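/- All curves are smooth complex projective curves, regarded as compact Riemann surfaces; coverings are finite holomorphic maps and may be ramified. Let $Y$ and $C$ be irreducible and let $p:C\overset{\pi}{\longrightarrow}C'\overset{g}{\longrightarrow}Y$ with $\deg\pi=2$, $\deg g=n$, and let $\mathfrak D\subset Y$ be the discriminant locus of $p$. Let $\epsilon_1,\dots,\epsilon_n$ be the standard basis of $\mathbb R^n$, let $s_\alpha$ be the reflection in the hyperplane orthogonal to $\alpha$, and call $\pm\epsilon_j$ short roots and $\pm\epsilon_j\pm\epsilon_k$ $(j<k)$ long roots. Let $W(B_n)$ be the group generated by the reflections in all roots, $W(D_n)$ the subgroup generated by the reflections in long roots, $G_1$ the subgroup generated by the $s_{\epsilon_i-\epsilon_j}$ $(i<j)$, and $N(G_1)$ the normalizer of $G_1$ in $W(B_n)$. These groups act faithfully on $\{\pm\epsilon_1,\dots,\pm\epsilon_n\}$, so that $W(B_n)\subset S_{2n}$. For $y_0\in Y\setminus\mathfrak D$ number the fibre $p^{-1}(y_0)$ by $\{\pm\epsilon_1,\dots,\pm\epsilon_n\}$ in such a way that the two points of each fibre of $\pi$ are numbered by opposite vectors, and let $G\subset S_{2n}$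 be the resulting monodromy group of $p$, i.e. the image of $\pi_1(Y\setminus\mathfrak D,y_0)$. Assume that $p$ is a simply ramified $B_n$-covering: $p$ is ramified, and the local monodromy at every point of $\mathfrak D$ is a reflection $s_\alpha$ in a root. Let $\mathfrak D_s\subset\mathfrak D$ be the set of points at which $\alpha$ is a short root. (1) Suppose that $g_*:\pi_1(C',*)\to\pi_1(Y,*)$ is surjective. If $\mathfrak D_s\neq\emptyset$, then $G=W(B_n)$. If $\mathfrak D_s=\emptyset$, then $G=W(B_n)$, or $G=W(D_n)$, or $n\ge 3$ and $G$ is conjugate in $W(B_n)$ to $N(G_1)$. For $n\ge 3$ and $\mathfrak D_s=\emptyset$ the last alternative holds if and only if $p=h\circ f$ for some holomorphic maps $f:C\to\tilde Y$ and $h:\tilde Y\to Y$, where $\tilde Y$ is an irreducible curve and $h$ is an étale covering of degree $2$. (2) Suppose that $Y\cong\mathbb P^1$ (without the hypothesis on $g_*$). If $\mathfrak D_s\neq\emptyset$, then $G=W(B_n)$. If $\mathfrak D_s=\emptyset$, then $G=W(D_n)$. -/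

import Mathlib

open scoped Manifold ContDiff Topology

universe u v w

noncomputable section

namespace BnCovering

/-! ### The root system of type `B_n` and its Weyl groups -/

/-- The euclidean space `ℝⁿ`. -/
abbrev V (n : ℕ) : Type := EuclideanSpace ℝ (Fin n)

/-- The standard basis vector `ε_j`. -/
def eps {n : ℕ} (j : Fin n) : V n := EuclideanSpace.single j (1 : ℝ)

/-- The short roots `± ε_j`. -/
def shortRoots (n : ℕ) : Set (V n) :=
  {a | ∃ j : Fin n, a = eps j ∨ a = -eps j}

/-- The long roots `± ε_j ± ε_k`, `j < k`. -/
def longRoots (n : ℕ) : Set (V n) :=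
  {a | ∃ j k : Fin n, j < k ∧
    (a = eps j + eps k ∨ a = eps j - eps k ∨ a = -eps j + eps k ∨ a = -eps j - eps k)}

/-- The reflection `s_α`, i.e. `x ↦ x - 2 (x|α) / (α|α) α`
(orthogonal reflection in the hyperplane orthogonal to `α`). -/
def refl {n : ℕ} (a : V n) : V n ≃ₗᵢ[ℝ] V n := (ℝ ∙ a)ᗮ.reflection

theorem refl_apply {n : ℕ} (a x : V n) :
    refl a x = x - (2 * (inner ℝ x a / inner ℝ a a)) • a := by
  have h := Submodule.reflection_orthogonal_apply (𝕜 := ℝ) (K := ℝ ∙ a) x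
  rw [refl, h, Submodule.reflection_singleton_apply, real_inner_self_eq_norm_sq,
    real_inner_comm a x]
  simp only [neg_sub, two_smul, mul_smul, RCLike.ofReal_real_eq_id, id_eq]

/-- The Weyl group `W(B_n)`, generated by the reflections in all roots. -/
def weylB (n : ℕ) : Subgroup (V n ≃ₗᵢ[ℝ] V n) :=
  Subgroup.closure (refl '' (shortRoots n ∪ longRoots n))

/-- The Weyl group `W(D_n)`, generated by the reflections in the long roots. -/
def weylD (n : ℕ) : Subgroup (V n ≃ₗᵢ[ℝ] V n) :=
  Subgroup.closure (refl '' longRoots n)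

/-- The group `G_1`, generated by the reflections `s_{ε_i - ε_j}`, `i < j`. -/
def groupG1 (n : ℕ) : Subgroup (V n ≃ₗᵢ[ℝ] V n) :=
  Subgroup.closure {s | ∃ i j : Fin n, i < j ∧ s = refl (eps i - eps j)}

/-- The normalizer `N(G_1)` of `G_1` in `W(B_n)`. -/
def normalizerG1 (n : ℕ) : Subgroup (V n ≃ₗᵢ[ℝ] V n) :=
  weylB n ⊓ Subgroup.normalizer (groupG1 n : Set (V n ≃ₗᵢ[ℝ] V n))

/-- The group of permutations of the set `{± ε_j}` of short roots that are induced by the elements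
of a group of isometries of `ℝⁿ`. In particular `permGroup (weylB n)` is `W(B_n) ⊂ S_{2n}`. -/
def permGroup {n : ℕ} (H : Subgroup (V n ≃ₗᵢ[ℝ] V n)) : Subgroup (Equiv.Perm (shortRoots n)) where
  carrier := {σ | ∃ s ∈ H, ∀ a : shortRoots n, (σ a : V n) = s a}
  mul_mem' := by
    rintro σ τ ⟨s, hs, h⟩ ⟨t, ht, h'⟩
    exact ⟨s * t, H.mul_mem hs ht, fun a => by simp [h, h']⟩
  one_mem' := ⟨1, H.one_mem, fun a => by simp⟩
  inv_mem' := by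
    rintro σ ⟨s, hs, h⟩
    refine ⟨s⁻¹, H.inv_mem hs, fun a => ?_⟩
    have h' : (a : V n) = s (σ⁻¹ a : shortRoots n) := by
      rw [← h]; exact congrArg Subtype.val (σ.apply_symm_apply a).symm
    rw [h']
    exact (s.symm_apply_apply _).symm

/-! ### Coverings of compact Riemann surfaces -/

section coverings

variable {X : Type u} {Y : Type v} [TopologicalSpace X] [ChartedSpace ℂ X]
  [TopologicalSpace Y] [ChartedSpace ℂ Y]

/-- Holomorphic maps of Riemann surfaces. -/
def IsHolomorphic (f : X → Y) : Prop := ContMDiff 𝓘(ℂ, ℂ) 𝓘(ℂ, ℂ) ω f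

/-- The discriminant locus: the images of the points where the derivative vanishes. -/
def discr (f : X → Y) : Set Y := f '' {x | mfderiv 𝓘(ℂ, ℂ) 𝓘(ℂ, ℂ) f x = 0}

/-- A (possibly ramified) covering of degree `d` of Riemann surfaces, i.e. a finite morphism of
degree `d`. -/
structure IsCovering (f : X → Y) (d : ℕ) : Prop where
  holomorphic : IsHolomorphic f
  finite_fibers : ∀ y, (f ⁻¹' {y}).Finite
  degree : ∀ y, y ∉ discr f → (f ⁻¹' {y}).ncard = d

theorem IsHolomorphic.comp {Z : Type w} [TopologicalSpace Z] [ChartedSpace ℂ Z]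
    {g : Y → Z} {f : X → Y} (hg : IsHolomorphic g) (hf : IsHolomorphic f) :
    IsHolomorphic (g ∘ f) :=
  ContMDiff.comp hg hf

theorem IsHolomorphic.continuous {f : X → Y} (hf : IsHolomorphic f) : Continuous f :=
  ContMDiff.continuous hf

/-- A holomorphic map is a local homeomorphism where its derivative does not vanish. -/
theorem IsHolomorphic.isLocalHomeomorphOn {f : X → Y} (hf : IsHolomorphic f) :
    IsLocalHomeomorphOn f {x | mfderiv 𝓘(ℂ, ℂ) 𝓘(ℂ, ℂ) f x ≠ 0} := by
  refine IsLocalHomeomorphOn.mk f _ fun x hx => ?_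
  set φ := chartAt ℂ x with hφ
  set ψ := chartAt ℂ (f x) with hψ
  obtain ⟨-, hF⟩ := contMDiffAt_iff.1 (hf x)
  have hmd := (hf x).mdifferentiableAt (by simp)
  set F : ℂ → ℂ := ψ ∘ f ∘ φ.symm with hFdef
  have hF' : ContDiffAt ℂ ω F (φ x) := by
    rw [← contDiffWithinAt_univ]
    simpa [mfld_simps] using hF
  have hne : deriv F (φ x) ≠ 0 := by
    intro h0
    apply hx
    have h1 : fderiv ℂ F (φ x) = 0 := by
      ext
      simpa using h0
    rw [hmd.mfderiv]
    simp only [mfld_simps, fderivWithin_univ]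
    exact h1
  have hs := (hF'.hasStrictDerivAt (by simp)).hasStrictFDerivAt_equiv hne
  set E := hs.toOpenPartialHomeomorph F with hE
  have hmem : φ x ∈ E.source := hs.mem_toOpenPartialHomeomorph_source
  have hEF : ∀ z, E z = F z := fun z => rfl
  have hopen : IsOpen (f ⁻¹' ψ.source) := ψ.open_source.preimage hf.continuous
  refine ⟨((φ.trans E).trans ψ.symm).restrOpen _ hopen, ?_, ?_⟩
  · simp only [mfld_simps]
    refine ⟨⟨⟨mem_chart_source ℂ x, hmem⟩, ?_⟩, mem_chart_source ℂ (f x)⟩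
    rw [hEF]
    simp [hFdef, hφ, hψ]
  · intro y hy
    simp only [mfld_simps] at hy
    obtain ⟨⟨⟨hy1, hy2⟩, hy3⟩, hy4⟩ := hy
    change f y = ψ.symm (ψ (f (φ.symm (φ y))))
    rw [φ.left_inv hy1, ψ.left_inv hy4]

/-- A holomorphic map of compact Riemann surfaces is an unramified topological covering over the
complement of the discriminant locus. -/
theorem IsHolomorphic.isCoveringMap [T2Space X] [CompactSpace X] [T2Space Y]
    {f : X → Y} (hf : IsHolomorphic f) :
    IsCoveringMap ((discr f)ᶜ.restrictPreimage f) := by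
  refine (IsCoveringMapOn.of_isLocalHomeomorphOn hf.continuous ?_).isCoveringMap_restrictPreimage
  intro x hx
  exact hf.isLocalHomeomorphOn x fun h => hx ⟨x, h, rfl⟩

/-- The fibre of `f` over a point `y₀` outside the discriminant locus. -/
abbrev Fibre (f : X → Y) (y₀ : ↥(discr f)ᶜ) : Type u :=
  ↥((discr f)ᶜ.restrictPreimage f ⁻¹' {y₀})

/-- The monodromy homomorphism `π₁(Y ∖ D, y₀) → S(f⁻¹(y₀))`. -/
def monodromy [T2Space X] [CompactSpace X] [T2Space Y]
    {f : X → Y} (hf : IsHolomorphic f) (y₀ : ↥(discr f)ᶜ) :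
    FundamentalGroup ↥(discr f)ᶜ y₀ →* Equiv.Perm (Fibre f y₀) :=
  hf.isCoveringMap.monodromyPerm y₀

/-- `γ` is a small positively oriented circle around `b`: in the chart at `b` it is
`t ↦ b + r exp(2πit)`, and the closed disc of radius `r` contains no point of `D` except
possibly `b`. -/
def IsCircleAround {D : Set Y} (b : Y) {y : ↥Dᶜ} (γ : Path y y) : Prop :=
  ∃ r : ℝ, 0 < r ∧
    Metric.closedBall (chartAt ℂ b b) r ⊆ (chartAt ℂ b).target ∧
    (∀ z ∈ Metric.closedBall (chartAt ℂ b b) r, (chartAt ℂ b).symm z ∈ D → z = chartAt ℂ b b) ∧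
    ∀ t : unitInterval, (γ t : Y) =
      (chartAt ℂ b).symm (chartAt ℂ b b + r * Complex.exp (2 * Real.pi * Complex.I * (t : ℝ)))

/-- `σ` is a local monodromy of `f` at `b`: the monodromy of a loop `δ γ δ⁻¹` in `Y ∖ D`, where
`δ` is a path from `y₀` to a point near `b` and `γ` is a small circle around `b`. -/
def IsLocalMonodromy [T2Space X] [CompactSpace X] [T2Space Y]
    {f : X → Y} (hf : IsHolomorphic f) (y₀ : ↥(discr f)ᶜ) (b : Y)
    (σ : Equiv.Perm (Fibre f y₀)) : Prop :=
  ∃ (y : ↥(discr f)ᶜ) (δ : Path y₀ y) (γ : Path y y), IsCircleAround b γ ∧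
    σ = monodromy hf y₀
      (FundamentalGroup.fromPath (Path.Homotopic.Quotient.mk ((δ.trans γ).trans δ.symm)))

/-- Surjectivity of `f_* : π₁(X, *) → π₁(Y, *)` (for some base point). -/
def SurjectiveOnPi1 {f : X → Y} (hf : Continuous f) : Prop :=
  ∃ x : X, Function.Surjective (FundamentalGroup.map (⟨f, hf⟩ : C(X, Y)) x)

end coverings

/-! ### Coverings of type `B_n` -/

section typeB

variable {C : Type u} {C' : Type v} {Y : Type w}
  [TopologicalSpace C] [ChartedSpace ℂ C] [TopologicalSpace C'] [ChartedSpace ℂ C']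
  [TopologicalSpace Y] [ChartedSpace ℂ Y]

/-- A numbering of the fibre of `p = g ∘ π` over `y₀` by `{± ε_j}` under which the involution of
`C` over `C'` becomes `-id`: the two points of a fibre of `π` are numbered by `a` and `-a`. -/
structure Numbering (n : ℕ) (π : C → C') (g : C' → Y) (y₀ : ↥(discr (g ∘ π))ᶜ) where
  toEquiv : Fibre (g ∘ π) y₀ ≃ shortRoots n
  map_involution : ∀ x x' : Fibre (g ∘ π) y₀, x ≠ x' → π x.1.1 = π x'.1.1 →
    (toEquiv x' : V n) = -(toEquiv x : V n)

variable [T2Space C] [CompactSpace C] [T2Space Y] {n : ℕ} {π : C → C'} {g : C' → Y}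

/-- The monodromy group of `p = g ∘ π` as a subgroup of the group `S_{2n}` of permutations of
`{± ε_j}`. -/
def monodromyGroup (hp : IsHolomorphic (g ∘ π)) {y₀ : ↥(discr (g ∘ π))ᶜ}
    (L : Numbering n π g y₀) : Subgroup (Equiv.Perm (shortRoots n)) :=
  (monodromy hp y₀).range.map (L.toEquiv.permCongrHom : _ →* Equiv.Perm (shortRoots n))

/-- The points of the discriminant locus of `p = g ∘ π` at which the local monodromy is a
reflection `s_α` with `α` in the given set of roots. -/
def discrOfType (hp : IsHolomorphic (g ∘ π)) {y₀ : ↥(discr (g ∘ π))ᶜ}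
    (L : Numbering n π g y₀) (R : Set (V n)) : Set Y :=
  {b ∈ discr (g ∘ π) | ∃ σ, IsLocalMonodromy hp y₀ b σ ∧
    ∃ a ∈ R, ∀ x, (L.toEquiv (σ x) : V n) = refl a (L.toEquiv x)}

/-- The set `D_s`: the local monodromy is a reflection in a short root. -/
def discrShort (hp : IsHolomorphic (g ∘ π)) {y₀ : ↥(discr (g ∘ π))ᶜ}
    (L : Numbering n π g y₀) : Set Y :=
  discrOfType hp L (shortRoots n)

/-- The covering `p = g ∘ π` is simply ramified of type `B_n`: it is ramified, and the local
monodromy at every discriminant point is a reflection in `W(B_n)`. -/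
def IsSimplyRamified (hp : IsHolomorphic (g ∘ π)) {y₀ : ↥(discr (g ∘ π))ᶜ}
    (L : Numbering n π g y₀) : Prop :=
  (discr (g ∘ π)).Nonempty ∧
    ∀ b ∈ discr (g ∘ π), b ∈ discrOfType hp L (shortRoots n ∪ longRoots n)

/-- `p : C → Y` factors as `C → Z → Y` through a connected étale double covering `h : Z → Y`. -/
def FactorsThroughEtaleDouble (p : C → Y) : Prop :=
  ∃ (Z : Type u) (_ : TopologicalSpace Z) (_ : ChartedSpace ℂ Z),
    IsManifold 𝓘(ℂ, ℂ) ω Z ∧ T2Space Z ∧ CompactSpace Z ∧ ConnectedSpace Z ∧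
    ∃ (f : C → Z) (h : Z → Y), IsHolomorphic f ∧ IsCovering h 2 ∧ discr h = ∅ ∧ h ∘ f = p

/-- `G` is, inside `W(B_n)`, conjugate to `N(G_1)`. -/
def IsConjNormalizerG1 (G : Subgroup (Equiv.Perm (shortRoots n))) : Prop :=
  ∃ s ∈ weylB n, G = permGroup ((normalizerG1 n).map (MulAut.conj s).toMonoidHom)

end typeB

/-! ### The projective line -/

/-- The inversion `z ↦ 1/z` of the Riemann sphere, exchanging `0` and `∞`. -/
def sphereInvFun : OnePoint ℂ → OnePoint ℂ
  | OnePoint.infty => ((0 : ℂ) : OnePoint ℂ)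
  | OnePoint.some z => if z = 0 then OnePoint.infty else ((z⁻¹ : ℂ) : OnePoint ℂ)

theorem sphereInvFun_infty : sphereInvFun OnePoint.infty = ((0 : ℂ) : OnePoint ℂ) := rfl

theorem sphereInvFun_zero : sphereInvFun ((0 : ℂ) : OnePoint ℂ) = OnePoint.infty :=
  if_pos rfl

theorem sphereInvFun_coe {z : ℂ} (hz : z ≠ 0) :
    sphereInvFun (z : OnePoint ℂ) = ((z⁻¹ : ℂ) : OnePoint ℂ) :=
  if_neg hz

theorem sphereInvFun_invol (x : OnePoint ℂ) : sphereInvFun (sphereInvFun x) = x := by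
  induction x using OnePoint.rec with
  | infty => rw [sphereInvFun_infty, sphereInvFun_zero]
  | coe z =>
    by_cases hz : z = 0
    · rw [hz, sphereInvFun_zero, sphereInvFun_infty]
    · rw [sphereInvFun_coe hz, sphereInvFun_coe (inv_ne_zero hz), inv_inv]

theorem continuous_sphereInvFun : Continuous sphereInvFun := by
  rw [continuous_iff_continuousAt]
  intro x
  induction x using OnePoint.rec with
  | infty =>
    rw [OnePoint.continuousAt_infty', sphereInvFun_infty, Filter.coclosedCompact_eq_cocompact,
      ← Metric.cobounded_eq_cocompact]
    have h : Filter.Tendsto (fun z : ℂ => ((z⁻¹ : ℂ) : OnePoint ℂ)) (Bornology.cobounded ℂ)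
        (𝓝 ((0 : ℂ) : OnePoint ℂ)) :=
      (OnePoint.continuous_coe.tendsto 0).comp Filter.tendsto_inv₀_cobounded
    refine h.congr' ?_
    filter_upwards [Bornology.eventually_ne_cobounded (0 : ℂ)] with z hz
    exact (sphereInvFun_coe hz).symm
  | coe z =>
    rw [OnePoint.continuousAt_coe]
    by_cases hz : z = 0
    · subst hz
      rw [continuousAt_iff_punctured_nhds]
      have h : Filter.Tendsto (fun z : ℂ => ((z⁻¹ : ℂ) : OnePoint ℂ)) (𝓝[≠] 0)
          (𝓝 (OnePoint.infty : OnePoint ℂ)) := by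
        refine OnePoint.tendsto_coe_infty.comp ?_
        rw [Filter.coclosedCompact_eq_cocompact, ← Metric.cobounded_eq_cocompact]
        exact Filter.tendsto_inv₀_nhdsNE_zero
      simp only [Function.comp_apply, sphereInvFun_zero]
      refine h.congr' ?_
      filter_upwards [self_mem_nhdsWithin] with z hz
      exact (sphereInvFun_coe hz).symm
    · have h : ContinuousAt (fun z : ℂ => ((z⁻¹ : ℂ) : OnePoint ℂ)) z :=
        OnePoint.continuous_coe.continuousAt.comp (continuousAt_inv₀ hz)
      refine h.congr ?_
      filter_upwards [isOpen_ne.mem_nhds hz] with w hw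
      exact (sphereInvFun_coe hw).symm

/-- The inversion of the Riemann sphere as a homeomorphism. -/
def sphereInv : OnePoint ℂ ≃ₜ OnePoint ℂ where
  toFun := sphereInvFun
  invFun := sphereInvFun
  left_inv := sphereInvFun_invol
  right_inv := sphereInvFun_invol
  continuous_toFun := continuous_sphereInvFun
  continuous_invFun := continuous_sphereInvFun

/-- The affine chart `z` of the Riemann sphere, defined on `ℂ`. -/
def sphereChart : OpenPartialHomeomorph (OnePoint ℂ) ℂ :=
  (OnePoint.isOpenEmbedding_coe.toOpenPartialHomeomorph ((↑) : ℂ → OnePoint ℂ)).symm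

/-- The chart `1/z` of the Riemann sphere at `∞`. -/
def sphereChartInfty : OpenPartialHomeomorph (OnePoint ℂ) ℂ :=
  sphereInv.toOpenPartialHomeomorph.trans sphereChart

theorem sphereChart_source : sphereChart.source = Set.range ((↑) : ℂ → OnePoint ℂ) := by
  simp [sphereChart]

theorem sphereChart_coe (z : ℂ) : sphereChart (z : OnePoint ℂ) = z :=
  OnePoint.isOpenEmbedding_coe.toOpenPartialHomeomorph_left_inv _

theorem sphereChart_symm (z : ℂ) : sphereChart.symm z = (z : OnePoint ℂ) := by
  simp [sphereChart]

open Classical in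
/-- The complex structure of the projective line `ℙ¹ = ℂ ∪ {∞}`, with the two charts `z` and
`1/z`. -/
instance sphereChartedSpace : ChartedSpace ℂ (OnePoint ℂ) where
  atlas := {sphereChart, sphereChartInfty}
  chartAt x := if x = OnePoint.infty then sphereChartInfty else sphereChart
  mem_chart_source x := by
    induction x using OnePoint.rec with
    | infty =>
      rw [if_pos rfl]
      simp only [sphereChartInfty, mfld_simps, sphereChart_source]
      exact ⟨0, rfl⟩
    | coe z =>
      rw [if_neg (OnePoint.coe_ne_infty z), sphereChart_source]
      exact ⟨z, rfl⟩
  chart_mem_atlas x := by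
    split_ifs <;> simp

theorem sphere_transition :
    ContDiffOn ℂ ω (sphereChart ∘ sphereInvFun ∘ sphereChart.symm)
      {z | sphereInvFun (sphereChart.symm z) ∈ sphereChart.source} := by
  have hne : ∀ z, sphereInvFun (sphereChart.symm z) ∈ sphereChart.source → z ≠ 0 := by
    rintro z hz rfl
    rw [sphereChart_symm, sphereChart_source, sphereInvFun_zero] at hz
    exact OnePoint.infty_notMem_range_coe hz
  refine ContDiffOn.congr (f := fun z => z⁻¹) ?_ fun z hz => ?_
  · exact fun z hz => (contDiffAt_inv ℂ (hne z hz)).contDiffWithinAt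
  · simp only [Function.comp_apply, sphereChart_symm]
    rw [sphereInvFun_coe (hne z hz), sphereChart_coe]

instance sphereIsManifold : IsManifold 𝓘(ℂ, ℂ) ω (OnePoint ℂ) := by
  have hT : sphereChart.target = Set.univ := by simp [sphereChart]
  apply isManifold_of_contDiffOn
  intro e e' he he'
  rcases he with rfl | rfl <;> rcases he' with rfl | rfl
  · refine contDiffOn_id.congr fun z hz => ?_
    simp only [mfld_simps] at hz ⊢
    rw [sphereChart_symm, sphereChart_coe]
  · refine (sphere_transition.congr fun z hz => ?_).mono fun z hz => ?_
    · rfl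
    · simp only [mfld_simps, sphereChartInfty] at hz
      exact hz.2
  · refine (sphere_transition.congr fun z hz => ?_).mono fun z hz => ?_
    · rfl
    · simp only [mfld_simps, sphereChartInfty] at hz
      exact hz.2
  · refine contDiffOn_id.congr fun z hz => ?_
    simp only [mfld_simps] at hz ⊢
    exact sphereChartInfty.right_inv hz.1

/-- `Y` is isomorphic to the projective line, as a Riemann surface. -/
def IsProjectiveLine (Y : Type w) [TopologicalSpace Y] [ChartedSpace ℂ Y] : Prop :=
  ∃ e : Y ≃ₜ OnePoint ℂ, IsHolomorphic e ∧ IsHolomorphic e.symm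

end BnCovering
end

noncomputable section

namespace BnCovering

open Set

/-! ### Reflections in the roots of `B_n` -/

section roots

variable {n : ℕ}

/-! The monodromy of p covers that of g, so it commutes with -1 on the numbered fibre and is given
by a homomorphism `θ` from π₁(Y ∖ D, y₀) to W(B_n) (`Numbering.exists_hom`). Its image G need not be
generated by reflections. The proof therefore works with a normal subgroup K of π₁(Y ∖ D, y₀),
generated by small loops around points of Y whose images are reflections
(`exists_reflectionSubgroup`). Then θ(K) is a reflection group normalized by G.

A normal subgroup containing a small loop around each branch point corresponds to something
unramified: its orbits on a fibre of g define a topological covering of Y through which g factors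
(`exists_etale_quotient`). If g_* is surjective, this covering has one sheet, so θ(K) permutes the
pairs ±ε_i transitively. Over ℙ¹ every covering has sections, so K is the whole fundamental group
(`eq_top_of_sections`) and transitivity comes from the connectedness of C.

The rest is a classification. In a pair-transitive group generated by root reflections, any two
orthogonal short roots are exchanged, up to sign, by a reflection of the group
(`linked_of_pairTransitive`). A short reflection then produces W(B_n) (`weylB_le_of_short`). If all
generators are long, either some pair a, b has both reflections s_{a-b} and s_{a+b}, and W(D_n) is
contained in θ(K), or suitable signs turn θ(K) into G₁ (`weylD_le_or_eq_conj`). In the first case G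
is W(D_n) or W(B_n) by the index. In the second, G normalizes a conjugate of G₁ and is transitive on
short roots because C is connected, so G is the conjugate of N(G₁) (`eq_conj_normalizerG1`). Over ℙ¹
the second case is impossible, since G = θ(K) would preserve signs.

N(G₁) permutes the two blocks {ε_i} and {-ε_i}. For n ≥ 3 its long reflections lie in G₁ and fix the
blocks, so the blocks define an étale double covering through which p factors. Conversely, small
loops act trivially on the fibres of an étale covering. If θ(K) contained W(D_n), which is
transitive on short roots, a fibre of p would map to a single point of the étale double covering,
contrary to its connectedness. -/

theorem inner_eps (i j : Fin n) : inner ℝ (eps i) (eps j) = if i = j then (1 : ℝ) else 0 := by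
  simp [eps, EuclideanSpace.inner_single_left]

theorem eps_ne_zero (i : Fin n) : eps i ≠ 0 := fun h => by
  have := inner_eps i i
  simp [h] at this

theorem eps_injective : Function.Injective (eps : Fin n → V n) := fun i j h => by
  by_contra hne
  have := inner_eps i j
  rw [h, inner_eps] at this
  simp [hne] at this

theorem eps_ne_neg (i j : Fin n) : eps i ≠ -eps j := fun h => by
  have := inner_eps i j
  rw [h, inner_neg_left, inner_eps] at this
  by_cases hij : i = j
  · norm_num [hij] at this
  · have h1 := inner_eps i i
    nth_rw 1 [h] at h1
    rw [inner_neg_left, inner_eps] at h1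
    simp [Ne.symm hij] at h1

theorem eps_mem_shortRoots (i : Fin n) : eps i ∈ shortRoots n := ⟨i, Or.inl rfl⟩

theorem neg_mem_shortRoots {a : V n} (ha : a ∈ shortRoots n) : -a ∈ shortRoots n := by
  obtain ⟨j, rfl | rfl⟩ := ha
  · exact ⟨j, Or.inr rfl⟩
  · exact ⟨j, Or.inl (neg_neg _)⟩

theorem inner_self_of_mem_shortRoots {a : V n} (ha : a ∈ shortRoots n) : inner ℝ a a = (1 : ℝ) := by
  obtain ⟨j, rfl | rfl⟩ := ha
  · rw [inner_eps, if_pos rfl]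
  · rw [inner_neg_neg, inner_eps, if_pos rfl]

theorem neg_ne_of_mem_shortRoots {a : V n} (ha : a ∈ shortRoots n) : -a ≠ a := fun h => by
  have h1 := inner_self_of_mem_shortRoots ha
  have h2 : inner ℝ (-a) a = (1 : ℝ) := by rw [h, h1]
  rw [inner_neg_left, h1] at h2
  norm_num at h2

theorem eq_or_eq_neg_or_inner_eq_zero {a b : V n} (ha : a ∈ shortRoots n) (hb : b ∈ shortRoots n) :
    b = a ∨ b = -a ∨ inner ℝ a b = (0 : ℝ) := by
  obtain ⟨i, rfl | rfl⟩ := ha <;> obtain ⟨j, rfl | rfl⟩ := hb <;> by_cases hij : i = j <;>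
    simp [hij, inner_eps]

theorem mem_longRoots_iff {d : V n} : d ∈ longRoots n ↔
    ∃ a ∈ shortRoots n, ∃ b ∈ shortRoots n, inner ℝ a b = (0 : ℝ) ∧ d = a - b := by
  constructor
  · rintro ⟨j, k, hjk, h⟩
    have h0 : inner ℝ (eps j) (eps k) = (0 : ℝ) := by simp [inner_eps, hjk.ne]
    rcases h with rfl | rfl | rfl | rfl
    · exact ⟨_, ⟨j, Or.inl rfl⟩, _, ⟨k, Or.inr rfl⟩, by simp [h0], by abel⟩
    · exact ⟨_, ⟨j, Or.inl rfl⟩, _, ⟨k, Or.inl rfl⟩, h0, rfl⟩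
    · exact ⟨_, ⟨j, Or.inr rfl⟩, _, ⟨k, Or.inr rfl⟩, by simp [h0], by abel⟩
    · exact ⟨_, ⟨j, Or.inr rfl⟩, _, ⟨k, Or.inl rfl⟩, by simp [h0], rfl⟩
  · rintro ⟨a, ⟨j, hj⟩, b, ⟨k, hk⟩, h0, rfl⟩
    have hjk : j ≠ k := by
      rintro rfl
      rcases hj with rfl | rfl <;> rcases hk with rfl | rfl <;>
        simp [eps_ne_zero] at h0
    rcases lt_or_gt_of_ne hjk with h | h
    · refine ⟨j, k, h, ?_⟩
      rcases hj with rfl | rfl <;> rcases hk with rfl | rfl <;> simp [sub_eq_add_neg]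
    · refine ⟨k, j, h, ?_⟩
      rcases hj with rfl | rfl <;> rcases hk with rfl | rfl <;>
        simp [sub_eq_add_neg, add_comm (eps j), add_comm (-eps j)]

theorem refl_neg (a : V n) : refl (-a) = refl a := by
  ext1 x
  rw [refl_apply, refl_apply, inner_neg_right, inner_neg_neg, neg_div, mul_neg, smul_neg, neg_smul,
    neg_neg]

theorem refl_sub_comm (a b : V n) : refl (a - b) = refl (b - a) := by
  rw [← refl_neg, neg_sub]

/-- An isometry carries the hyperplane orthogonal to a to the one orthogonal to s a. All new
reflections in a generated group are obtained from this identity. -/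
theorem refl_conj (s : V n ≃ₗᵢ[ℝ] V n) (a : V n) : s * refl a * s⁻¹ = refl (s a) := by
  ext1 x
  have h : ∀ y, inner ℝ (s⁻¹ x) y = inner ℝ x (s y) := fun y => by
    rw [← s.inner_map_map]
    congr 1
    exact s.apply_symm_apply x
  change s (refl a (s⁻¹ x)) = _
  rw [refl_apply, refl_apply, map_sub, map_smul, h, s.inner_map_map]
  congr 1
  exact s.apply_symm_apply x

theorem refl_inv (a : V n) : (refl a)⁻¹ = refl a :=
  LinearIsometryEquiv.ext fun _ => rfl

theorem refl_apply_of_inner_eq_zero {a x : V n} (h : inner ℝ a x = (0 : ℝ)) : refl a x = x := by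
  rw [refl_apply, real_inner_comm, h]; simp

theorem refl_apply_self {a : V n} (ha : a ∈ shortRoots n) : refl a a = -a := by
  rw [refl_apply, inner_self_of_mem_shortRoots ha, div_one, mul_one, two_smul]; abel

theorem refl_sub_apply_left {a b : V n} (ha : a ∈ shortRoots n) (hb : b ∈ shortRoots n)
    (h : inner ℝ a b = (0 : ℝ)) : refl (a - b) a = b := by
  have h' : inner ℝ b a = (0 : ℝ) := by rw [real_inner_comm, h]
  rw [refl_apply]
  simp only [inner_sub_left, inner_sub_right, h, h', inner_self_of_mem_shortRoots ha,
    inner_self_of_mem_shortRoots hb]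
  norm_num

theorem refl_sub_apply_right {a b : V n} (ha : a ∈ shortRoots n) (hb : b ∈ shortRoots n)
    (h : inner ℝ a b = (0 : ℝ)) : refl (a - b) b = a := by
  rw [refl_sub_comm, refl_sub_apply_left hb ha (by rw [real_inner_comm, h])]

theorem refl_sub_apply_of_inner {a b x : V n} (ha : inner ℝ a x = (0 : ℝ))
    (hb : inner ℝ b x = (0 : ℝ)) : refl (a - b) x = x :=
  refl_apply_of_inner_eq_zero (by rw [inner_sub_left, ha, hb, sub_zero])

theorem isometry_ext {s t : V n ≃ₗᵢ[ℝ] V n} (h : ∀ i, s (eps i) = t (eps i)) : s = t := by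
  have : s.toLinearEquiv.toLinearMap = t.toLinearEquiv.toLinearMap := by
    refine (EuclideanSpace.basisFun (Fin n) ℝ).toBasis.ext fun i => ?_
    simpa [eps] using h i
  exact LinearIsometryEquiv.ext fun x => LinearMap.congr_fun this x

theorem refl_mem_weylB_of_short {a : V n} (ha : a ∈ shortRoots n) : refl a ∈ weylB n :=
  Subgroup.subset_closure ⟨a, Or.inl ha, rfl⟩

theorem refl_sub_mem_weylD {a b : V n} (ha : a ∈ shortRoots n) (hb : b ∈ shortRoots n)
    (h : inner ℝ a b = (0 : ℝ)) : refl (a - b) ∈ weylD n :=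
  Subgroup.subset_closure ⟨_, mem_longRoots_iff.2 ⟨a, ha, b, hb, h, rfl⟩, rfl⟩

theorem weylD_le_weylB : weylD n ≤ weylB n :=
  Subgroup.closure_mono (image_mono subset_union_right)

theorem groupG1_le_weylD : groupG1 n ≤ weylD n := by
  refine (Subgroup.closure_le _).2 ?_
  rintro _ ⟨i, j, hij, rfl⟩
  exact refl_sub_mem_weylD (eps_mem_shortRoots i) (eps_mem_shortRoots j)
    (by simp [inner_eps, hij.ne])

theorem refl_eps_sub_mem_groupG1 {i j : Fin n} (h : i ≠ j) : refl (eps i - eps j) ∈ groupG1 n := by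
  rcases lt_or_gt_of_ne h with h | h
  · exact Subgroup.subset_closure ⟨i, j, h, rfl⟩
  · rw [refl_sub_comm]
    exact Subgroup.subset_closure ⟨j, i, h, rfl⟩

theorem refl_apply_mem_shortRoots {d a : V n} (hd : d ∈ shortRoots n ∪ longRoots n)
    (ha : a ∈ shortRoots n) : refl d a ∈ shortRoots n := by
  rcases hd with hd | hd
  · rcases eq_or_eq_neg_or_inner_eq_zero hd ha with rfl | rfl | h
    · rw [refl_apply_self hd]; exact neg_mem_shortRoots hd
    · rw [map_neg, refl_apply_self hd, neg_neg]; exact hd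
    · rwa [refl_apply_of_inner_eq_zero h]
  · obtain ⟨b, hb, c, hc, h0, rfl⟩ := mem_longRoots_iff.1 hd
    rcases eq_or_eq_neg_or_inner_eq_zero hb ha with rfl | rfl | h
    · rwa [refl_sub_apply_left hb hc h0]
    · rw [map_neg, refl_sub_apply_left hb hc h0]; exact neg_mem_shortRoots hc
    · rcases eq_or_eq_neg_or_inner_eq_zero hc ha with rfl | rfl | h'
      · rwa [refl_sub_apply_right hb hc h0]
      · rw [map_neg, refl_sub_apply_right hb hc h0]; exact neg_mem_shortRoots hb
      · rwa [refl_sub_apply_of_inner h h']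

theorem apply_mem_shortRoots {s : V n ≃ₗᵢ[ℝ] V n} (hs : s ∈ weylB n) {a : V n}
    (ha : a ∈ shortRoots n) : s a ∈ shortRoots n := by
  induction hs using Subgroup.closure_induction'' generalizing a with
  | mem x hx => obtain ⟨d, hd, rfl⟩ := hx; exact refl_apply_mem_shortRoots hd ha
  | inv_mem x hx =>
    obtain ⟨d, hd, rfl⟩ := hx
    rw [refl_inv]; exact refl_apply_mem_shortRoots hd ha
  | one => exact ha
  | mul x y _ _ hx hy => exact hx (hy ha)

theorem exists_mem_groupG1_apply_eps (τ : Equiv.Perm (Fin n)) :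
    ∃ s ∈ groupG1 n, ∀ i, s (eps i) = eps (τ i) := by
  induction τ using Equiv.Perm.swap_induction_on with
  | one => exact ⟨1, one_mem _, fun i => rfl⟩
  | swap_mul f x y hxy ih =>
    obtain ⟨s, hs, h⟩ := ih
    refine ⟨refl (eps x - eps y) * s, mul_mem (refl_eps_sub_mem_groupG1 hxy) hs, fun i => ?_⟩
    change refl (eps x - eps y) (s (eps i)) = _
    rw [h, Equiv.Perm.mul_apply]
    have h0 : inner ℝ (eps x) (eps y) = (0 : ℝ) := by simp [inner_eps, hxy]
    by_cases h1 : f i = x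
    · rw [h1, Equiv.swap_apply_left,
        refl_sub_apply_left (eps_mem_shortRoots x) (eps_mem_shortRoots y) h0]
    · by_cases h2 : f i = y
      · rw [h2, Equiv.swap_apply_right,
          refl_sub_apply_right (eps_mem_shortRoots x) (eps_mem_shortRoots y) h0]
      · rw [Equiv.swap_apply_of_ne_of_ne h1 h2, refl_sub_apply_of_inner]
        · simp [inner_eps, Ne.symm h1]
        · simp [inner_eps, Ne.symm h2]

theorem exists_mem_weylB_apply_eps_sign (e : Fin n → V n) (he : ∀ i, e i = eps i ∨ e i = -eps i) :
    ∃ s ∈ weylB n, ∀ i, s (eps i) = e i := by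
  classical
  have key : ∀ F : Finset (Fin n), ∃ s ∈ weylB n,
      ∀ i, s (eps i) = if i ∈ F then -eps i else eps i := by
    intro F
    induction F using Finset.induction_on with
    | empty => exact ⟨1, one_mem _, fun i => by simp⟩
    | insert j F hj ih =>
      obtain ⟨s, hs, h⟩ := ih
      refine ⟨s * refl (eps j), mul_mem hs (refl_mem_weylB_of_short (eps_mem_shortRoots j)),
        fun i => ?_⟩
      change s (refl (eps j) (eps i)) = _
      by_cases hij : i = j
      · subst hij
        rw [refl_apply_self (eps_mem_shortRoots i), map_neg, h]
        simp [hj]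
      · rw [refl_apply_of_inner_eq_zero (by simp [inner_eps, Ne.symm hij]), h]
        simp [hij]
  obtain ⟨s, hs, h⟩ := key (Finset.univ.filter fun i => e i = -eps i)
  refine ⟨s, hs, fun i => ?_⟩
  rw [h]
  rcases he i with h1 | h1
  · simp [h1, eps_ne_neg]
  · simp [h1]

/-- A permutation of the short roots that commutes with `-1` is induced by an element
of `W(B_n)`. -/
theorem exists_mem_weylB_of_perm (σ : Equiv.Perm (shortRoots n))
    (hσ : ∀ a b : shortRoots n, (b : V n) = -a → (σ b : V n) = -σ a) :
    ∃ s ∈ weylB n, ∀ a : shortRoots n, (σ a : V n) = s a := by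
  have h : ∀ i : Fin n, ∃ j : Fin n, (σ ⟨eps i, eps_mem_shortRoots i⟩ : V n) = eps j ∨
      (σ ⟨eps i, eps_mem_shortRoots i⟩ : V n) = -eps j := fun i =>
    (σ ⟨eps i, eps_mem_shortRoots i⟩).2
  choose τ hτ using h
  have hneg : ∀ i, (σ ⟨-eps i, neg_mem_shortRoots (eps_mem_shortRoots i)⟩ : V n) =
      -σ ⟨eps i, eps_mem_shortRoots i⟩ := fun i => hσ _ _ rfl
  have hinj : Function.Injective τ := by
    intro i j hij
    have h1 : (σ ⟨eps i, eps_mem_shortRoots i⟩ : V n) = σ ⟨eps j, eps_mem_shortRoots j⟩ ∨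
        (σ ⟨eps i, eps_mem_shortRoots i⟩ : V n) =
          σ ⟨-eps j, neg_mem_shortRoots (eps_mem_shortRoots j)⟩ := by
      rw [hneg]
      have hi := hτ i
      have hj := hτ j
      rw [hij] at hi
      rcases hi with hi | hi <;> rcases hj with hj | hj <;> rw [hi, hj] <;> simp
    rcases h1 with h1 | h1
    · exact eps_injective (congrArg Subtype.val (σ.injective (Subtype.ext h1)))
    · exact absurd (congrArg Subtype.val (σ.injective (Subtype.ext h1))) (eps_ne_neg i j)
  -- The signed permutation is split into a permutation of the indices, realized in G₁, followed by
  -- a change of signs.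
  let τ' : Equiv.Perm (Fin n) := Equiv.ofBijective τ (Finite.injective_iff_bijective.1 hinj)
  obtain ⟨s₁, hs₁, h₁⟩ := exists_mem_groupG1_apply_eps τ'
  obtain ⟨s₂, hs₂, h₂⟩ := exists_mem_weylB_apply_eps_sign
    (fun j => (σ ⟨eps (τ'.symm j), eps_mem_shortRoots _⟩ : V n)) (fun j => by
      have := hτ (τ'.symm j)
      rwa [show τ (τ'.symm j) = j from τ'.apply_symm_apply j] at this)
  have h3 : ∀ i, (s₂ * s₁) (eps i) = σ ⟨eps i, eps_mem_shortRoots i⟩ := by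
    intro i
    change s₂ (s₁ (eps i)) = _
    rw [h₁, h₂]
    simp only [Equiv.symm_apply_apply]
  refine ⟨s₂ * s₁, mul_mem hs₂ (weylD_le_weylB (groupG1_le_weylD hs₁)), ?_⟩
  rintro ⟨a, i, rfl | rfl⟩
  · rw [h3]
  · rw [map_neg, h3, ← hneg]

end roots

/-! ### Subgroups of `W(B_n)` generated by reflections -/

section groups

variable {n : ℕ}

/-- `N` acts transitively on the pairs `{ε_i, -ε_i}`. -/
def PairTransitive (N : Subgroup (V n ≃ₗᵢ[ℝ] V n)) : Prop :=
  ∀ i j : Fin n, ∃ s ∈ N, s (eps i) = eps j ∨ s (eps i) = -eps j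

/-- `a` and `b` agree up to sign, or `N` contains a reflection interchanging them up to sign. -/
def Linked (N : Subgroup (V n ≃ₗᵢ[ℝ] V n)) (a b : V n) : Prop :=
  b = a ∨ b = -a ∨ refl (a - b) ∈ N ∨ refl (a + b) ∈ N

variable {N : Subgroup (V n ≃ₗᵢ[ℝ] V n)} {a b c : V n}

theorem Linked.symm (h : Linked N a b) : Linked N b a := by
  rcases h with h | h | h | h
  · exact Or.inl h.symm
  · exact Or.inr (Or.inl (by rw [h, neg_neg]))
  · exact Or.inr (Or.inr (Or.inl (by rwa [refl_sub_comm])))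
  · exact Or.inr (Or.inr (Or.inr (by rwa [add_comm])))

theorem Linked.neg_right (h : Linked N a b) : Linked N a (-b) := by
  rcases h with h | h | h | h
  · exact Or.inr (Or.inl (by rw [h]))
  · exact Or.inl (by rw [h, neg_neg])
  · exact Or.inr (Or.inr (Or.inr (by rwa [← sub_eq_add_neg])))
  · exact Or.inr (Or.inr (Or.inl (by rwa [sub_neg_eq_add])))

theorem Linked.neg_left (h : Linked N a b) : Linked N (-a) b := h.symm.neg_right.symm

theorem refl_sub_mem_of_mem (ha : a ∈ shortRoots n) (hb : b ∈ shortRoots n)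
    (hab : inner ℝ a b = (0 : ℝ)) (hac : inner ℝ a c = (0 : ℝ)) (hbc : inner ℝ b c = (0 : ℝ))
    (h₁ : refl (a - b) ∈ N) (h₂ : refl (b - c) ∈ N) : refl (a - c) ∈ N := by
  have h := mul_mem (mul_mem h₁ h₂) (inv_mem h₁)
  rwa [refl_conj, map_sub, refl_sub_apply_right ha hb hab, refl_sub_apply_of_inner hac hbc] at h

theorem ne_and_ne_neg_of_inner_eq_zero (ha : a ∈ shortRoots n) (h : inner ℝ a b = (0 : ℝ)) :
    b ≠ a ∧ b ≠ -a := by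
  have h1 := inner_self_of_mem_shortRoots ha
  constructor
  · rintro rfl
    exact zero_ne_one (h.symm.trans h1)
  · rintro rfl
    rw [inner_neg_right, h1] at h
    norm_num at h

theorem Linked.refl_mem (h : Linked N a b) (ha : a ∈ shortRoots n)
    (h0 : inner ℝ a b = (0 : ℝ)) : refl (a - b) ∈ N ∨ refl (a + b) ∈ N := by
  rcases h with h | h | h
  exacts [absurd h (ne_and_ne_neg_of_inner_eq_zero ha h0).1,
    absurd h (ne_and_ne_neg_of_inner_eq_zero ha h0).2, h]

/-- For three mutually orthogonal roots, conjugating the reflection that links b and c by the one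
that links a and b links a and c. The relative signs multiply, whence the four cases. -/
theorem Linked.trans (ha : a ∈ shortRoots n) (hb : b ∈ shortRoots n) (hc : c ∈ shortRoots n)
    (hab : Linked N a b) (hbc : Linked N b c) : Linked N a c := by
  rcases eq_or_eq_neg_or_inner_eq_zero ha hc with h | h | hac
  · exact Or.inl h
  · exact Or.inr (Or.inl h)
  rcases eq_or_eq_neg_or_inner_eq_zero ha hb with rfl | rfl | hab0
  · exact hbc
  · simpa using hbc.neg_left
  rcases eq_or_eq_neg_or_inner_eq_zero hb hc with rfl | rfl | hbc0
  · exact hab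
  · exact hab.neg_right
  have key : ∀ b' c', b' ∈ shortRoots n → inner ℝ a b' = (0 : ℝ) → inner ℝ b' c' = (0 : ℝ) →
      inner ℝ a c' = (0 : ℝ) → refl (a - b') ∈ N → refl (b' - c') ∈ N → refl (a - c') ∈ N :=
    fun b' c' h1 h2 h3 h4 h5 h6 => refl_sub_mem_of_mem ha h1 h2 h4 h3 h5 h6
  have h1 := hab.refl_mem ha hab0
  have h2 := hbc.refl_mem hb hbc0
  rcases h1 with h1 | h1 <;> rcases h2 with h2 | h2
  · exact Or.inr (Or.inr (Or.inl (key b c hb hab0 hbc0 hac h1 h2)))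
  · refine Or.inr (Or.inr (Or.inr ?_))
    have := key b (-c) hb hab0 (by simp [hbc0]) (by simp [hac]) h1 (by rwa [sub_neg_eq_add])
    rwa [sub_neg_eq_add] at this
  · refine Or.inr (Or.inr (Or.inr ?_))
    have := key (-b) (-c) (neg_mem_shortRoots hb) (by simp [hab0]) (by simp [hbc0]) (by simp [hac])
      (by rwa [sub_neg_eq_add]) (by rw [← refl_neg]; convert h2 using 2; abel)
    rwa [sub_neg_eq_add] at this
  · refine Or.inr (Or.inr (Or.inl ?_))
    exact key (-b) c (neg_mem_shortRoots hb) (by simp [hab0]) (by simp [hbc0]) hac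
      (by rwa [sub_neg_eq_add]) (by rw [← refl_neg]; convert h2 using 2; abel)

theorem linked_refl_apply {d : V n} (hd : d ∈ shortRoots n ∪ longRoots n) (hN : refl d ∈ N)
    (ha : a ∈ shortRoots n) : Linked N a (refl d a) := by
  rcases hd with hd | hd
  · rcases eq_or_eq_neg_or_inner_eq_zero hd ha with rfl | rfl | h
    · exact Or.inr (Or.inl (refl_apply_self hd))
    · exact Or.inr (Or.inl (by rw [map_neg, refl_apply_self hd]))
    · exact Or.inl (refl_apply_of_inner_eq_zero h)
  · obtain ⟨b, hb, c, hc, h0, rfl⟩ := mem_longRoots_iff.1 hd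
    have hbc : Linked N b c := Or.inr (Or.inr (Or.inl hN))
    rcases eq_or_eq_neg_or_inner_eq_zero hb ha with rfl | rfl | h
    · rwa [refl_sub_apply_left hb hc h0]
    · rw [map_neg, refl_sub_apply_left hb hc h0]; exact hbc.neg_left.neg_right
    · rcases eq_or_eq_neg_or_inner_eq_zero hc ha with rfl | rfl | h'
      · rw [refl_sub_apply_right hb hc h0]; exact hbc.symm
      · rw [map_neg, refl_sub_apply_right hb hc h0]; exact hbc.symm.neg_left.neg_right
      · exact Or.inl (refl_sub_apply_of_inner h h')

/-- Every generator moves a short root to a linked one. Transitivity of linkage extends this to all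
of N, and pair transitivity then reaches every short root. -/
theorem linked_of_pairTransitive {A : Set (V n)} (hA : A ⊆ shortRoots n ∪ longRoots n)
    (hN : N = Subgroup.closure (refl '' A)) (ht : PairTransitive N)
    (ha : a ∈ shortRoots n) (hb : b ∈ shortRoots n) : Linked N a b := by
  have hAN : ∀ d ∈ A, refl d ∈ N := fun d hd => hN ▸ Subgroup.subset_closure ⟨d, hd, rfl⟩
  have hNB : N ≤ weylB n := hN ▸ Subgroup.closure_mono (image_mono hA)
  have h1 : ∀ s ∈ N, ∀ x ∈ shortRoots n, Linked N x (s x) := by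
    intro s hs
    have hs' : s ∈ Subgroup.closure (refl '' A) := hN ▸ hs
    induction hs' using Subgroup.closure_induction'' with
    | mem x hx => obtain ⟨d, hd, rfl⟩ := hx; exact fun y hy => linked_refl_apply (hA hd) hs hy
    | inv_mem x hx =>
      obtain ⟨d, hd, rfl⟩ := hx
      rw [refl_inv]; exact fun y hy => linked_refl_apply (hA hd) (hAN d hd) hy
    | one => exact fun y _ => Or.inl rfl
    | mul s t hs0 ht0 hs1 ht1 =>
      have hs2 : s ∈ N := hN ▸ hs0
      have ht2 : t ∈ N := hN ▸ ht0
      intro y hy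
      have hty := apply_mem_shortRoots (hNB ht2) hy
      exact (ht1 ht2 y hy).trans hy hty (apply_mem_shortRoots (hNB hs2) hty) (hs1 hs2 _ hty)
  have h2 : ∀ i j : Fin n, Linked N (eps i) (eps j) := by
    intro i j
    obtain ⟨s, hs, h⟩ := ht i j
    have h3 := h1 s hs _ (eps_mem_shortRoots i)
    rcases h with h | h <;> rw [h] at h3
    · exact h3
    · simpa using h3.neg_right
  obtain ⟨i, rfl | rfl⟩ := ha <;> obtain ⟨j, rfl | rfl⟩ := hb
  exacts [h2 i j, (h2 i j).neg_right, (h2 i j).neg_left, (h2 i j).neg_left.neg_right]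

/-- Conjugation along the transitive action spreads one short reflection to all of them. Linkage
provides one of s_{b-c} and s_{b+c}, and conjugation by s_c exchanges the two. -/
theorem weylB_le_of_short {A : Set (V n)} (hA : A ⊆ shortRoots n ∪ longRoots n)
    (hN : N = Subgroup.closure (refl '' A)) (ht : PairTransitive N)
    (ha : a ∈ shortRoots n) (haN : refl a ∈ N) : weylB n ≤ N := by
  have h1 : ∀ b ∈ shortRoots n, refl b ∈ N := by
    have h2 : ∀ i, refl (eps i) ∈ N := by
      intro i
      obtain ⟨j, hj⟩ := ha
      have haj : refl (eps j) ∈ N := by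
        rcases hj with rfl | rfl
        · exact haN
        · rwa [refl_neg] at haN
      obtain ⟨s, hs, h⟩ := ht j i
      have h3 := mul_mem (mul_mem hs haj) (inv_mem hs)
      rw [refl_conj] at h3
      rcases h with h | h
      · rwa [h] at h3
      · rwa [h, refl_neg] at h3
    rintro b ⟨i, rfl | rfl⟩
    · exact h2 i
    · rw [refl_neg]; exact h2 i
  refine (Subgroup.closure_le _).2 ?_
  rintro _ ⟨d, hd | hd, rfl⟩
  · exact h1 d hd
  · obtain ⟨b, hb, c, hc, h0, rfl⟩ := mem_longRoots_iff.1 hd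
    rcases (linked_of_pairTransitive hA hN ht hb hc).refl_mem hb h0 with h | h
    · exact h
    · have h3 := mul_mem (mul_mem (h1 c hc) h) (inv_mem (h1 c hc))
      rw [refl_conj, map_add, refl_apply_self hc,
        refl_apply_of_inner_eq_zero (by rw [real_inner_comm, h0]), ← sub_eq_add_neg] at h3
      exact h3

/-- Having both reflections s_{x-y} and s_{x+y} is contagious: composing each with the link between
y and z gives both for x and z. Replacing first one member of the pair and then the other reaches
every orthogonal pair. -/
theorem weylD_le_of_both {A : Set (V n)} (hA : A ⊆ shortRoots n ∪ longRoots n)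
    (hN : N = Subgroup.closure (refl '' A)) (ht : PairTransitive N)
    (ha : a ∈ shortRoots n) (hb : b ∈ shortRoots n) (h0 : inner ℝ a b = (0 : ℝ))
    (h₁ : refl (a - b) ∈ N) (h₂ : refl (a + b) ∈ N) : weylD n ≤ N := by
  have hL : ∀ {x y}, x ∈ shortRoots n → y ∈ shortRoots n → Linked N x y := fun hx hy =>
    linked_of_pairTransitive hA hN ht hx hy
  have step : ∀ {x y}, x ∈ shortRoots n → y ∈ shortRoots n → inner ℝ x y = (0 : ℝ) →
      refl (x - y) ∈ N → refl (x + y) ∈ N → ∀ z ∈ shortRoots n, inner ℝ x z = (0 : ℝ) →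
      refl (x - z) ∈ N ∧ refl (x + z) ∈ N := by
    intro x y hx hy hxy h1 h2 z hz hxz
    rcases eq_or_eq_neg_or_inner_eq_zero hy hz with rfl | rfl | hyz
    · exact ⟨h1, h2⟩
    · exact ⟨by rwa [sub_neg_eq_add], by rwa [← sub_eq_add_neg]⟩
    have hny := neg_mem_shortRoots hy
    have hxy' : inner ℝ x (-y) = (0 : ℝ) := by simp [hxy]
    have hxz' : inner ℝ x (-z) = (0 : ℝ) := by simp [hxz]
    have hyz' : inner ℝ y (-z) = (0 : ℝ) := by simp [hyz]
    have h2' : refl (x - -y) ∈ N := by rwa [sub_neg_eq_add]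
    rw [← sub_neg_eq_add x z]
    rcases (hL hy hz).refl_mem hy hyz with h | h
    · refine ⟨refl_sub_mem_of_mem hx hy hxy hxz hyz h1 h,
        refl_sub_mem_of_mem hx hny hxy' hxz' (by simp [hyz]) h2' ?_⟩
      rw [← refl_neg]; convert h using 2; abel
    · refine ⟨refl_sub_mem_of_mem hx hny hxy' hxz (by simp [hyz]) h2' ?_,
        refl_sub_mem_of_mem hx hy hxy hxz' hyz' h1 (by rwa [sub_neg_eq_add])⟩
      rw [← refl_neg]; convert h using 2; abel
  refine (Subgroup.closure_le _).2 ?_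
  rintro _ ⟨d, hd, rfl⟩
  obtain ⟨x, hx, y, hy, hxy, rfl⟩ := mem_longRoots_iff.1 hd
  have hab := step ha hb h0 h₁ h₂
  rcases eq_or_eq_neg_or_inner_eq_zero ha hx with rfl | rfl | hax
  · exact (hab y hy hxy).1
  · have := (hab y hy (by simpa using hxy)).2
    rw [← refl_neg] at this
    change refl _ ∈ N
    convert this using 2; abel
  · obtain ⟨h1, h2⟩ := hab x hx hax
    exact (step hx ha (by rw [real_inner_comm, hax]) (by rwa [refl_sub_comm])
      (by rwa [add_comm]) y hy hxy).1

/-- The conjugate `w H w⁻¹`. -/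
abbrev conjSubgroup (w : V n ≃ₗᵢ[ℝ] V n) (H : Subgroup (V n ≃ₗᵢ[ℝ] V n)) :
    Subgroup (V n ≃ₗᵢ[ℝ] V n) := H.map (MulAut.conj w).toMonoidHom

theorem mem_conjSubgroup {w s : V n ≃ₗᵢ[ℝ] V n} {H : Subgroup (V n ≃ₗᵢ[ℝ] V n)} :
    s ∈ conjSubgroup w H ↔ w⁻¹ * s * w ∈ H := by
  constructor
  · rintro ⟨t, ht, rfl⟩
    convert ht using 1
    simp [mul_assoc]
  · intro h
    exact ⟨_, h, by simp [mul_assoc]⟩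

/-- A group generated by reflections in long roots that is transitive on pairs contains `W(D_n)`
or is conjugate to `G₁`. -/
theorem weylD_le_or_eq_conj {A : Set (V n)} (hA : A ⊆ longRoots n)
    (hN : N = Subgroup.closure (refl '' A)) (ht : PairTransitive N) (hn : n ≠ 0) :
    weylD n ≤ N ∨ ∃ w ∈ weylB n, N = conjSubgroup w (groupG1 n) := by
  have hA' : A ⊆ shortRoots n ∪ longRoots n := hA.trans subset_union_right
  by_cases hboth : ∃ a b : V n, a ∈ shortRoots n ∧ b ∈ shortRoots n ∧ inner ℝ a b = (0 : ℝ) ∧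
      refl (a - b) ∈ N ∧ refl (a + b) ∈ N
  · obtain ⟨a, b, ha, hb, h0, h1, h2⟩ := hboth
    exact Or.inl (weylD_le_of_both hA' hN ht ha hb h0 h1 h2)
  right
  have : NeZero n := ⟨hn⟩
  -- A choice of signs: ε₀ is kept, and every other ε_i receives the sign for which the reflection
  -- exchanging it with ε₀ lies in N. The element w carries out these sign changes.
  have hch : ∀ i : Fin n, ∃ e : V n, (e = eps i ∨ e = -eps i) ∧
      (i = 0 → e = eps 0) ∧ (i ≠ 0 → refl (eps 0 - e) ∈ N) := by
    intro i
    by_cases hi : i = 0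
    · exact ⟨eps i, Or.inl rfl, fun h => by rw [h], fun h => absurd hi h⟩
    · rcases (linked_of_pairTransitive hA' hN ht (eps_mem_shortRoots 0)
        (eps_mem_shortRoots i)).refl_mem (eps_mem_shortRoots 0) (by simp [inner_eps, Ne.symm hi])
        with h | h
      · exact ⟨eps i, Or.inl rfl, fun h' => absurd h' hi, fun _ => h⟩
      · exact ⟨-eps i, Or.inr rfl, fun h' => absurd h' hi, fun _ => by rwa [sub_neg_eq_add]⟩
  choose e he he0 heN using hch
  obtain ⟨w, hw, hwe⟩ := exists_mem_weylB_apply_eps_sign e he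
  have hes : ∀ i, e i ∈ shortRoots n := fun i => ⟨i, he i⟩
  have hin : ∀ {i j}, i ≠ j → inner ℝ (e i) (e j) = (0 : ℝ) := by
    intro i j hij
    rw [← hwe, ← hwe, w.inner_map_map, inner_eps, if_neg hij]
  have hmem : ∀ {i j}, i ≠ j → refl (e i - e j) ∈ N := by
    intro i j hij
    by_cases hi : i = 0
    · subst hi
      rw [he0 0 rfl]
      exact heN j hij.symm
    · by_cases hj : j = 0
      · subst hj
        rw [he0 0 rfl, refl_sub_comm]
        exact heN i hi
      · refine refl_sub_mem_of_mem (b := e 0) (hes i) (hes 0) (hin hi) (hin hij)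
          (hin (Ne.symm hj)) ?_ ?_
        · rw [he0 0 rfl, refl_sub_comm]; exact heN i hi
        · rw [he0 0 rfl]; exact heN j hj
  refine ⟨w, hw, le_antisymm ?_ ?_⟩
  · rw [hN]
    refine (Subgroup.closure_le _).2 ?_
    rintro _ ⟨d, hd, rfl⟩
    have hdN : refl d ∈ N := hN ▸ Subgroup.subset_closure ⟨d, hd, rfl⟩
    obtain ⟨a, ⟨i, ha⟩, b, ⟨j, hb⟩, h0, rfl⟩ := mem_longRoots_iff.1 (hA hd)
    have ha' : a = e i ∨ a = -e i := by
      rcases he i with h | h <;> rw [h] <;> rcases ha with h | h <;> simp [h]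
    have hb' : b = e j ∨ b = -e j := by
      rcases he j with h | h <;> rw [h] <;> rcases hb with h | h <;> simp [h]
    have hij : i ≠ j := by
      rintro rfl
      have hs := inner_self_of_mem_shortRoots (hes i)
      rcases ha' with rfl | rfl <;> rcases hb' with rfl | rfl <;>
        simp only [inner_neg_left, inner_neg_right, neg_neg, hs] at h0 <;> norm_num at h0
    have hG : refl (e i - e j) ∈ conjSubgroup w (groupG1 n) :=
      ⟨_, refl_eps_sub_mem_groupG1 hij, by
        change w * refl (eps i - eps j) * w⁻¹ = _
        rw [refl_conj, map_sub, hwe, hwe]⟩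
    -- Since N already contains the reflection in e_i - e_j, the one in e_i + e_j would produce a
    -- pair with both reflections, which is excluded.
    have hno : ∀ {P : Prop}, refl (e i + e j) ∈ N → P := fun h =>
      absurd ⟨e i, e j, hes i, hes j, hin hij, hmem hij, h⟩ hboth
    rcases ha' with rfl | rfl <;> rcases hb' with rfl | rfl
    · exact hG
    · exact hno (by rwa [sub_neg_eq_add] at hdN)
    · refine hno ?_
      rw [← refl_neg]; convert hdN using 2; abel
    · change refl _ ∈ conjSubgroup w (groupG1 n)
      rw [← refl_neg]; convert hG using 2; abel
  · rintro _ ⟨s, hs, rfl⟩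
    change s ∈ N.comap (MulAut.conj w).toMonoidHom
    refine (Subgroup.closure_le _).2 ?_ hs
    rintro _ ⟨i, j, hij, rfl⟩
    change w * refl (eps i - eps j) * w⁻¹ ∈ N
    rw [refl_conj, map_sub, hwe, hwe]
    exact hmem hij.ne

/-! ### The index of W(D_n) in W(B_n) -/

theorem refl_mul_self (a : V n) : refl a * refl a = 1 := by
  nth_rw 1 [← refl_inv]
  exact inv_mul_cancel _

theorem refl_mul_self_mul (a : V n) (t : V n ≃ₗᵢ[ℝ] V n) : refl a * (refl a * t) = t := by
  rw [← mul_assoc, refl_mul_self, one_mul]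

/-- Changing two signs at once is the product of the two long reflections s_{ε_i-ε_j} and
s_{ε_i+ε_j}. Both factors come from conjugating s_{ε_j} and s_{ε_i-ε_j} by one another. -/
theorem refl_mul_refl_mem_weylD {i j : Fin n} :
    refl (eps i) * refl (eps j) ∈ weylD n := by
  by_cases hij : i = j
  · subst hij
    rw [refl_mul_self]; exact one_mem _
  · have h0 : inner ℝ (eps i) (eps j) = (0 : ℝ) := by simp [inner_eps, hij]
    have h : refl (eps i) * refl (eps j) = refl (eps i - eps j) * refl (eps i - -eps j) := by
      have h1 : refl (eps j) * refl (eps i - eps j) * (refl (eps j))⁻¹ =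
          refl (eps i - -eps j) := by
        rw [refl_conj, map_sub, refl_apply_self (eps_mem_shortRoots j),
          refl_apply_of_inner_eq_zero (by rw [real_inner_comm, h0])]
      have h2 : refl (eps i - eps j) * refl (eps j) * (refl (eps i - eps j))⁻¹ =
          refl (eps i) := by
        rw [refl_conj, refl_sub_apply_right (eps_mem_shortRoots i) (eps_mem_shortRoots j) h0]
      rw [← h1, ← h2, refl_inv, refl_inv]
      simp only [mul_assoc]
    rw [h]
    exact mul_mem (refl_sub_mem_weylD (eps_mem_shortRoots i) (eps_mem_shortRoots j) h0)
      (refl_sub_mem_weylD (eps_mem_shortRoots i) (neg_mem_shortRoots (eps_mem_shortRoots j))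
        (by simp [h0]))

theorem conj_mem_weylD {s t : V n ≃ₗᵢ[ℝ] V n} (hs : s ∈ weylB n) (ht : t ∈ weylD n) :
    s * t * s⁻¹ ∈ weylD n := by
  change t ∈ (weylD n).comap (MulAut.conj s).toMonoidHom
  refine (Subgroup.closure_le _).2 ?_ ht
  rintro _ ⟨d, hd, rfl⟩
  obtain ⟨a, ha, b, hb, h0, rfl⟩ := mem_longRoots_iff.1 hd
  change s * refl (a - b) * s⁻¹ ∈ weylD n
  rw [refl_conj, map_sub]
  exact refl_sub_mem_weylD (apply_mem_shortRoots hs ha) (apply_mem_shortRoots hs hb)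
    (by rw [s.inner_map_map, h0])

/-- `W(D_n)` has index at most two in `W(B_n)`. -/
theorem eq_weylD_or_eq_weylB {G : Subgroup (V n ≃ₗᵢ[ℝ] V n)} (h₁ : weylD n ≤ G)
    (h₂ : G ≤ weylB n) : G = weylD n ∨ G = weylB n := by
  by_cases h : G ≤ weylD n
  · exact Or.inl (le_antisymm h h₁)
  right
  obtain ⟨g, hg, hgD⟩ := SetLike.not_le_iff_exists.1 h
  -- For each i the group W(B_n) is covered by W(D_n) and its coset by s_{ε_i}. An element of G
  -- outside W(D_n) therefore brings every s_{ε_i} into G.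
  have key : ∀ i : Fin n, ∀ s ∈ weylB n, s ∈ weylD n ∨ refl (eps i) * s ∈ weylD n := by
    intro i s hs
    have hshort : ∀ j, ∀ t, (t ∈ weylD n ∨ refl (eps i) * t ∈ weylD n) →
        (t * refl (eps j) ∈ weylD n ∨ refl (eps i) * (t * refl (eps j)) ∈ weylD n) := by
      intro j t ht
      have hj := refl_mem_weylB_of_short (eps_mem_shortRoots j)
      rcases ht with ht | ht
      · right
        have := mul_mem (refl_mul_refl_mem_weylD (i := i) (j := j)) (conj_mem_weylD hj ht)
        convert this using 1
        simp only [mul_assoc, refl_inv, refl_mul_self_mul]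
      · left
        have := mul_mem (refl_mul_refl_mem_weylD (i := i) (j := j)) (conj_mem_weylD hj ht)
        convert this using 1
        simp only [mul_assoc, refl_inv, refl_mul_self_mul]
    have hgen : ∀ d ∈ shortRoots n ∪ longRoots n, ∀ t,
        (t ∈ weylD n ∨ refl (eps i) * t ∈ weylD n) →
        (t * refl d ∈ weylD n ∨ refl (eps i) * (t * refl d) ∈ weylD n) := by
      rintro d (⟨j, rfl | rfl⟩ | hd) t ht
      · exact hshort j t ht
      · rw [refl_neg]; exact hshort j t ht
      · have hd' : refl d ∈ weylD n := Subgroup.subset_closure ⟨d, hd, rfl⟩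
        rcases ht with ht | ht
        · exact Or.inl (mul_mem ht hd')
        · exact Or.inr (by rw [← mul_assoc]; exact mul_mem ht hd')
    induction hs using Subgroup.closure_induction_right with
    | one => exact Or.inl (one_mem _)
    | mul_right x hx y hy ih => obtain ⟨d, hd, rfl⟩ := hy; exact hgen d hd _ ih
    | mul_inv_cancel x hx y hy ih =>
      obtain ⟨d, hd, rfl⟩ := hy; rw [refl_inv]; exact hgen d hd _ ih
  refine le_antisymm h₂ ?_
  have hshort : ∀ i : Fin n, refl (eps i) ∈ G := by
    intro i
    have h3 := ((key i g (h₂ hg)).resolve_left hgD)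
    have := mul_mem (h₁ h3) (inv_mem hg)
    rwa [mul_assoc, mul_inv_cancel, mul_one] at this
  refine (Subgroup.closure_le _).2 ?_
  rintro _ ⟨d, ⟨j, rfl | rfl⟩ | hd, rfl⟩
  · exact hshort j
  · rw [refl_neg]; exact hshort j
  · exact h₁ (Subgroup.subset_closure ⟨d, hd, rfl⟩)

/-! ### The normalizer of G₁ -/

theorem apply_eps_of_mem_groupG1 {s : V n ≃ₗᵢ[ℝ] V n} (hs : s ∈ groupG1 n) (i : Fin n) :
    ∃ j, s (eps i) = eps j := by
  have hgen : ∀ j k : Fin n, j < k → ∀ i, ∃ l, refl (eps j - eps k) (eps i) = (eps l : V n) := by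
    intro j k hjk i
    have h0 : inner ℝ (eps j) (eps k) = (0 : ℝ) := by simp [inner_eps, hjk.ne]
    by_cases h1 : i = j
    · exact ⟨k, by rw [h1, refl_sub_apply_left (eps_mem_shortRoots j) (eps_mem_shortRoots k) h0]⟩
    · by_cases h2 : i = k
      · exact ⟨j, by
          rw [h2, refl_sub_apply_right (eps_mem_shortRoots j) (eps_mem_shortRoots k) h0]⟩
      · exact ⟨i, refl_sub_apply_of_inner (by simp [inner_eps, Ne.symm h1])
          (by simp [inner_eps, Ne.symm h2])⟩
  induction hs using Subgroup.closure_induction'' generalizing i with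
  | mem x hx => obtain ⟨j, k, hjk, rfl⟩ := hx; exact hgen j k hjk i
  | inv_mem x hx => obtain ⟨j, k, hjk, rfl⟩ := hx; rw [refl_inv]; exact hgen j k hjk i
  | one => exact ⟨i, rfl⟩
  | mul x y _ _ hx hy =>
    obtain ⟨j, hj⟩ := hy i
    obtain ⟨k, hk⟩ := hx j
    exact ⟨k, by change x (y (eps i)) = _; rw [hj, hk]⟩

theorem mem_groupG1_of_apply_eps {s : V n ≃ₗᵢ[ℝ] V n} (hs : ∀ i, ∃ j, s (eps i) = eps j) :
    s ∈ groupG1 n := by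
  choose τ hτ using hs
  have hinj : Function.Injective τ := fun i j hij =>
    eps_injective (s.injective (by rw [hτ, hτ, hij]))
  obtain ⟨t, ht, h⟩ := exists_mem_groupG1_apply_eps
    (Equiv.ofBijective τ (Finite.injective_iff_bijective.1 hinj))
  have : s = t := isometry_ext fun i => by rw [hτ, h]; rfl
  rwa [this]

/-- An element of `N(G₁)` permutes the `ε_i`, or the `ε_i` up to a common sign `-1`. -/
theorem apply_eps_of_mem_normalizerG1 {s : V n ≃ₗᵢ[ℝ] V n} (hs : s ∈ normalizerG1 n) :
    (∀ i, ∃ j, s (eps i) = eps j) ∨ ∀ i, ∃ j, s (eps i) = -eps j := by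
  obtain ⟨hB, hnorm⟩ := hs
  by_contra hcon
  push Not at hcon
  obtain ⟨⟨i, hi⟩, j, hj⟩ := hcon
  obtain ⟨k, hk⟩ := apply_mem_shortRoots hB (eps_mem_shortRoots i)
  obtain ⟨l, hl⟩ := apply_mem_shortRoots hB (eps_mem_shortRoots j)
  have hk' := hk.resolve_left (hi k)
  have hl' := hl.resolve_right (hj l)
  have hij : i ≠ j := by
    rintro rfl
    exact eps_ne_neg l k (hl'.symm.trans hk')
  -- With s ε_i = -ε_k and s ε_j = ε_l, the conjugate of s_{ε_i-ε_j} sends ε_l to -ε_k, which no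
  -- element of G₁ does.
  have h1 := (Subgroup.mem_normalizer_iff.1 hnorm _).1 (refl_eps_sub_mem_groupG1 hij)
  rw [refl_conj, map_sub] at h1
  obtain ⟨m, hm⟩ := apply_eps_of_mem_groupG1 h1 l
  rw [← hl', refl_sub_apply_right (apply_mem_shortRoots hB (eps_mem_shortRoots i))
    (apply_mem_shortRoots hB (eps_mem_shortRoots j))
    (by rw [s.inner_map_map]; simp [inner_eps, hij]), hk'] at hm
  exact eps_ne_neg m k hm.symm

/-- A subgroup of `W(B_n)` that normalizes a conjugate of `G₁`, contains it and is transitive on the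
short roots is the corresponding conjugate of `N(G₁)`. -/
theorem eq_conj_normalizerG1 {G : Subgroup (V n ≃ₗᵢ[ℝ] V n)} {w : V n ≃ₗᵢ[ℝ] V n} (hn : n ≠ 0)
    (hw : w ∈ weylB n) (hGB : G ≤ weylB n) (h₁ : conjSubgroup w (groupG1 n) ≤ G)
    (hnorm : ∀ g ∈ G, ∀ s ∈ conjSubgroup w (groupG1 n), g * s * g⁻¹ ∈ conjSubgroup w (groupG1 n))
    (htrans : ∀ a ∈ shortRoots n, ∀ b ∈ shortRoots n, ∃ g ∈ G, g a = b) :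
    G = conjSubgroup w (normalizerG1 n) := by
  have : NeZero n := ⟨hn⟩
  have hle : ∀ g ∈ G, w⁻¹ * g * w ∈ normalizerG1 n := by
    intro g hg
    refine Subgroup.mem_inf.2 ⟨mul_mem (mul_mem (inv_mem hw) (hGB hg)) hw, ?_⟩
    have hconj : ∀ g ∈ G, ∀ h ∈ groupG1 n, (w⁻¹ * g * w) * h * (w⁻¹ * g * w)⁻¹ ∈ groupG1 n := by
      intro g hg h hh
      have := hnorm g hg (w * h * w⁻¹) ⟨h, hh, rfl⟩
      rw [mem_conjSubgroup] at this
      simpa only [mul_inv_rev, inv_inv, mul_assoc] using this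
    refine Subgroup.mem_normalizer_iff.2 ?_
    intro h
    refine ⟨hconj g hg h, fun hh => ?_⟩
    have := hconj g⁻¹ (inv_mem hg) _ hh
    simpa only [mul_inv_rev, inv_inv, mul_assoc, mul_inv_cancel_left, inv_mul_cancel_left,
      mul_inv_cancel, inv_mul_cancel, mul_one] using this
  have hpos : ∀ {s}, s ∈ normalizerG1 n → (∀ i, ∃ j, s (eps i) = eps j) →
      w * s * w⁻¹ ∈ G := fun {s} _ hs =>
    h₁ ⟨s, mem_groupG1_of_apply_eps hs, rfl⟩
  apply le_antisymm
  · intro g hg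
    rw [mem_conjSubgroup]
    exact hle g hg
  · rintro _ ⟨s, hs, rfl⟩
    change w * s * w⁻¹ ∈ G
    rcases apply_eps_of_mem_normalizerG1 hs with h | h
    · exact hpos hs h
    -- Transitivity on short roots supplies an element of G that sends w ε₀ to its negative.
    -- Relative to the basis w ε_i it reverses all signs, so its product with a sign-reversing s
    -- preserves signs and falls into the conjugate of G₁.
    · obtain ⟨g, hg, hg0⟩ := htrans (w (eps 0)) (apply_mem_shortRoots hw (eps_mem_shortRoots 0))
        (w (-eps 0)) (apply_mem_shortRoots hw (neg_mem_shortRoots (eps_mem_shortRoots 0)))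
      have hg1 : (w⁻¹ * g * w) (eps 0) = -eps 0 := by
        change w⁻¹ (g (w (eps 0))) = _
        rw [hg0]
        exact w.symm_apply_apply _
      have hg2 : ∀ i, ∃ j, (w⁻¹ * g * w) (eps i) = -eps j := by
        rcases apply_eps_of_mem_normalizerG1 (hle g hg) with h' | h'
        · obtain ⟨j, hj⟩ := h' 0
          exact absurd (hj.symm.trans hg1) (eps_ne_neg j 0)
        · exact h'
      have h3 := hpos (mul_mem (hle g hg) hs) (fun i => by
        obtain ⟨j, hj⟩ := h i
        obtain ⟨k, hk⟩ := hg2 j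
        refine ⟨k, ?_⟩
        change (w⁻¹ * g * w) (s (eps i)) = _
        rw [hj, map_neg, hk, neg_neg])
      have h4 := mul_mem (inv_mem hg) h3
      simpa only [mul_assoc, mul_inv_cancel_left, inv_mul_cancel_left] using h4

/-- Only the passage from a to -a needs an argument: it goes through a third short root c orthogonal
to a, which exists because n ≥ 2. -/
theorem exists_mem_weylD_apply_eq (hn : 2 ≤ n) (ha : a ∈ shortRoots n) (hb : b ∈ shortRoots n) :
    ∃ s ∈ weylD n, s a = b := by
  rcases eq_or_eq_neg_or_inner_eq_zero ha hb with rfl | rfl | h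
  · exact ⟨1, one_mem _, rfl⟩
  · obtain ⟨c, hc, h0⟩ : ∃ c ∈ shortRoots n, inner ℝ a c = (0 : ℝ) := by
      have : Nontrivial (Fin n) := Fin.nontrivial_iff_two_le.2 hn
      obtain ⟨i, hi⟩ := ha
      obtain ⟨j, hj⟩ := exists_ne i
      refine ⟨eps j, eps_mem_shortRoots j, ?_⟩
      rcases hi with rfl | rfl <;> simp [inner_eps, hj.symm]
    have h0' : inner ℝ c (-a) = (0 : ℝ) := by rw [inner_neg_right, real_inner_comm, h0, neg_zero]
    refine ⟨refl (c - -a) * refl (a - c), mul_mem (refl_sub_mem_weylD hc hb h0')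
      (refl_sub_mem_weylD ha hc h0), ?_⟩
    change refl (c - -a) (refl (a - c) a) = _
    rw [refl_sub_apply_left ha hc h0, refl_sub_apply_left hc hb h0']
  · exact ⟨_, refl_sub_mem_weylD ha hb h, refl_sub_apply_left ha hb h⟩

theorem refl_conj_eq_self_of_inner_eq_zero {d : V n}
    (h : ∀ i j : Fin n, i < j → inner ℝ d (eps i - eps j) = (0 : ℝ)) {s : V n ≃ₗᵢ[ℝ] V n}
    (hs : s ∈ groupG1 n) : refl d * s * (refl d)⁻¹ = s := by
  induction hs using Subgroup.closure_induction with
  | mem x hx =>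
    obtain ⟨i, j, hij, rfl⟩ := hx
    rw [refl_conj, refl_apply_of_inner_eq_zero (h i j hij)]
  | one => rw [mul_one, mul_inv_cancel]
  | mul x y _ _ hx hy => rw [← conj_mul, hx, hy]
  | inv x _ hx => rw [← conj_inv, hx]

theorem mem_normalizerG1_of_conj_mem {s : V n ≃ₗᵢ[ℝ] V n} (hs : s ∈ weylB n)
    (h : ∀ t ∈ groupG1 n, s * t * s⁻¹ ∈ groupG1 n) (h' : ∀ t ∈ groupG1 n, s⁻¹ * t * s ∈ groupG1 n) :
    s ∈ normalizerG1 n := by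
  refine Subgroup.mem_inf.2 ⟨hs, Subgroup.mem_normalizer_iff.2 fun t => ⟨h t, fun ht => ?_⟩⟩
  have h1 := h' _ ht
  simpa only [mul_assoc, inv_mul_cancel_left, inv_mul_cancel, mul_one] using h1

theorem refl_mem_normalizerG1_of_inner_eq_zero {d : V n} (hd : refl d ∈ weylB n)
    (h : ∀ i j : Fin n, i < j → inner ℝ d (eps i - eps j) = (0 : ℝ)) :
    refl d ∈ normalizerG1 n := by
  have hcomm : ∀ t ∈ groupG1 n, refl d * t * (refl d)⁻¹ ∈ groupG1 n := fun t ht => by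
    rwa [refl_conj_eq_self_of_inner_eq_zero h ht]
  refine mem_normalizerG1_of_conj_mem hd hcomm ?_
  rw [refl_inv] at hcomm ⊢
  exact hcomm

/-- In rank two ε₀ + ε₁ is orthogonal to ε₀ - ε₁, so both long reflections normalize G₁. This is why
the normalizer gives no separate alternative for n = 2. -/
theorem weylD_two_le_normalizerG1 : weylD 2 ≤ normalizerG1 2 := by
  have h0 : inner ℝ (eps (0 : Fin 2)) (eps 1) = (0 : ℝ) := by rw [inner_eps, if_neg (by decide)]
  have hij : ∀ i j : Fin 2, i < j → i = 0 ∧ j = 1 := by decide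
  have hG : refl (eps (0 : Fin 2) - eps 1) ∈ groupG1 2 := refl_eps_sub_mem_groupG1 (by decide)
  have h1 : refl (eps (0 : Fin 2) - eps 1) ∈ normalizerG1 2 :=
    Subgroup.mem_inf.2 ⟨weylD_le_weylB (groupG1_le_weylD hG), Subgroup.le_normalizer hG⟩
  have h2 : refl (eps (0 : Fin 2) - -eps 1) ∈ normalizerG1 2 := by
    refine refl_mem_normalizerG1_of_inner_eq_zero (weylD_le_weylB
      (refl_sub_mem_weylD (eps_mem_shortRoots (0 : Fin 2))
        (neg_mem_shortRoots (eps_mem_shortRoots 1)) (by rw [inner_neg_right, h0, neg_zero]))) ?_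
    intro i j h
    obtain ⟨rfl, rfl⟩ := hij i j h
    rw [sub_neg_eq_add, inner_add_left, inner_sub_right, inner_sub_right, h0, real_inner_comm (eps 0) (eps 1),
      h0, inner_eps, inner_eps, if_pos rfl, if_pos rfl]
    norm_num
  rw [sub_neg_eq_add] at h2
  refine (Subgroup.closure_le _).2 ?_
  rintro _ ⟨d, ⟨i, j, h, hd⟩, rfl⟩
  obtain ⟨rfl, rfl⟩ := hij i j h
  change refl d ∈ normalizerG1 2
  rcases hd with rfl | rfl | rfl | rfl
  · exact h2
  · exact h1
  · rwa [neg_add_eq_sub, refl_sub_comm]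
  · rwa [← refl_neg, neg_sub_left, neg_neg, add_comm]

/-- For `n ≥ 3` the long reflections in a conjugate of `N(G₁)` lie in the conjugate of `G₁`. -/
theorem refl_mem_conj_groupG1 (hn : 3 ≤ n) {w : V n ≃ₗᵢ[ℝ] V n} (hw : w ∈ weylB n) {d : V n}
    (hd : d ∈ longRoots n) (h : refl d ∈ conjSubgroup w (normalizerG1 n)) :
    refl d ∈ conjSubgroup w (groupG1 n) := by
  have hc : w⁻¹ * refl d * w = refl (w⁻¹ d) := by
    have := refl_conj w⁻¹ d
    rwa [inv_inv] at this
  rw [mem_conjSubgroup, hc] at h ⊢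
  rcases apply_eps_of_mem_normalizerG1 h with h | h
  · exact mem_groupG1_of_apply_eps h
  · exfalso
    obtain ⟨a, ha, b, hb, h0, rfl⟩ := mem_longRoots_iff.1 hd
    obtain ⟨i, hi⟩ := apply_mem_shortRoots (inv_mem hw) ha
    obtain ⟨j, hj⟩ := apply_mem_shortRoots (inv_mem hw) hb
    -- Here n ≥ 3 enters: some ε_k is orthogonal to both short roots whose difference is w⁻¹d. The
    -- reflection fixes it, so it cannot reverse all signs.
    obtain ⟨k, hk⟩ : ∃ k, k ∉ ({i, j} : Finset (Fin n)) := by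
      by_contra hcon
      push Not at hcon
      have h1 := Finset.card_le_card (fun x _ => hcon x : (Finset.univ : Finset (Fin n)) ⊆ {i, j})
      have h2 := Finset.card_le_two (a := i) (b := j)
      rw [Finset.card_univ, Fintype.card_fin] at h1
      omega
    simp only [Finset.mem_insert, Finset.mem_singleton, not_or] at hk
    obtain ⟨l, hl⟩ := h k
    rw [map_sub, refl_sub_apply_of_inner] at hl
    · exact eps_ne_neg k l hl
    · rcases hi with hi | hi <;> rw [hi] <;> simp [inner_eps, Ne.symm hk.1]
    · rcases hj with hj | hj <;> rw [hj] <;> simp [inner_eps, Ne.symm hk.2]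

end groups

end BnCovering

namespace BnCovering

open Filter Set

/-! ### Local systems and flat functions -/

/-- A local system on `B` with structure group `P`, given by its parallel transport. -/
structure Holonomy (B : Type*) [TopologicalSpace B] (P : Type*) [Group P] where
  hol : ∀ {x y : B}, Path x y → P
  hol_trans : ∀ {x y z : B} (γ : Path x y) (γ' : Path y z), hol (γ.trans γ') = hol γ' * hol γ
  hol_homotopic : ∀ {x y : B} {γ γ' : Path x y}, γ.Homotopic γ' → hol γ = hol γ'

/-- The detour back and forth along β cancels. This is the multiplicativity needed for
`Holonomy.ofHom`, where auxiliary paths turn arbitrary paths into loops. -/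
theorem _root_.Path.Homotopic.Quotient.conj_trans {B : Type*} [TopologicalSpace B]
    {a b c d e : B} (α : Path a b) (γ : Path b c) (β : Path d c) (γ' : Path c e) (ε : Path a e) :
    Path.Homotopic.Quotient.mk ((α.trans (γ.trans γ')).trans ε.symm) =
      (Path.Homotopic.Quotient.mk ((α.trans γ).trans β.symm)).trans
        (Path.Homotopic.Quotient.mk ((β.trans γ').trans ε.symm)) := by
  simp only [Path.Homotopic.Quotient.mk_trans, Path.Homotopic.Quotient.mk_symm,
    Path.Homotopic.Quotient.trans_assoc]
  rw [← Path.Homotopic.Quotient.trans_assoc (.symm _) (.mk β)]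
  simp

namespace Holonomy

variable {B : Type*} [TopologicalSpace B] {P : Type*} [Group P] (H : Holonomy B P)

theorem hol_refl (x : B) : H.hol (Path.refl x) = 1 := by
  have h := H.hol_trans (Path.refl x) (Path.refl x)
  rw [Path.refl_trans_refl] at h
  exact left_eq_mul.mp h

theorem hol_cast {x y x' y' : B} (γ : Path x y) (hx : x' = x) (hy : y' = y) :
    H.hol (γ.cast hx hy) = H.hol γ := by
  subst hx hy; rfl

/-- The local system defined by a representation of the fundamental group, relative to a choice of
paths from the base point. -/
def ofHom {b : B} (ρ : FundamentalGroup B b →* P) (δ : ∀ v, Path b v) : Holonomy B P where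
  hol {x y} γ := ρ (FundamentalGroup.fromPath
    (Path.Homotopic.Quotient.mk (((δ x).trans γ).trans (δ y).symm)))
  hol_trans {x y z} γ γ' := by
    rw [← map_mul]
    congr 1
    exact Path.Homotopic.Quotient.conj_trans _ _ _ _ _
  hol_homotopic {x y γ γ'} h := by
    have : Path.Homotopic.Quotient.mk γ = Path.Homotopic.Quotient.mk γ' :=
      Path.Homotopic.Quotient.eq.2 h
    simp only [Path.Homotopic.Quotient.mk_trans, this]

/-- Parallel transport inside `O` depends only on the end points. -/
def IsTrivialOn (O : Set B) : Prop :=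
  ∀ ⦃x y : B⦄ (γ γ' : Path x y), range γ ⊆ O → range γ' ⊆ O → H.hol γ = H.hol γ'

/-- `κ` is invariant under parallel transport along small paths starting at `q x`. -/
def FlatAt {X S : Type*} [TopologicalSpace X] [MulAction P S] (q : X → B) (κ : X → S) (x : X) :
    Prop :=
  ∀ O ∈ 𝓝 (q x), ∀ᶠ x' in 𝓝 x, ∃ η : Path (q x) (q x'), range η ⊆ O ∧ κ x' = H.hol η • κ x

/-- Both functions are transported along small paths with the same end points. The paths may differ,
but inside O the transports agree and cancel in the quotient. -/
theorem FlatAt.eventually_inv_smul_eq {X S : Type*} [TopologicalSpace X] [MulAction P S]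
    {H : Holonomy B P} {q : X → B} {κ : X → S} {τ : B → P} {x : X} (hκ : H.FlatAt q κ x)
    (hτ : H.FlatAt id τ (q x)) (hq : ContinuousAt q x) {O : Set B} (hO : O ∈ 𝓝 (q x))
    (ht : H.IsTrivialOn O) :
    ∀ᶠ x' in 𝓝 x, (τ (q x'))⁻¹ • κ x' = (τ (q x))⁻¹ • κ x := by
  filter_upwards [hκ O hO, hq.eventually (hτ O hO)] with x' ⟨η, hη, h⟩ ⟨η', hη', h'⟩
  rw [h, h', ht η' η hη' hη]
  simp [mul_smul]

/-- The flat section is transport from a fixed point of O, well defined because transport in O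
depends only on end points. Its value 1 outside O plays no role. -/
theorem IsTrivialOn.exists_flat [LocallyPathConnectedSpace B] {H : Holonomy B P} {O : Set B}
    (hO : IsOpen O) (hc : IsPathConnected O) (ht : H.IsTrivialOn O) :
    ∃ τ : B → P, ∀ v ∈ O, H.FlatAt id τ v := by
  classical
  obtain ⟨u, hu, hj⟩ := hc
  refine ⟨fun v => if hv : v ∈ O then H.hol (hj hv).somePath else 1, fun v hv O' hO' => ?_⟩
  filter_upwards [pathComponentIn_mem_nhds (inter_mem hO' (hO.mem_nhds hv))] with v' hv'
  have hj' : JoinedIn (O' ∩ O) v v' := hv'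
  have h1 : range hj'.somePath ⊆ O' ∩ O := by
    rintro _ ⟨t, rfl⟩; exact hj'.somePath_mem t
  have hv'O : v' ∈ O := hj'.target_mem.2
  refine ⟨hj'.somePath, h1.trans inter_subset_left, ?_⟩
  simp only [id_eq, hv, hv'O, dif_pos, smul_eq_mul]
  rw [← H.hol_trans]
  refine ht _ _ ?_ ?_
  · rintro _ ⟨t, rfl⟩; exact (hj hv'O).somePath_mem t
  · rw [Path.trans_range]
    refine union_subset ?_ (h1.trans inter_subset_right)
    rintro _ ⟨t, rfl⟩; exact (hj hv).somePath_mem t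

end Holonomy

/-! ### The covering of `Y` defined by a local system on the complement of `D` -/

/-- A cover of `Y` by open sets, indexed by the points of `Y`, with flat sections of a local system
on `Y ∖ D`. A point of `D` lies in only one of these sets. -/
structure FlatCover {Y : Type*} [TopologicalSpace Y] {D : Set Y} {P : Type*} [Group P]
    (H : Holonomy ↥Dᶜ P) where
  U : Y → Set Y
  isOpen_U : ∀ i, IsOpen (U i)
  mem_U : ∀ i, i ∈ U i
  eq_of_mem : ∀ i, ∀ y ∈ U i, y ∈ D → y = i
  τ : Y → ↥Dᶜ → P
  flat : ∀ i, ∀ v : ↥Dᶜ, (v : Y) ∈ U i → H.FlatAt id (τ i) v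
  trivial : ∀ v : ↥Dᶜ, ∃ O ∈ 𝓝 v, H.IsTrivialOn O
  neBot : ∀ y : Y, (comap ((↑) : ↥Dᶜ → Y) (𝓝 y)).NeBot

namespace FlatCover

variable {Y : Type*} [TopologicalSpace Y] {D : Set Y} {P : Type*} [Group P]
  {H : Holonomy ↥Dᶜ P} (A : FlatCover H)

/-- At a point of D there is nothing to compare, since only one set of the cover contains it.
Elsewhere the quotient of two flat sections is locally constant. -/
theorem exists_transition {i j y : Y} (hi : y ∈ A.U i) (hj : y ∈ A.U j) :
    ∃ c : P, ∀ᶠ v in comap ((↑) : ↥Dᶜ → Y) (𝓝 y), (A.τ j v)⁻¹ * A.τ i v = c := by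
  by_cases hy : y ∈ D
  · obtain rfl := A.eq_of_mem i y hi hy
    obtain rfl := A.eq_of_mem j y hj hy
    exact ⟨1, Eventually.of_forall fun v => inv_mul_cancel _⟩
  · obtain ⟨O, hO, ht⟩ := A.trivial ⟨y, hy⟩
    have h := (A.flat i ⟨y, hy⟩ hi).eventually_inv_smul_eq (A.flat j ⟨y, hy⟩ hj)
      continuousAt_id hO ht
    rw [nhds_induced] at h
    exact ⟨_, h⟩

open Classical in
/-- The transition function between two flat sections, extended over `D`. -/
def transition (i j y : Y) : P :=
  if h : y ∈ A.U i ∧ y ∈ A.U j then (A.exists_transition h.1 h.2).choose else 1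

theorem eventually_transition {i j y : Y} (hi : y ∈ A.U i) (hj : y ∈ A.U j) :
    ∀ᶠ v in comap ((↑) : ↥Dᶜ → Y) (𝓝 y), (A.τ j v)⁻¹ * A.τ i v = A.transition i j y := by
  rw [transition, dif_pos ⟨hi, hj⟩]
  exact (A.exists_transition hi hj).choose_spec

theorem _root_.Filter.Eventually.eventually_comap_nhds {X A : Type*} [TopologicalSpace X]
    {e : A → X} {x : X} {p : A → Prop} (h : ∀ᶠ a in comap e (𝓝 x), p a) :
    ∀ᶠ x' in 𝓝 x, ∀ᶠ a in comap e (𝓝 x'), p a := by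
  simp only [eventually_comap] at h ⊢
  exact eventually_eventually_nhds.2 h

/-- Transition values are read off at points of Y ∖ D. Such points accumulate at every point of Y
(`neBot`), so an identity that holds on them determines the values over D too. -/
theorem eventually_transition_eq {i j y : Y} (hi : y ∈ A.U i) (hj : y ∈ A.U j) :
    ∀ᶠ y' in 𝓝 y, A.transition i j y' = A.transition i j y := by
  filter_upwards [(A.eventually_transition hi hj).eventually_comap_nhds,
    (A.isOpen_U i).mem_nhds hi, (A.isOpen_U j).mem_nhds hj] with y' h hi' hj'
  have := A.neBot y'
  obtain ⟨v, h1, h2⟩ := (h.and (A.eventually_transition hi' hj')).exists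
  exact h2.symm.trans h1

theorem transition_mul {i j k y : Y} (hi : y ∈ A.U i) (hj : y ∈ A.U j) (hk : y ∈ A.U k) :
    A.transition j k y * A.transition i j y = A.transition i k y := by
  have := A.neBot y
  obtain ⟨v, h1, h2, h3⟩ := ((A.eventually_transition hi hj).and
    ((A.eventually_transition hj hk).and (A.eventually_transition hi hk))).exists
  rw [← h1, ← h2, ← h3]; group

theorem transition_self {i y : Y} (hi : y ∈ A.U i) : A.transition i i y = 1 := by
  have := A.neBot y
  obtain ⟨v, h1⟩ := (A.eventually_transition hi hi).exists
  rw [← h1, inv_mul_cancel]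

variable (S : Type*) [MulAction P S] [TopologicalSpace S] [DiscreteTopology S]

/-- The covering of `Y` with fibre `S` defined by a local system. -/
def core : FiberBundleCore Y Y S where
  baseSet := A.U
  isOpen_baseSet := A.isOpen_U
  indexAt := id
  mem_baseSet_at := A.mem_U
  coordChange i j y s := A.transition i j y • s
  coordChange_self i y hy s := by rw [A.transition_self hy, one_smul]
  continuousOn_coordChange i j := by
    rintro ⟨y, s⟩ ⟨⟨hi, hj⟩, -⟩
    refine ContinuousAt.continuousWithinAt ?_
    have h : ∀ᶠ p : Y × S in 𝓝 (y, s), A.transition i j p.1 • p.2 = A.transition i j y • s := by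
      rw [nhds_prod_eq, nhds_discrete S, eventually_prod_iff]
      exact ⟨_, A.eventually_transition_eq hi hj, (· = s), by simp, fun h1 _ h2 => by rw [h1, h2]⟩
    exact continuousAt_const.congr (h.mono fun _ h => h.symm)
  coordChange_comp i j k y hy s := by
    rw [← mul_smul, A.transition_mul hy.1.1 hy.1.2 hy.2]

theorem isCoveringMap_core : IsCoveringMap (A.core S).proj :=
  FiberBundle.isCoveringMap (F := S) (E := (A.core S).Fiber)

variable {S}

/-- A function `κ` on the part of `X` over `Y ∖ D` that is locally constant relative to the flat
sections, also near the points over `D`, defines a continuous map to the covering. -/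
theorem exists_lift {X : Type*} [TopologicalSpace X] {q : X → Y} (hq : Continuous q)
    (κ : ↥(q ⁻¹' Dᶜ) → S) (hne : ∀ x : X, (comap ((↑) : ↥(q ⁻¹' Dᶜ) → X) (𝓝 x)).NeBot)
    (hκ : ∀ x : X, ∃ c : S, ∀ᶠ x' in comap ((↑) : ↥(q ⁻¹' Dᶜ) → X) (𝓝 x),
      (A.τ (q x) (Dᶜ.restrictPreimage q x'))⁻¹ • κ x' = c) :
    ∃ f : X → (A.core S).TotalSpace, Continuous f ∧ (∀ x, (f x).1 = q x) ∧
      ∀ x, ∀ᶠ x' in comap ((↑) : ↥(q ⁻¹' Dᶜ) → X) (𝓝 x),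
        (A.τ (q x) (Dᶜ.restrictPreimage q x'))⁻¹ • κ x' = (f x).2 := by
  choose c hc using hκ
  refine ⟨fun x => ⟨q x, c x⟩, ?_, fun x => rfl, hc⟩
  rw [continuous_iff_continuousAt]
  intro x
  rw [FiberBundle.continuousAt_totalSpace]
  refine ⟨hq.continuousAt, ?_⟩
  have h : ∀ᶠ x' in 𝓝 x, A.transition (q x') (q x) (q x') • c x' = c x := by
    filter_upwards [(hc x).eventually_comap_nhds,
      hq.continuousAt.eventually ((A.isOpen_U _).mem_nhds (A.mem_U (q x)))] with x' h1 h2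
    have h3 := A.eventually_transition (A.mem_U (q x')) h2
    have h4 : Tendsto (Dᶜ.restrictPreimage q) (comap ((↑) : ↥(q ⁻¹' Dᶜ) → X) (𝓝 x'))
        (comap ((↑) : ↥Dᶜ → Y) (𝓝 (q x'))) := by
      rw [tendsto_comap_iff]
      exact (hq.tendsto x').comp tendsto_comap
    have := hne x'
    obtain ⟨z, hz1, hz2, hz3⟩ := (h1.and ((h4.eventually h3).and (hc x'))).exists
    rw [← hz1, ← hz2, ← hz3, mul_smul, smul_inv_smul]
  have h5 : (fun x' => A.transition (q x') (q x) (q x') • c x') =ᶠ[𝓝 x] fun _ => c x := h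
  exact continuousAt_const.congr h5.symm

end FlatCover

/-! ### Discs and punctured discs -/

namespace Holonomy

variable {B : Type*} [TopologicalSpace B] {P : Type*} [Group P] (H : Holonomy B P)

theorem hol_congr {x y x' y' : B} {γ : Path x y} {γ' : Path x' y'} (h : ∀ t, γ t = γ' t) :
    H.hol γ = H.hol γ' := by
  obtain rfl : x = x' := by rw [← γ.source, ← γ'.source, h]
  obtain rfl : y = y' := by rw [← γ.target, ← γ'.target, h]
  obtain rfl : γ = γ' := Path.ext (funext h)
  rfl

theorem isTrivialOn_of_simplyConnected {O : Set B} [SimplyConnectedSpace O] :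
    H.IsTrivialOn O := by
  intro x y γ γ' h h'
  have hx : x ∈ O := h ⟨0, γ.source⟩
  have hy : y ∈ O := h ⟨1, γ.target⟩
  let η : Path (⟨x, hx⟩ : O) ⟨y, hy⟩ :=
    { toFun := fun t => ⟨γ t, h ⟨t, rfl⟩⟩
      source' := Subtype.ext γ.source
      target' := Subtype.ext γ.target }
  let η' : Path (⟨x, hx⟩ : O) ⟨y, hy⟩ :=
    { toFun := fun t => ⟨γ' t, h' ⟨t, rfl⟩⟩
      source' := Subtype.ext γ'.source
      target' := Subtype.ext γ'.target }
  exact H.hol_homotopic ((SimplyConnectedSpace.paths_homotopic η η').map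
    ⟨Subtype.val, continuous_subtype_val⟩)

end Holonomy

theorem exists_simplyConnected_nhds {M : Type*} [TopologicalSpace M] [ChartedSpace ℂ M] {x : M}
    {O : Set M} (hO : O ∈ 𝓝 x) :
    ∃ W ⊆ O, IsOpen W ∧ x ∈ W ∧ SimplyConnectedSpace W := by
  set e := chartAt ℂ x
  have hx := mem_chart_source ℂ x
  have h1 : e.symm ⁻¹' O ∈ 𝓝 (e x) := by
    refine (e.symm.continuousAt (e.map_source hx)).preimage_mem_nhds ?_
    rwa [e.left_inv hx]
  obtain ⟨R, hR, hball⟩ := Metric.mem_nhds_iff.1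
    (inter_mem h1 (e.open_target.mem_nhds (e.map_source hx)))
  refine ⟨e.symm '' Metric.ball (e x) R, ?_, ?_, ?_, ?_⟩
  · rintro _ ⟨z, hz, rfl⟩; exact (hball hz).1
  · exact e.symm.isOpen_image_of_subset_source Metric.isOpen_ball fun z hz => (hball hz).2
  · exact ⟨e x, Metric.mem_ball_self hR, e.left_inv hx⟩
  · have : ContractibleSpace (Metric.ball (e x) R) :=
      (convex_ball _ _).contractibleSpace ⟨_, Metric.mem_ball_self hR⟩
    let f : Metric.ball (e x) R ≃ₜ e.symm '' Metric.ball (e x) R :=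
      e.symm.homeomorphOfImageSubsetSource (fun z hz => (hball hz).2) rfl
    exact f.symm.toHomotopyEquiv.simplyConnectedSpace

/-- The exponential map on a half-plane is the universal covering of the punctured disc. It yields
connectedness here and the analysis of transport around a puncture below. -/
theorem image_exp_halfPlane (c : ℂ) {r : ℝ} (hr : 0 < r) :
    (fun ζ : ℂ => c + Complex.exp ζ) '' {ζ | ζ.re < Real.log r} = Metric.ball c r \ {c} := by
  ext z
  simp only [mem_image, mem_ofPred_eq, Set.mem_sdiff, mem_singleton_iff, mem_ball_iff_norm]
  constructor
  · rintro ⟨ζ, hζ, rfl⟩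
    refine ⟨?_, by simp⟩
    rw [add_sub_cancel_left, Complex.norm_exp]
    exact (Real.lt_log_iff_exp_lt hr).1 hζ
  · rintro ⟨h1, h2⟩
    have h3 : z - c ≠ 0 := sub_ne_zero.2 h2
    refine ⟨Complex.log (z - c), ?_, by rw [Complex.exp_log h3]; ring⟩
    rw [Complex.log_re]
    exact Real.log_lt_log (norm_pos_iff.2 h3) h1

theorem isConnected_ball_diff_center (c : ℂ) {r : ℝ} (hr : 0 < r) :
    IsConnected (Metric.ball c r \ {c}) := by
  rw [← image_exp_halfPlane c hr]
  refine IsConnected.image ?_ _ (by fun_prop)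
  refine (convex_halfSpace_re_lt _).isConnected ⟨((Real.log r - 1 : ℝ) : ℂ), ?_⟩
  simp

/-- In a Riemann surface, small punctured neighbourhoods are connected. -/
theorem exists_isConnected_diff_nhds {M : Type*} [TopologicalSpace M] [ChartedSpace ℂ M] [T1Space M]
    {x : M} {O F : Set M} (hO : O ∈ 𝓝 x) (hF : F.Finite) :
    ∃ W ⊆ O, IsOpen W ∧ x ∈ W ∧ IsConnected (W \ F) := by
  set e := chartAt ℂ x
  have hx := mem_chart_source ℂ x
  have h1 : e.symm ⁻¹' (O ∩ (F \ {x})ᶜ) ∈ 𝓝 (e x) := by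
    refine (e.symm.continuousAt (e.map_source hx)).preimage_mem_nhds ?_
    rw [e.left_inv hx]
    exact inter_mem hO ((hF.subset sdiff_subset).isClosed.isOpen_compl.mem_nhds (by simp))
  obtain ⟨R, hR, hball⟩ := Metric.mem_nhds_iff.1
    (inter_mem h1 (e.open_target.mem_nhds (e.map_source hx)))
  have hcont : ContinuousOn e.symm (Metric.ball (e x) R) :=
    e.continuousOn_symm.mono fun z hz => (hball hz).2
  refine ⟨e.symm '' Metric.ball (e x) R, ?_, ?_, ?_, ?_⟩
  · rintro _ ⟨z, hz, rfl⟩; exact (hball hz).1.1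
  · exact e.symm.isOpen_image_of_subset_source Metric.isOpen_ball fun z hz => (hball hz).2
  · exact ⟨e x, Metric.mem_ball_self hR, e.left_inv hx⟩
  · by_cases hxF : x ∈ F
    · have : e.symm '' Metric.ball (e x) R \ F = e.symm '' (Metric.ball (e x) R \ {e x}) := by
        ext y; constructor
        · rintro ⟨⟨z, hz, rfl⟩, hy⟩
          refine ⟨z, ⟨hz, ?_⟩, rfl⟩
          rintro rfl
          exact hy (by rwa [e.left_inv hx])
        · rintro ⟨z, ⟨hz, hne⟩, rfl⟩
          refine ⟨⟨z, hz, rfl⟩, fun hy => (hball hz).1.2 ⟨hy, fun h => hne ?_⟩⟩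
          rw [mem_singleton_iff] at h ⊢
          rw [← h, e.right_inv (hball hz).2]
      rw [this]
      exact (isConnected_ball_diff_center _ hR).image _ (hcont.mono sdiff_subset)
    · have : e.symm '' Metric.ball (e x) R \ F = e.symm '' Metric.ball (e x) R := by
        refine sdiff_eq_left.2 (disjoint_left.2 ?_)
        rintro _ ⟨z, hz, rfl⟩ hy
        exact (hball hz).1.2 ⟨hy, fun h => hxF (h ▸ hy)⟩
      rw [this]
      exact (Metric.isConnected_ball hR).image _ hcont

theorem neBot_comap_nhds_of_finite {M : Type*} [TopologicalSpace M] [ChartedSpace ℂ M] [T1Space M]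
    {F : Set M} (hF : F.Finite) (x : M) : (comap ((↑) : ↥Fᶜ → M) (𝓝 x)).NeBot := by
  rw [comap_neBot_iff]
  intro t ht
  obtain ⟨W, hWt, -, -, ⟨y, hy⟩, -⟩ := exists_isConnected_diff_nhds ht hF
  exact ⟨⟨y, hy.2⟩, hWt hy.1⟩

/-- Every point has a neighbourhood that remains connected after F is removed and hence lies on one
side of a separation of the complement. The separation would therefore extend to M. -/
theorem isConnected_compl_of_finite {M : Type*} [TopologicalSpace M] [ChartedSpace ℂ M] [T1Space M]
    [ConnectedSpace M] {F : Set M} (hF : F.Finite) : IsConnected Fᶜ := by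
  obtain ⟨x₀⟩ := (inferInstance : Nonempty M)
  obtain ⟨W, -, -, -, ⟨y, hy⟩, -⟩ := exists_isConnected_diff_nhds (x := x₀) univ_mem hF
  refine ⟨⟨y, hy.2⟩, ?_⟩
  rw [isPreconnected_iff_subset_of_disjoint]
  intro u v hu hv huv hdis
  let u' : Set M := {x | ∃ W, IsOpen W ∧ x ∈ W ∧ W \ F ⊆ u}
  let v' : Set M := {x | ∃ W, IsOpen W ∧ x ∈ W ∧ W \ F ⊆ v}
  have hu' : IsOpen u' := isOpen_iff_forall_mem_open.2 fun x ⟨W, h1, h2, h3⟩ =>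
    ⟨W, fun z hz => ⟨W, h1, hz, h3⟩, h1, h2⟩
  have hv' : IsOpen v' := isOpen_iff_forall_mem_open.2 fun x ⟨W, h1, h2, h3⟩ =>
    ⟨W, fun z hz => ⟨W, h1, hz, h3⟩, h1, h2⟩
  have hcov : (univ : Set M) ⊆ u' ∪ v' := by
    intro x _
    obtain ⟨W, -, h1, h2, h3⟩ := exists_isConnected_diff_nhds (x := x) univ_mem hF
    rcases isPreconnected_iff_subset_of_disjoint.1 h3.isPreconnected u v hu hv
      (fun z hz => huv hz.2)
      (eq_empty_of_subset_empty fun z hz => hdis.subset ⟨hz.1.2, hz.2⟩) with h | h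
    · exact Or.inl ⟨W, h1, h2, h⟩
    · exact Or.inr ⟨W, h1, h2, h⟩
  have hdis' : univ ∩ (u' ∩ v') = ∅ := by
    rw [univ_inter, eq_empty_iff_forall_notMem]
    rintro x ⟨⟨W, h1, h2, h3⟩, W', h1', h2', h3'⟩
    obtain ⟨V, hV, -, -, ⟨z, hz⟩, -⟩ := exists_isConnected_diff_nhds
      (inter_mem (h1.mem_nhds h2) (h1'.mem_nhds h2')) hF
    exact hdis.subset ⟨hz.2, h3 ⟨(hV hz.1).1, hz.2⟩, h3' ⟨(hV hz.1).2, hz.2⟩⟩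
  have key : ∀ {t t' : Set M}, IsOpen t → (univ : Set M) ⊆ t' →
      (∀ x ∈ t', ∃ W, IsOpen W ∧ x ∈ W ∧ W \ F ⊆ t) → Fᶜ ⊆ t := fun _ h1 h2 x hx => by
    obtain ⟨W, -, h3, h4⟩ := h2 x (h1 trivial)
    exact h4 ⟨h3, hx⟩
  rcases isPreconnected_iff_subset_of_disjoint.1 isPreconnected_univ u' v' hu' hv' hcov hdis'
    with h | h
  · exact Or.inl (key hu h fun x hx => hx)
  · exact Or.inr (key hv h fun x hx => hx)

/-- Parallel transport around a puncture is trivial if it is trivial along one small circle. -/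
theorem IsCircleAround.exists_isTrivialOn {Y : Type*} [TopologicalSpace Y] [ChartedSpace ℂ Y]
    {D : Set Y} {P : Type*} [Group P] (H : Holonomy ↥Dᶜ P) {b : Y} (hb : b ∈ D) {y : ↥Dᶜ}
    {γ : Path y y} (hγ : IsCircleAround b γ) (hhol : H.hol γ = 1) :
    ∃ U : Set Y, IsOpen U ∧ b ∈ U ∧ (∀ z ∈ U, z ∈ D → z = b) ∧
      IsPathConnected ((↑) ⁻¹' U : Set ↥Dᶜ) ∧ H.IsTrivialOn ((↑) ⁻¹' U) := by
  obtain ⟨r, hr, htarget, hD, hγ⟩ := hγ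
  set φ := chartAt ℂ b
  set c := φ b
  have hbs : b ∈ φ.source := mem_chart_source ℂ b
  have hmem : ∀ ζ : ℂ, ζ.re ≤ Real.log r → c + Complex.exp ζ ∈ Metric.closedBall c r := by
    intro ζ hζ
    rw [mem_closedBall_iff_norm, add_sub_cancel_left, Complex.norm_exp]
    exact (Real.le_log_iff_exp_le hr).1 hζ
  -- The half-plane is closed so that the circle of radius r itself lifts to it. It is convex, so
  -- transport pulled back along ζ ↦ c + exp ζ depends only on end points.
  let A : Set ℂ := {ζ | ζ.re ≤ Real.log r}
  have hA : ContractibleSpace A := (convex_halfSpace_re_le _).contractibleSpace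
    ⟨(Real.log r : ℂ), by simp⟩
  let j : C(A, ↥Dᶜ) := ⟨fun ζ => ⟨φ.symm (c + Complex.exp ζ), fun h => by
      have := hD _ (hmem ζ ζ.2) h
      simp at this⟩, by
    refine Continuous.subtype_mk ?_ _
    exact φ.continuousOn_symm.comp_continuous (by fun_prop) fun ζ => htarget (hmem ζ ζ.2)⟩
  have hj : ∀ ζ : A, (j ζ : Y) = φ.symm (c + Complex.exp ζ) := fun _ => rfl
  let h : A → A → P := fun ζ ζ' => H.hol ((PathConnectedSpace.somePath ζ ζ').map j.continuous)
  have hh : ∀ {ζ ζ' : A} (Z : Path ζ ζ'), H.hol (Z.map j.continuous) = h ζ ζ' := fun Z =>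
    H.hol_homotopic ((SimplyConnectedSpace.paths_homotopic Z _).map j)
  have hmul : ∀ ζ ζ' ζ'' : A, h ζ ζ'' = h ζ' ζ'' * h ζ ζ' := by
    intro ζ ζ' ζ''
    rw [← hh ((PathConnectedSpace.somePath ζ ζ').trans (PathConnectedSpace.somePath ζ' ζ'')),
      Path.map_trans, H.hol_trans]
  let per : ℂ := 2 * Real.pi * Complex.I
  have hper₀ : per.re = 0 := by simp [per]
  let tr : A → A := fun ζ => ⟨ζ + per, by
    have := ζ.2
    simp only [A, mem_ofPred_eq, Complex.add_re, hper₀, add_zero] at this ⊢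
    exact this⟩
  have htr : Continuous tr := by fun_prop
  have hjtr : ∀ ζ, j (tr ζ) = j ζ := fun ζ => Subtype.ext <| by
    rw [hj, hj]
    simp [tr, per, Complex.exp_periodic (ζ : ℂ)]
  have htrans : ∀ ζ ζ', h (tr ζ) (tr ζ') = h ζ ζ' := by
    intro ζ ζ'
    rw [← hh ((PathConnectedSpace.somePath ζ ζ').map htr)]
    exact H.hol_congr fun t => hjtr _
  let ζ₀ : A := ⟨(Real.log r : ℂ), by simp [A]⟩
  -- The circle lifts to the vertical segment from log r to log r + 2πi, so trivial transport around
  -- it makes transport in the half-plane periodic.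
  have hcirc : h ζ₀ (tr ζ₀) = 1 := by
    let Z : Path ζ₀ (tr ζ₀) :=
      { toFun := fun t => ⟨(Real.log r : ℂ) + per * (t : ℝ), by simp [A, per]⟩
        source' := Subtype.ext (by simp [ζ₀])
        target' := Subtype.ext (by simp [ζ₀, tr])
        continuous_toFun := by fun_prop }
    rw [← hh Z, ← hhol]
    refine H.hol_congr fun t => Subtype.ext ?_
    rw [hγ]
    change φ.symm (c + Complex.exp ((Real.log r : ℂ) + per * (t : ℝ))) = _
    rw [Complex.exp_add, ← Complex.ofReal_exp, Real.exp_log hr]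
  classical
  -- The extension by 1 off A serves only to state periodicity on all of ℂ; translation by 2πi
  -- preserves both A and its complement.
  let T : ℂ → P := fun ζ => if hζ : ζ ∈ A then h ζ₀ ⟨ζ, hζ⟩ else 1
  have hT : ∀ ζ : A, T ζ = h ζ₀ ζ := fun ζ => dif_pos ζ.2
  have hper : Function.Periodic T per := by
    intro ζ
    by_cases hζ : ζ ∈ A
    · have h1 := hT (tr ⟨ζ, hζ⟩)
      change T (ζ + per) = _ at h1
      rw [h1, hT ⟨ζ, hζ⟩, hmul ζ₀ (tr ζ₀), htrans, hcirc, mul_one]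
    · have hζ' : ζ + per ∉ A := by
        simp only [A, mem_ofPred_eq, Complex.add_re, hper₀, add_zero] at hζ ⊢
        exact hζ
      simp [T, hζ, hζ']
  have hexp : ∀ ζ ζ' : A, Complex.exp ζ = Complex.exp ζ' → T ζ = T ζ' := by
    intro ζ ζ' he
    obtain ⟨n, hn⟩ := Complex.exp_eq_exp_iff_exists_int.1 he
    rw [hn]
    exact hper.int_mul n _
  let U : Set Y := φ.source ∩ φ ⁻¹' Metric.ball c r
  have hU1 : ∀ z ∈ U, z ∈ D → z = b := by
    rintro z ⟨hz1, hz2⟩ hz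
    have := hD (φ z) (Metric.ball_subset_closedBall hz2) (by rwa [φ.left_inv hz1])
    exact φ.injOn hz1 hbs this
  -- A path in the punctured disc lifts through exp. Its transport is a quotient of values of T, and
  -- these depend only on the exponentials, hence only on the end points of the path.
  have hlift : ∀ {x x' : ↥Dᶜ} (η : Path x x'), range η ⊆ (↑) ⁻¹' U → ∃ ζ ζ' : A,
      Complex.exp ζ = φ x - c ∧ Complex.exp ζ' = φ x' - c ∧ H.hol η = T ζ' * (T ζ)⁻¹ := by
    intro x x' η hη
    have hη' : ∀ t, (η t : Y) ∈ U := fun t => hη ⟨t, rfl⟩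
    have hne : ∀ t, φ (η t) - c ≠ 0 := fun t h0 => by
      have : (η t : Y) = b := φ.injOn (hη' t).1 hbs (sub_eq_zero.1 h0)
      exact (η t).2 (this ▸ hb)
    let ξ : C(unitInterval, {z : ℂ // z ≠ 0}) := ⟨fun t => ⟨φ (η t) - c, hne t⟩, by
      refine Continuous.subtype_mk (Continuous.sub ?_ continuous_const) _
      exact φ.continuousOn.comp_continuous (continuous_subtype_val.comp η.continuous)
        fun t => (hη' t).1⟩
    obtain ⟨Z, hZ, -⟩ := Complex.isCoveringMap_exp.exists_path_lifts ξ
      (Complex.log (φ (η 0) - c)) (Subtype.ext (Complex.exp_log (hne 0)).symm)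
    have hZ' : ∀ t, Complex.exp (Z t) = φ (η t) - c := fun t =>
      congrArg Subtype.val (congrFun hZ t)
    have hZA : ∀ t, Z t ∈ A := fun t => by
      have h1 := (hη' t).2
      rw [mem_preimage, mem_ball_iff_norm, ← hZ', Complex.norm_exp] at h1
      exact ((Real.lt_log_iff_exp_lt hr).2 h1).le
    let Z' : Path (⟨Z 0, hZA 0⟩ : A) ⟨Z 1, hZA 1⟩ :=
      { toFun := fun t => ⟨Z t, hZA t⟩, source' := rfl, target' := rfl }
    refine ⟨⟨Z 0, hZA 0⟩, ⟨Z 1, hZA 1⟩, by rw [hZ', η.source], by rw [hZ', η.target], ?_⟩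
    rw [hT, hT, hmul ζ₀ ⟨Z 0, hZA 0⟩ ⟨Z 1, hZA 1⟩, mul_inv_cancel_right, ← hh Z']
    refine H.hol_congr fun t => Subtype.ext ?_
    change (η t : Y) = φ.symm (c + Complex.exp (Z t))
    rw [hZ', add_sub_cancel, φ.left_inv (hη' t).1]
  refine ⟨U, φ.isOpen_inter_preimage Metric.isOpen_ball, ⟨hbs, Metric.mem_ball_self hr⟩, hU1,
    ?_, ?_⟩
  · have hO : ((↑) ⁻¹' U : Set ↥Dᶜ) = j '' {ζ : A | (ζ : ℂ).re < Real.log r} := by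
      ext x
      constructor
      · rintro ⟨h1, h2⟩
        have hx : φ x ∈ Metric.ball c r \ {c} := ⟨h2, fun h0 => x.2
          (by rwa [φ.injOn h1 hbs h0])⟩
        rw [← image_exp_halfPlane c hr] at hx
        obtain ⟨ζ, hζ, h3⟩ := hx
        refine ⟨⟨ζ, (show ζ.re < Real.log r from hζ).le⟩, hζ, Subtype.ext ?_⟩
        rw [hj]
        change φ.symm (c + Complex.exp ζ) = x
        rw [show c + Complex.exp ζ = φ x from h3, φ.left_inv h1]
      · rintro ⟨ζ, hζ, rfl⟩
        have h1 : c + Complex.exp ζ ∈ Metric.ball c r \ {c} := by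
          rw [← image_exp_halfPlane c hr]; exact ⟨ζ, hζ, rfl⟩
        have h2 := htarget (hmem ζ ζ.2)
        refine ⟨φ.map_target h2, ?_⟩
        rw [mem_preimage, hj, φ.right_inv h2]
        exact h1.1
    rw [hO]
    refine IsPathConnected.image ?_ j.continuous
    have hconv : IsPathConnected {ζ : ℂ | ζ.re < Real.log r} :=
      (convex_halfSpace_re_lt _).isPathConnected ⟨((Real.log r - 1 : ℝ) : ℂ), by simp⟩
    have := hconv.preimage_coe (U := A) fun ζ (hζ : ζ.re < _) => hζ.le
    exact this
  · intro x x' η η' h1 h2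
    obtain ⟨ζ, ζ', e1, e2, e3⟩ := hlift η h1
    obtain ⟨ξ, ξ', f1, f2, f3⟩ := hlift η' h2
    rw [e3, f3, hexp ζ ξ (e1.trans f1.symm), hexp ζ' ξ' (e2.trans f2.symm)]

/-! ### Étale quotients of coverings -/

theorem locallyPathConnectedSpace_compl {Y : Type*} [TopologicalSpace Y] [ChartedSpace ℂ Y]
    {D : Set Y} (hD : IsClosed D) : LocallyPathConnectedSpace ↥Dᶜ := by
  have := ChartedSpace.locallyPathConnectedSpace ℂ Y
  exact hD.isOpen_compl.locallyPathConnectedSpace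

theorem pathConnectedSpace_compl {Y : Type*} [TopologicalSpace Y] [ChartedSpace ℂ Y] [T1Space Y]
    [ConnectedSpace Y] {D : Set Y} (hD : D.Finite) : PathConnectedSpace ↥Dᶜ := by
  have := locallyPathConnectedSpace_compl hD.isClosed
  have := isConnected_iff_connectedSpace.1 (isConnected_compl_of_finite hD)
  exact pathConnectedSpace_iff_connectedSpace.2 this

theorem t2Space_of_isSeparatedMap {X Y : Type*} [TopologicalSpace X] [TopologicalSpace Y] [T2Space Y]
    {f : X → Y} (hf : Continuous f) (hs : IsSeparatedMap f) : T2Space X := by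
  refine ⟨fun x y hxy => ?_⟩
  by_cases h : f x = f y
  · exact hs x y h hxy
  · obtain ⟨u, v, hu, hv, hxu, hyv, hd⟩ := t2_separation h
    exact ⟨_, _, hu.preimage hf, hv.preimage hf, hxu, hyv, hd.preimage f⟩

/-- Replacing the connecting path ε by δ conjugates the loop by the class of ε δ⁻¹, so triviality of
a local monodromy does not depend on the path. -/
theorem map_conj_path_eq_one {B : Type*} [TopologicalSpace B] {b y : B} {P : Type*} [Group P]
    (ρ : FundamentalGroup B b →* P) (ε δ : Path b y) (γ : Path y y)
    (h : ρ (FundamentalGroup.fromPath (.mk ((ε.trans γ).trans ε.symm))) = 1) :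
    ρ (FundamentalGroup.fromPath (.mk ((δ.trans γ).trans δ.symm))) = 1 := by
  have h1 : FundamentalGroup.fromPath (.mk ((δ.trans γ).trans δ.symm)) =
      FundamentalGroup.fromPath (.mk (ε.trans δ.symm)) *
        (FundamentalGroup.fromPath (.mk ((ε.trans γ).trans ε.symm)) *
          FundamentalGroup.fromPath (.mk (δ.trans ε.symm))) := by
    simp only [FundamentalGroup.mul_def]
    simp only [Path.Homotopic.Quotient.mk_trans, Path.Homotopic.Quotient.mk_symm,
      Path.Homotopic.Quotient.trans_assoc]
    rw [← Path.Homotopic.Quotient.trans_assoc (.symm (.mk ε)) (.mk ε),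
      Path.Homotopic.Quotient.symm_trans, Path.Homotopic.Quotient.refl_trans,
      ← Path.Homotopic.Quotient.trans_assoc (.symm (.mk ε)) (.mk ε),
      Path.Homotopic.Quotient.symm_trans, Path.Homotopic.Quotient.refl_trans]
  have h2 : FundamentalGroup.fromPath (.mk (ε.trans δ.symm)) *
      FundamentalGroup.fromPath (.mk (δ.trans ε.symm)) = 1 := by
    simp only [FundamentalGroup.mul_def, FundamentalGroup.one_def]
    simp only [Path.Homotopic.Quotient.mk_trans, Path.Homotopic.Quotient.mk_symm,
      Path.Homotopic.Quotient.trans_assoc]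
    rw [← Path.Homotopic.Quotient.trans_assoc (.symm (.mk ε)) (.mk ε),
      Path.Homotopic.Quotient.symm_trans, Path.Homotopic.Quotient.refl_trans,
      Path.Homotopic.Quotient.trans_symm]
  rw [h1, map_mul, map_mul, h, one_mul, ← map_mul, h2, map_one]

section

variable {Y : Type*} [TopologicalSpace Y] [ChartedSpace ℂ Y] [T1Space Y] {D : Set Y}
  {P : Type*} [Group P]

omit [T1Space Y] in
theorem exists_simplyConnected_nhds_compl (hD : IsClosed D) (v : ↥Dᶜ) :
    ∃ W : Set ↥Dᶜ, IsOpen W ∧ v ∈ W ∧ SimplyConnectedSpace W := by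
  let : ChartedSpace ℂ ↥Dᶜ :=
    inferInstanceAs (ChartedSpace ℂ (⟨Dᶜ, hD.isOpen_compl⟩ : TopologicalSpace.Opens Y))
  obtain ⟨W, -, h⟩ := exists_simplyConnected_nhds (x := v) univ_mem
  exact ⟨W, h⟩

/-- Near a point of D the trivial local monodromy yields a flat section on a punctured disc; away
from D a simply connected neighbourhood suffices. -/
theorem exists_flatCover (hD : D.Finite) (H : Holonomy ↥Dᶜ P)
    (hloc : ∀ b ∈ D, ∃ (y : ↥Dᶜ) (γ : Path y y), IsCircleAround b γ ∧ H.hol γ = 1) :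
    Nonempty (FlatCover H) := by
  have := locallyPathConnectedSpace_compl hD.isClosed
  have key : ∀ i : Y, ∃ (U : Set Y) (τ : ↥Dᶜ → P), IsOpen U ∧ i ∈ U ∧ (∀ y ∈ U, y ∈ D → y = i) ∧
      ∀ v : ↥Dᶜ, (v : Y) ∈ U → H.FlatAt id τ v := by
    intro i
    by_cases hi : i ∈ D
    · obtain ⟨y, γ, hγ, h1⟩ := hloc i hi
      obtain ⟨U, hU, hiU, hUD, hc, ht⟩ := hγ.exists_isTrivialOn H hi h1
      obtain ⟨τ, hτ⟩ := ht.exists_flat (hU.preimage continuous_subtype_val) hc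
      exact ⟨U, τ, hU, hiU, hUD, hτ⟩
    · obtain ⟨W, hW, hiW, hs⟩ := exists_simplyConnected_nhds_compl hD.isClosed ⟨i, hi⟩
      obtain ⟨τ, hτ⟩ := H.isTrivialOn_of_simplyConnected.exists_flat hW
        (isPathConnected_iff_pathConnectedSpace.2 inferInstance)
      refine ⟨(↑) '' W, τ, hD.isClosed.isOpen_compl.isOpenMap_subtype_val W hW, ⟨_, hiW, rfl⟩,
        ?_, ?_⟩
      · rintro _ ⟨v, -, rfl⟩ hv
        exact absurd hv v.2
      · rintro v ⟨v', hv', h⟩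
        obtain rfl := Subtype.ext h
        exact hτ _ hv'
  choose U τ h1 h2 h3 h4 using key
  refine ⟨⟨U, h1, h2, h3, τ, h4, fun v => ?_, neBot_comap_nhds_of_finite hD⟩⟩
  obtain ⟨W, hW, hvW, hs⟩ := exists_simplyConnected_nhds_compl hD.isClosed v
  exact ⟨W, hW.mem_nhds hvW, H.isTrivialOn_of_simplyConnected⟩

omit [ChartedSpace ℂ Y] [T1Space Y] in
theorem FlatCover.eventually_inv_smul_eq {S : Type*} [MulAction P S] {H : Holonomy ↥Dᶜ P}
    (A : FlatCover H) {X : Type*} [TopologicalSpace X] {q : X → ↥Dᶜ} {κ : X → S} {x : X} {i : Y}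
    (hκ : H.FlatAt q κ x) (hq : ContinuousAt q x) (hi : (q x : Y) ∈ A.U i) :
    ∀ᶠ x' in 𝓝 x, (A.τ i (q x'))⁻¹ • κ x' = (A.τ i (q x))⁻¹ • κ x := by
  obtain ⟨O, hO, ht⟩ := A.trivial (q x)
  exact hκ.eventually_inv_smul_eq (A.flat i _ hi) hq hO ht

end

theorem exists_flatCover_ofHom {Y : Type*} [TopologicalSpace Y] [ChartedSpace ℂ Y] [T1Space Y]
    [ConnectedSpace Y] {D : Set Y} (hD : D.Finite) (y₀ : ↥Dᶜ) {P : Type*} [Group P]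
    (ρ : FundamentalGroup ↥Dᶜ y₀ →* P)
    (hloc : ∀ b ∈ D, ∃ (y : ↥Dᶜ) (δ : Path y₀ y) (γ : Path y y), IsCircleAround b γ ∧
      ρ (FundamentalGroup.fromPath
        (Path.Homotopic.Quotient.mk ((δ.trans γ).trans δ.symm))) = 1) :
    ∃ δ : ∀ v : ↥Dᶜ, Path y₀ v, Nonempty (FlatCover (Holonomy.ofHom ρ δ)) := by
  have := pathConnectedSpace_compl hD
  refine ⟨fun v => PathConnectedSpace.somePath y₀ v, exists_flatCover hD _ fun b hb => ?_⟩
  obtain ⟨y, ε, γ, hγ, h1⟩ := hloc b hb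
  exact ⟨y, γ, hγ, map_conj_path_eq_one ρ ε _ γ h1⟩

/-- A representation of `π₁(Y ∖ D)` that is trivial on small circles around the points of `D`
defines a covering of `Y`; a branched covering of `Y` whose fibre maps equivariantly to the
representation factors through it. -/
theorem exists_etale_quotient {Y : Type w} [TopologicalSpace Y] [ChartedSpace ℂ Y] [T2Space Y]
    [ConnectedSpace Y] {D : Set Y} (hD : D.Finite)
    {X : Type u} [TopologicalSpace X] [ChartedSpace ℂ X] [T2Space X] [CompactSpace X]
    {q : X → Y} (hq : Continuous q) (cov : IsCoveringMap (Dᶜ.restrictPreimage q))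
    (hfin : (q ⁻¹' D).Finite) (y₀ : ↥Dᶜ) {S : Type v}
    (ρ : FundamentalGroup ↥Dᶜ y₀ →* Equiv.Perm S)
    (κ₀ : ↥(Dᶜ.restrictPreimage q ⁻¹' {y₀}) → S) (hsurj : Function.Surjective κ₀)
    (hκ₀ : ∀ γ x, κ₀ (cov.monodromyPerm y₀ γ x) = ρ γ (κ₀ x))
    (hloc : ∀ b ∈ D, ∃ (y : ↥Dᶜ) (δ : Path y₀ y) (γ : Path y y), IsCircleAround b γ ∧
      ρ (FundamentalGroup.fromPath
        (Path.Homotopic.Quotient.mk ((δ.trans γ).trans δ.symm))) = 1) :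
    ∃ (E : Type (max w v)) (_ : TopologicalSpace E) (h : E → Y) (f : X → E),
      IsCoveringMap h ∧ Continuous f ∧ h ∘ f = q ∧ Function.Surjective f ∧
      (∀ y, Nonempty (S ≃ h ⁻¹' {y})) ∧
      ∀ x x' : ↥(Dᶜ.restrictPreimage q ⁻¹' {y₀}), f x.1.1 = f x'.1.1 ↔ κ₀ x = κ₀ x' := by
  let : TopologicalSpace S := ⊥
  have : DiscreteTopology S := ⟨rfl⟩
  have hDc : IsClosed (q ⁻¹' D) := hfin.isClosed
  have : LocallyPathConnectedSpace ↥(q ⁻¹' Dᶜ) := locallyPathConnectedSpace_compl hDc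
  obtain ⟨δ, ⟨A⟩⟩ := exists_flatCover_ofHom hD y₀ ρ hloc
  let H := Holonomy.ofHom ρ δ
  have hH : ∀ {x y : ↥Dᶜ} (γ : Path x y), H.hol γ = ρ (FundamentalGroup.fromPath
    (Path.Homotopic.Quotient.mk (((δ x).trans γ).trans (δ y).symm))) := fun _ => rfl
  -- The labelling κ₀ of one fibre is carried to all others along the chosen paths. Equivariance of
  -- κ₀ is exactly what makes the result flat.
  let κv : ∀ v : ↥Dᶜ, ↥(Dᶜ.restrictPreimage q ⁻¹' {v}) → S := fun v x =>
    κ₀ (cov.monodromy (Path.Homotopic.Quotient.mk (δ v).symm) x)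
  let κ : ↥(q ⁻¹' Dᶜ) → S := fun x => κv (Dᶜ.restrictPreimage q x) ⟨x, rfl⟩
  have hflat : ∀ x, H.FlatAt (Dᶜ.restrictPreimage q) κ x := by
    intro x O hO
    filter_upwards [pathComponentIn_mem_nhds (cov.continuous.continuousAt hO)] with x' hx'
    have hj : JoinedIn (Dᶜ.restrictPreimage q ⁻¹' O) x x' := hx'
    refine ⟨hj.somePath.map cov.continuous, ?_, ?_⟩
    · rintro _ ⟨t, rfl⟩; exact hj.somePath_mem t
    · have h1 : cov.monodromy (.mk (hj.somePath.map cov.continuous)) ⟨x, rfl⟩ = ⟨x', rfl⟩ :=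
        cov.monodromy_map (.mk hj.somePath)
      have h2 : ∀ z, cov.monodromy (.mk (δ (Dᶜ.restrictPreimage q x)))
          (cov.monodromy (.mk (δ (Dᶜ.restrictPreimage q x)).symm) z) = z := by
        intro z
        rw [← cov.monodromy_trans_apply, Path.Homotopic.Quotient.mk_symm,
          Path.Homotopic.Quotient.symm_trans, cov.monodromy_refl, id]
      rw [hH, Equiv.Perm.smul_def, ← hκ₀, cov.coe_monodromyPerm]
      simp only [κ, κv]
      rw [Path.Homotopic.Quotient.mk_trans, Path.Homotopic.Quotient.mk_trans]
      erw [cov.monodromy_trans_apply, cov.monodromy_trans_apply, h2, h1]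
  have hflat' : ∀ (i : Y) (x : ↥(q ⁻¹' Dᶜ)), q x ∈ A.U i →
      ContinuousAt (fun x' => (A.τ i (Dᶜ.restrictPreimage q x'))⁻¹ • κ x') x := by
    intro i x hx
    have h := A.eventually_inv_smul_eq (hflat x) cov.continuous.continuousAt hx
    exact continuousAt_const.congr (h.mono fun _ h => h.symm)
  -- Relative to a flat section κ is locally constant. Near a point of X over D it is even constant,
  -- because a small punctured neighbourhood in X is connected; this extends f over the ramification
  -- points.
  obtain ⟨f, hf, hf1, hf2⟩ := A.exists_lift hq κ (neBot_comap_nhds_of_finite hfin) (by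
    intro x
    obtain ⟨W, hWO, hW, hxW, hc⟩ := exists_isConnected_diff_nhds
      (hq.continuousAt ((A.isOpen_U _).mem_nhds (A.mem_U (q x)))) hfin
    obtain ⟨⟨z, hz⟩, hpre⟩ := hc
    have hpre' : IsPreconnected ((↑) ⁻¹' W : Set ↥(q ⁻¹' Dᶜ)) := by
      rw [← Topology.IsInducing.subtypeVal.isPreconnected_image]
      convert hpre using 1
      ext a
      simp only [mem_image, mem_preimage, Subtype.exists, Set.mem_sdiff]
      constructor
      · rintro ⟨a, h1, h2, rfl⟩; exact ⟨h2, h1⟩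
      · rintro ⟨h1, h2⟩; exact ⟨a, h2, h1, rfl⟩
    refine ⟨(A.τ (q x) (Dᶜ.restrictPreimage q ⟨z, hz.2⟩))⁻¹ • κ ⟨z, hz.2⟩, ?_⟩
    · filter_upwards [preimage_mem_comap (hW.mem_nhds hxW)] with x' hx'
      exact hpre'.constant (fun a ha => (hflat' (q x) a (hWO ha)).continuousWithinAt) hx'
        (show (⟨z, hz.2⟩ : ↥(q ⁻¹' Dᶜ)) ∈ _ from hz.1))
  have hfv : ∀ (v : ↥Dᶜ) (x : ↥(Dᶜ.restrictPreimage q ⁻¹' {v})),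
      f x.1.1 = ⟨(v : Y), (A.τ v v)⁻¹ • κv v x⟩ := by
    rintro _ ⟨x, rfl⟩
    have h := hf2 x
    rw [← nhds_induced] at h
    have h' := h.self_of_nhds
    exact Bundle.TotalSpace.ext (hf1 x) (heq_of_eq h'.symm)
  have hκv : ∀ v, Function.Surjective (κv v) := fun v =>
    hsurj.comp (cov.monodromy_bijective _).2
  have hcov := A.isCoveringMap_core S
  refine ⟨_, inferInstance, (A.core S).proj, f, hcov, hf, funext hf1, ?_, ?_, ?_⟩
  -- Surjectivity: the image of f is compact, hence closed, and contains the dense part of the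
  -- covering over Y ∖ D.
  · have hT2 : T2Space (A.core S).TotalSpace :=
      t2Space_of_isSeparatedMap hcov.continuous hcov.isSeparatedMap
    have hcl : IsClosed (range f) := (isCompact_range hf).isClosed
    have hdense : Dense ((A.core S).proj ⁻¹' Dᶜ) := Dense.preimage
      (fun y => mem_closure_iff_comap_neBot.2 (neBot_comap_nhds_of_finite hD y)) hcov.isOpenMap
    have hsub : (A.core S).proj ⁻¹' Dᶜ ⊆ range f := by
      rintro ⟨y, s⟩ (hy : y ∉ D)
      obtain ⟨x, hx⟩ := hκv ⟨y, hy⟩ (A.τ y ⟨y, hy⟩ • (show S from s))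
      refine ⟨x.1.1, ?_⟩
      rw [hfv, hx, inv_smul_smul]
    intro e
    exact hcl.closure_subset_iff.2 hsub (hdense e)
  · intro y
    exact ⟨⟨fun s => ⟨⟨y, s⟩, rfl⟩, fun e => e.1.2, fun s => rfl, by rintro ⟨⟨y, s⟩, rfl⟩; rfl⟩⟩
  · intro x x'
    -- The chosen path δ y₀ may be a nontrivial loop, so κ₀ is recovered only up to a permutation,
    -- which does not affect equality of labels.
    have h1 : ∀ z, κv y₀ z = ρ (FundamentalGroup.fromPath (.mk (δ y₀).symm)) (κ₀ z) :=
      fun z => hκ₀ (FundamentalGroup.fromPath (.mk (δ y₀).symm)) z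
    rw [hfv, hfv]
    constructor
    · intro h
      have h2 : (A.τ y₀ y₀)⁻¹ • κv y₀ x = (A.τ y₀ y₀)⁻¹ • κv y₀ x' :=
        eq_of_heq (Bundle.TotalSpace.ext_iff.1 h).2
      rw [smul_left_cancel_iff, h1, h1] at h2
      exact (Equiv.injective _) h2
    · intro h
      rw [h1, h1, h]

/-- If all coverings of `Y` have sections through all points, then a representation of `π₁(Y ∖ D)`
that is trivial on small circles around the points of `D` is trivial. -/
theorem representation_eq_one_of_sections {Y : Type w} [TopologicalSpace Y] [ChartedSpace ℂ Y]
    [T1Space Y] [ConnectedSpace Y] {D : Set Y} (hD : D.Finite) (y₀ : ↥Dᶜ) {S : Type v}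
    (ρ : FundamentalGroup ↥Dᶜ y₀ →* Equiv.Perm S)
    (hloc : ∀ b ∈ D, ∃ (y : ↥Dᶜ) (δ : Path y₀ y) (γ : Path y y), IsCircleAround b γ ∧
      ρ (FundamentalGroup.fromPath
        (Path.Homotopic.Quotient.mk ((δ.trans γ).trans δ.symm))) = 1)
    (hsec : ∀ (E : Type (max w v)) [TopologicalSpace E] (h : E → Y), IsCoveringMap h → ∀ e : E,
      ∃ s : Y → E, Continuous s ∧ (∀ y, h (s y) = y) ∧ s (h e) = e)
    (g : FundamentalGroup ↥Dᶜ y₀) : ρ g = 1 := by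
  let : TopologicalSpace S := ⊥
  have : DiscreteTopology S := ⟨rfl⟩
  obtain ⟨δ, ⟨A⟩⟩ := exists_flatCover_ofHom hD y₀ ρ hloc
  let H := Holonomy.ofHom ρ δ
  obtain ⟨γ, rfl⟩ := Path.Homotopic.Quotient.mk_surjective g
  suffices hγ : H.hol γ = 1 by
    have h1 := map_conj_path_eq_one ρ (δ y₀) (Path.refl y₀) γ hγ
    simpa [Path.Homotopic.Quotient.mk_trans, Path.Homotopic.Quotient.mk_symm] using h1
  refine Equiv.ext fun s₀ => ?_
  let q : unitInterval → Y := fun t => γ t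
  have hq : Continuous q := continuous_subtype_val.comp γ.continuous
  -- Transporting s₀ along γ is a flat function on the interval, so it defines a path in the
  -- covering over γ. It starts and ends at the same point exactly when the holonomy fixes s₀.
  let κ : ↥(q ⁻¹' Dᶜ) → S := fun t => H.hol (γ.subpath 0 t.1) s₀
  have hmem : ∀ t, t ∈ q ⁻¹' Dᶜ := fun t => (γ t).2
  have hne : ∀ t : unitInterval, (comap ((↑) : ↥(q ⁻¹' Dᶜ) → unitInterval) (𝓝 t)).NeBot := by
    intro t
    refine NeBot.comap_of_range_mem inferInstance ?_
    rw [Subtype.range_coe, eq_univ_of_forall hmem]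
    exact univ_mem
  have hflat : ∀ t, H.FlatAt (Dᶜ.restrictPreimage q) κ t := by
    intro t O hO
    have h1 : γ ⁻¹' O ∈ 𝓝 (t : unitInterval) := γ.continuous.continuousAt hO
    have h2 := tendsto_smallSets_iff.1
      ((tendsto_const_nhds (x := (t : unitInterval))).uIcc continuousAt_subtype_val) _ h1
    filter_upwards [h2] with t' ht'
    refine ⟨γ.subpath t.1 t'.1,
      (γ.range_subpath t.1 t'.1).subset.trans (image_subset_iff.2 ht'), ?_⟩
    · change H.hol (γ.subpath 0 t'.1) s₀ = _
      rw [← H.hol_homotopic ⟨Path.Homotopy.subpathTransSubpath γ 0 t.1 t'.1⟩, H.hol_trans]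
      rfl
  obtain ⟨f, hf, hf1, hf2⟩ := A.exists_lift hq κ hne (by
    intro t
    have h := A.eventually_inv_smul_eq (hflat ⟨t, hmem t⟩) (i := q t)
      hq.restrictPreimage.continuousAt (A.mem_U _)
    rw [nhds_induced] at h
    exact ⟨_, h⟩)
  have hft : ∀ t, (A.τ (q t) (γ t))⁻¹ • κ ⟨t, hmem t⟩ = (f t).2 := by
    intro t
    have h := hf2 t
    rw [show t = ((⟨t, hmem t⟩ : ↥(q ⁻¹' Dᶜ)) : unitInterval) from rfl, ← nhds_induced] at h
    exact h.self_of_nhds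
  have hcov := A.isCoveringMap_core S
  -- A section through the starting point agrees with the whole lifted path by uniqueness of lifts,
  -- so the lift of the loop is closed.
  obtain ⟨s, hs, hs1, hs2⟩ := hsec _ _ hcov (f 0)
  have heq : s ∘ q = f := hcov.eq_of_comp_eq (hs.comp hq) hf
    (funext fun t => (hs1 (q t)).trans (hf1 t).symm) 0
    ((congrArg s (hf1 0).symm).trans hs2)
  have h01 : f 0 = f 1 := by
    rw [← heq]
    change s (γ 0) = s (γ 1)
    rw [γ.source, γ.target]
  have h2 : (A.τ (q 0) (γ 0))⁻¹ • κ ⟨0, hmem 0⟩ = (A.τ (q 1) (γ 1))⁻¹ • κ ⟨1, hmem 1⟩ := by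
    rw [hft, hft]
    exact eq_of_heq (Bundle.TotalSpace.ext_iff.1 h01).2
  have h3 : q 0 = q 1 := by simp only [q]; rw [γ.source, γ.target]
  rw [h3, γ.source, γ.target, smul_left_cancel_iff] at h2
  simp only [κ, Path.subpath_self, H.hol_refl, Path.subpath_zero_one, H.hol_cast] at h2
  exact h2.symm

/-! ### Critical points -/

section critical

variable {X : Type u} {Y : Type v} [TopologicalSpace X] [ChartedSpace ℂ X]
  [IsManifold 𝓘(ℂ, ℂ) ω X] [TopologicalSpace Y] [ChartedSpace ℂ Y] [IsManifold 𝓘(ℂ, ℂ) ω Y]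

omit [IsManifold 𝓘(ℂ, ℂ) ω X] [IsManifold 𝓘(ℂ, ℂ) ω Y] in
theorem IsHolomorphic.mdifferentiableAt {f : X → Y} (hf : IsHolomorphic f) (x : X) :
    MDifferentiableAt 𝓘(ℂ, ℂ) 𝓘(ℂ, ℂ) f x :=
  (hf x).mdifferentiableAt (by simp)

/-- The critical points of a holomorphic map with finite fibres are isolated. -/
theorem IsHolomorphic.eventually_mfderiv_ne_zero {f : X → Y} (hf : IsHolomorphic f)
    (hfib : ∀ y, (f ⁻¹' {y}).Finite) (x : X) :
    ∀ᶠ x' in 𝓝[≠] x, mfderiv 𝓘(ℂ, ℂ) 𝓘(ℂ, ℂ) f x' ≠ 0 := by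
  set φ := chartAt ℂ x with hφ
  set ψ := chartAt ℂ (f x) with hψ
  have hx : x ∈ φ.source := mem_chart_source ℂ x
  set F : ℂ → ℂ := ψ ∘ f ∘ φ.symm with hF
  have hF' : AnalyticAt ℂ F (φ x) := by
    obtain ⟨-, h⟩ := contMDiffAt_iff.1 (hf x)
    have h2 : ContDiffAt ℂ ω F (φ x) := by
      rw [← contDiffWithinAt_univ]
      simpa [mfld_simps] using h
    exact h2.analyticAt
  have hsrc : ∀ᶠ x' in 𝓝 x, x' ∈ φ.source ∧ f x' ∈ ψ.source :=
    (show ∀ᶠ x' in 𝓝 x, x' ∈ φ.source from φ.open_source.mem_nhds hx).and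
      (hf.continuous.continuousAt (ψ.open_source.mem_nhds (mem_chart_source ℂ _)))
  have hcrit : ∀ x', x' ∈ φ.source ∧ f x' ∈ ψ.source →
      mfderiv 𝓘(ℂ, ℂ) 𝓘(ℂ, ℂ) f x' = 0 → deriv F (φ x') = 0 := by
    rintro x' ⟨h1, h2⟩ h0
    have e1 : φ.symm (φ x') = x' := φ.left_inv h1
    have d1 : MDifferentiableAt 𝓘(ℂ, ℂ) 𝓘(ℂ, ℂ) φ.symm (φ x') :=
      mdifferentiableAt_atlas_symm (chart_mem_atlas ℂ x) (φ.map_source h1)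
    have d2 : MDifferentiableAt 𝓘(ℂ, ℂ) 𝓘(ℂ, ℂ) f (φ.symm (φ x')) := hf.mdifferentiableAt _
    have d3 : MDifferentiableAt 𝓘(ℂ, ℂ) 𝓘(ℂ, ℂ) ψ (f (φ.symm (φ x'))) :=
      mdifferentiableAt_atlas (chart_mem_atlas ℂ _) (by rwa [e1])
    have d4 : mfderiv 𝓘(ℂ, ℂ) 𝓘(ℂ, ℂ) F (φ x') = 0 := by
      rw [hF, mfderiv_comp (φ x') (I' := 𝓘(ℂ, ℂ)) (g := ψ) (f := f ∘ φ.symm) d3 (d2.comp _ d1),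
        mfderiv_comp (φ x') d2 d1, e1, h0]
      exact (congrArg _ (ContinuousLinearMap.zero_comp _)).trans (ContinuousLinearMap.comp_zero _)
    rw [mfderiv_eq_fderiv] at d4
    rw [← fderiv_apply_one_eq_deriv, d4]
    rfl
  -- The derivative of the local expression is analytic, so its zeros are isolated unless it
  -- vanishes near the point. In that case f is locally constant and has an infinite fibre.
  rcases hF'.deriv.eventually_eq_zero_or_eventually_ne_zero with h | h
  · exfalso
    obtain ⟨R, hR, hball⟩ := Metric.eventually_nhds_iff_ball.1 (h.and hF'.eventually_analyticAt)
    have hconst : ∀ z ∈ Metric.ball (φ x) R, F z = F (φ x) := by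
      intro z hz
      refine (convex_ball (φ x) R).is_const_of_fderivWithin_eq_zero (𝕜 := ℂ)
        (fun a ha => (hball a ha).2.differentiableAt.differentiableWithinAt) (fun a ha => ?_) hz
        (Metric.mem_ball_self hR)
      rw [fderivWithin_of_isOpen Metric.isOpen_ball ha]
      ext
      simpa using (hball a ha).1
    have hW : ∀ᶠ x' in 𝓝 x, f x' = f x := by
      filter_upwards [hsrc, φ.continuousAt hx (Metric.ball_mem_nhds _ hR)] with x' h1 h2
      have h3 := hconst _ h2
      simp only [hF, Function.comp_apply, φ.left_inv h1.1, φ.left_inv hx] at h3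
      exact ψ.injOn h1.2 (mem_chart_source ℂ _) h3
    obtain ⟨W, -, -⟩ := mem_nhds_iff.1 hW
    have hfin : ∀ᶠ z in 𝓝 (φ x), φ.symm z ∈ f ⁻¹' {f x} := by
      have := φ.symm.continuousAt (φ.map_source hx)
      rw [ContinuousAt, φ.left_inv hx] at this
      exact this.eventually hW
    have hfin2 : (φ.symm ⁻¹' (f ⁻¹' {f x}) ∩ φ.target).Finite :=
      Set.Finite.of_finite_image ((hfib (f x)).subset (by
        rintro _ ⟨z, hz, rfl⟩; exact hz.1)) (φ.symm.injOn.mono inter_subset_right)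
    have hnb : φ.symm ⁻¹' (f ⁻¹' {f x}) ∩ φ.target ∈ 𝓝 (φ x) :=
      inter_mem hfin (φ.open_target.mem_nhds (φ.map_source hx))
    exact infinite_of_mem_nhds _ hnb hfin2
  · rw [eventually_nhdsWithin_iff] at h ⊢
    filter_upwards [hsrc, (φ.continuousAt hx).eventually h] with x' h1 h2 hne h0
    exact h2 (fun h3 => hne (φ.injOn h1.1 hx h3)) (hcrit x' h1 h0)

theorem IsHolomorphic.finite_critical [CompactSpace X] {f : X → Y} (hf : IsHolomorphic f)
    (hfib : ∀ y, (f ⁻¹' {y}).Finite) :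
    {x | mfderiv 𝓘(ℂ, ℂ) 𝓘(ℂ, ℂ) f x = 0}.Finite := by
  by_contra hinf
  obtain ⟨x, hx⟩ := Set.Infinite.exists_accPt_principal hinf
  rw [accPt_iff_frequently_nhdsNE] at hx
  exact hx ((hf.eventually_mfderiv_ne_zero hfib x).mono fun _ h h' => h h')

theorem IsHolomorphic.finite_discr [CompactSpace X] {f : X → Y} (hf : IsHolomorphic f)
    (hfib : ∀ y, (f ⁻¹' {y}).Finite) : (discr f).Finite :=
  (hf.finite_critical hfib).image f

omit [IsManifold 𝓘(ℂ, ℂ) ω X] [IsManifold 𝓘(ℂ, ℂ) ω Y] in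
theorem isCoveringMap_restrictPreimage [T2Space X] [CompactSpace X] [T2Space Y]
    {f : X → Y} (hf : IsHolomorphic f) {D : Set Y} (hD : discr f ⊆ D) :
    IsCoveringMap (Dᶜ.restrictPreimage f) := by
  refine (IsCoveringMapOn.of_isLocalHomeomorphOn hf.continuous ?_).isCoveringMap_restrictPreimage
  intro x hx
  exact hf.isLocalHomeomorphOn x fun h => hx (hD ⟨x, h, rfl⟩)

end critical

section comp

variable {C : Type u} {C' : Type v} {Y : Type w}
  [TopologicalSpace C] [ChartedSpace ℂ C]
  [TopologicalSpace C'] [ChartedSpace ℂ C']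
  [TopologicalSpace Y] [ChartedSpace ℂ Y]
  {π : C → C'} {g : C' → Y}

theorem mfderiv_comp_eq_zero_left (hπ : IsHolomorphic π) (hg : IsHolomorphic g) {x : C}
    (h : mfderiv 𝓘(ℂ, ℂ) 𝓘(ℂ, ℂ) g (π x) = 0) : mfderiv 𝓘(ℂ, ℂ) 𝓘(ℂ, ℂ) (g ∘ π) x = 0 := by
  rw [mfderiv_comp x (hg.mdifferentiableAt _) (hπ.mdifferentiableAt _), h]
  ext
  simp

theorem mfderiv_comp_eq_zero_right (hπ : IsHolomorphic π) (hg : IsHolomorphic g) {x : C}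
    (h : mfderiv 𝓘(ℂ, ℂ) 𝓘(ℂ, ℂ) π x = 0) : mfderiv 𝓘(ℂ, ℂ) 𝓘(ℂ, ℂ) (g ∘ π) x = 0 := by
  rw [mfderiv_comp x (hg.mdifferentiableAt _) (hπ.mdifferentiableAt _), h]
  ext
  simp

theorem IsCovering.surjective {d : ℕ} (hd : d ≠ 0) (hπ : IsCovering π d) :
    Function.Surjective π := by
  intro y
  by_cases hy : y ∈ discr π
  · obtain ⟨x, -, hx⟩ := hy
    exact ⟨x, hx⟩
  · have h := hπ.degree y hy
    obtain ⟨x, hx⟩ := Set.nonempty_of_ncard_ne_zero (h.trans_ne hd)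
    exact ⟨x, hx⟩

/-- This makes g unramified over the complement of the discriminant locus of p, so that the
monodromies of g and p can be compared over one base. -/
theorem discr_subset_discr_comp (hπ : IsHolomorphic π) (hg : IsHolomorphic g)
    (hsurj : Function.Surjective π) : discr g ⊆ discr (g ∘ π) := by
  rintro _ ⟨x', hx', rfl⟩
  obtain ⟨x, rfl⟩ := hsurj x'
  exact ⟨x, mfderiv_comp_eq_zero_left hπ hg hx', rfl⟩

theorem image_discr_subset_discr_comp (hπ : IsHolomorphic π) (hg : IsHolomorphic g) {x' : C'}
    (h : x' ∈ discr π) : g x' ∈ discr (g ∘ π) := by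
  obtain ⟨x, hx, rfl⟩ := h
  exact ⟨x, mfderiv_comp_eq_zero_right hπ hg hx, rfl⟩

end comp

/-! ### Coverings of the projective line -/

/-- The sphere is the union of two simply connected charts, over each of which the covering has a
lift with prescribed initial point. Lifts that agree at 1 agree on the connected overlap ℂ ∖ {0} and
glue. -/
theorem exists_section_sphere_of_coe {E : Type*} [TopologicalSpace E] {h : E → OnePoint ℂ}
    (hh : IsCoveringMap h) {e : E} {z₀ : ℂ} (he : h e = (z₀ : OnePoint ℂ)) :
    ∃ s : OnePoint ℂ → E, Continuous s ∧ (∀ y, h (s y) = y) ∧ s (h e) = e := by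
  let i₀ : C(ℂ, OnePoint ℂ) := ⟨(↑), OnePoint.continuous_coe⟩
  let i₁ : C(ℂ, OnePoint ℂ) := ⟨fun z => sphereInv z, sphereInv.continuous.comp
    OnePoint.continuous_coe⟩
  obtain ⟨s₀, ⟨h₀, hs₀⟩, -⟩ := hh.existsUnique_continuousMap_lifts i₀ z₀ e he
  have h1 : h (s₀ 1) = i₁ 1 := by
    have : h (s₀ 1) = ((1 : ℂ) : OnePoint ℂ) := congrFun hs₀ 1
    rw [this]
    change _ = sphereInvFun ((1 : ℂ) : OnePoint ℂ)
    rw [sphereInvFun_coe one_ne_zero, inv_one]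
  obtain ⟨s₁, ⟨h₁, hs₁⟩, -⟩ := hh.existsUnique_continuousMap_lifts i₁ 1 (s₀ 1) h1
  have hs₀' : ∀ z : ℂ, h (s₀ z) = (z : OnePoint ℂ) := fun z => congrFun hs₀ z
  have hs₁' : ∀ z : ℂ, h (s₁ z) = sphereInv (z : OnePoint ℂ) := fun z => congrFun hs₁ z
  have hagree : ∀ z : ℂ, z ≠ 0 → s₀ z = s₁ z⁻¹ := by
    have hc : IsPreconnected ({0}ᶜ : Set ℂ) :=
      (isConnected_compl_singleton_of_one_lt_rank (by simp) 0).isPreconnected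
    have := hh.eqOn_of_comp_eqOn hc (g₁ := s₀) (g₂ := fun z => s₁ z⁻¹) s₀.continuous.continuousOn
      (s₁.continuous.comp_continuousOn (continuousOn_inv₀.mono fun z hz => hz))
      (fun z hz => by
        have hz' : z ≠ 0 := hz
        change h (s₀ z) = h (s₁ z⁻¹)
        rw [hs₀', hs₁']
        exact (sphereInvFun_coe (inv_ne_zero hz')).trans (by rw [inv_inv]) |>.symm) (a := 1) (by simp)
      (by simp [h₁])
    exact fun z hz => this hz
  let s : OnePoint ℂ → E := fun y => OnePoint.rec (s₁ 0) (fun z => s₀ z) y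
  have hs_coe : ∀ z : ℂ, s z = s₀ z := fun z => rfl
  have hs_inf : s OnePoint.infty = s₁ 0 := rfl
  have hs_inv : ∀ z : ℂ, s (sphereInv z) = s₁ z := by
    intro z
    change s (sphereInvFun z) = _
    by_cases hz : z = 0
    · rw [hz, sphereInvFun_zero, hs_inf]
    · rw [sphereInvFun_coe hz, hs_coe, hagree _ (inv_ne_zero hz), inv_inv]
  refine ⟨s, ?_, ?_, ?_⟩
  · rw [continuous_iff_continuousAt]
    intro y
    induction y using OnePoint.rec with
    | infty =>
      have h2 : ContinuousAt (s ∘ sphereInv) ((0 : ℂ) : OnePoint ℂ) := by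
        rw [OnePoint.continuousAt_coe]
        exact s₁.continuous.continuousAt.congr (Eventually.of_forall fun z => (hs_inv z).symm)
      rw [Homeomorph.comp_continuousAt_iff'] at h2
      have h3 : sphereInv ((0 : ℂ) : OnePoint ℂ) = OnePoint.infty := sphereInvFun_zero
      rwa [h3] at h2
    | coe z =>
      rw [OnePoint.continuousAt_coe]
      exact s₀.continuous.continuousAt
  · intro y
    induction y using OnePoint.rec with
    | infty => rw [hs_inf, hs₁']; exact sphereInvFun_zero
    | coe z => rw [hs_coe, hs₀']
  · rw [he, hs_coe, h₀]

/-- All coverings of the projective line have sections through all points. -/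
theorem IsProjectiveLine.exists_section {Y : Type*} [TopologicalSpace Y] [ChartedSpace ℂ Y]
    (hY : IsProjectiveLine Y) {E : Type*} [TopologicalSpace E] {h : E → Y}
    (hh : IsCoveringMap h) (e : E) :
    ∃ s : Y → E, Continuous s ∧ (∀ y, h (s y) = y) ∧ s (h e) = e := by
  obtain ⟨φ, -, -⟩ := hY
  have key : ∀ ψ : Y ≃ₜ OnePoint ℂ, (∃ z₀ : ℂ, ψ (h e) = z₀) →
      ∃ s : Y → E, Continuous s ∧ (∀ y, h (s y) = y) ∧ s (h e) = e := by
    rintro ψ ⟨z₀, hz⟩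
    obtain ⟨s, h1, h2, h3⟩ := exists_section_sphere_of_coe (hh.homeomorph_comp ψ) hz
    exact ⟨s ∘ ψ, h1.comp ψ.continuous, fun y => ψ.injective (h2 _), h3⟩
  by_cases hy : ∃ z₀ : ℂ, φ (h e) = z₀
  · exact key φ hy
  · refine key (φ.trans sphereInv) ⟨0, ?_⟩
    have : φ (h e) = OnePoint.infty := by
      by_contra hne
      obtain ⟨z, hz⟩ := OnePoint.ne_infty_iff_exists.1 hne
      exact hy ⟨z, hz.symm⟩
    rw [Homeomorph.trans_apply, this]
    exact sphereInvFun_infty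

/-! ### Monodromy of coverings -/

section monodromy

/-- The image under φ of a lifted path is a lift of the same path, so uniqueness of lifts makes
monodromy natural. -/
theorem monodromy_map_apply {X₁ X₂ B : Type*} [TopologicalSpace X₁] [TopologicalSpace X₂]
    [TopologicalSpace B] {q₁ : X₁ → B} {q₂ : X₂ → B} (cov₁ : IsCoveringMap q₁)
    (cov₂ : IsCoveringMap q₂) {φ : X₁ → X₂} (hφ : Continuous φ) (h : ∀ x, q₂ (φ x) = q₁ x)
    {b c : B} (γ : Path.Homotopic.Quotient b c) (x : q₁ ⁻¹' {b}) :
    ((cov₂.monodromy γ ⟨φ x.1, (h x.1).trans x.2⟩ : q₂ ⁻¹' {c}) : X₂) =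
      φ (cov₁.monodromy γ x : q₁ ⁻¹' {c}) := by
  obtain ⟨γ, rfl⟩ := Path.Homotopic.Quotient.mk_surjective γ
  let Γ := cov₁.liftPath γ x.1 (γ.source.trans x.2.symm)
  have h1 : q₁ ∘ Γ = γ := cov₁.liftPath_lifts _ _ _
  have h2 : Γ 0 = x.1 := cov₁.liftPath_zero _ _ _
  have h3 := (cov₂.eq_liftPath_iff' (γ := γ) (e := φ x.1)
    (γ_0 := γ.source.trans ((h x.1).trans x.2).symm)
    (Γ := ⟨φ ∘ Γ, hφ.comp Γ.continuous⟩)).2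
    ⟨(funext fun t => h (Γ t) : q₂ ∘ φ ∘ Γ = q₁ ∘ Γ).trans h1, congrArg φ h2⟩
  exact congr($(h3.symm) 1)

theorem exists_monodromyPerm_apply_eq {X B : Type*} [TopologicalSpace X] [TopologicalSpace B]
    [PathConnectedSpace X] {q : X → B} (cov : IsCoveringMap q) {b : B} (x x' : q ⁻¹' {b}) :
    ∃ γ : FundamentalGroup B b, cov.monodromyPerm b γ x = x' := by
  let ξ : Path.Homotopic.Quotient x.1 x'.1 := .mk (PathConnectedSpace.somePath x.1 x'.1)
  let γ : Path.Homotopic.Quotient b b := (ξ.map ⟨q, cov.continuous⟩).cast x.2.symm x'.2.symm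
  have h : cov.monodromy γ x = x' := cov.monodromy_eq_of_map_eq ξ (by
    exact ((Path.Homotopic.Quotient.cast_cast _ _ _ _ _).trans
      (Path.Homotopic.Quotient.cast_rfl_rfl _)).symm)
  exact ⟨γ, h⟩

theorem _root_.IsCoveringMap.eq_of_homotopicRel {E Y : Type*} [TopologicalSpace E]
    [TopologicalSpace Y] {h : E → Y} (hh : IsCoveringMap h) {e e₁ e₂ : E} (ξ₁ : Path e e₁)
    (ξ₂ : Path e e₂) (H : ((ξ₁.map hh.continuous : Path _ _) : C(unitInterval, Y)).HomotopicRel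
      (ξ₂.map hh.continuous : Path _ _) {0, 1}) : e₁ = e₂ := by
  have h1 := hh.liftPath_apply_one_eq_of_homotopicRel H e (ξ₁.map hh.continuous).source
    (ξ₂.map hh.continuous).source
  have lift : ∀ {e' : E} (ξ : Path e e'), (ξ : C(unitInterval, E)) =
      hh.liftPath (ξ.map hh.continuous : Path _ _) e (ξ.map hh.continuous).source :=
    fun ξ => (hh.eq_liftPath_iff' _).2 ⟨rfl, ξ.source⟩
  rw [← lift, ← lift] at h1
  exact ξ₁.target.symm.trans (h1.trans ξ₂.target)

/-- A covering that admits a map from a connected space inducing a surjection on `π₁` of the base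
has one sheet. -/
theorem subsingleton_fibre_of_surjectiveOnPi1 {X E Y : Type*} [TopologicalSpace X]
    [TopologicalSpace E] [TopologicalSpace Y] [PathConnectedSpace X] {h : E → Y} {f : X → E}
    (hh : IsCoveringMap h) (hf : Continuous f) (hfs : Function.Surjective f) {x : X}
    (hsurj : Function.Surjective (FundamentalGroup.map (⟨h ∘ f, hh.continuous.comp hf⟩ : C(X, Y)) x))
    (e : E) (he : h e = h (f x)) : e = f x := by
  have : PathConnectedSpace E := hfs.pathConnectedSpace hf
  let ξ : Path (f x) e := PathConnectedSpace.somePath (f x) e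
  -- The path ξ from f x to e projects to a loop, homotopic to the image of a loop δ at x. Now f ∘ δ
  -- and ξ start at the same point and have homotopic projections, so both end at f x.
  obtain ⟨δ, hδ⟩ := hsurj (FundamentalGroup.fromPath (.mk ((ξ.map hh.continuous).cast rfl he.symm)))
  obtain ⟨δ, rfl⟩ := Path.Homotopic.Quotient.mk_surjective δ
  have h1 : (δ.map (hh.continuous.comp hf)).Homotopic ((ξ.map hh.continuous).cast rfl he.symm) :=
    Path.Homotopic.Quotient.exact hδ
  exact (hh.eq_of_homotopicRel (δ.map hf) ξ h1).symm

end monodromy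

section fibre

variable {X : Type u} {Y : Type w} [TopologicalSpace X] [ChartedSpace ℂ X] [T2Space X]
  [TopologicalSpace Y] [ChartedSpace ℂ Y] [T2Space Y] {D : Set Y} {q : X → Y}

omit [ChartedSpace ℂ Y] [T2Space Y] in
theorem exists_monodromyPerm_apply_eq_of_finite [ConnectedSpace X]
    (cov : IsCoveringMap (Dᶜ.restrictPreimage q)) (hfin : (q ⁻¹' D).Finite) {y₀ : ↥Dᶜ}
    (x x' : ↥(Dᶜ.restrictPreimage q ⁻¹' {y₀})) : ∃ γ, cov.monodromyPerm y₀ γ x = x' := by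
  have : PathConnectedSpace ↥(q ⁻¹' Dᶜ) := pathConnectedSpace_compl hfin
  exact exists_monodromyPerm_apply_eq cov x x'

/-- An equivalence relation on a fibre of `q` that is invariant under the monodromy and contains the
orbits of small circles around the points of `D` is induced by a factorization through a covering of
`Y`. -/
theorem exists_etale_quotient_of_setoid [CompactSpace X] [ConnectedSpace Y]
    (hD : D.Finite) (hq : Continuous q) (cov : IsCoveringMap (Dᶜ.restrictPreimage q))
    (hfin : (q ⁻¹' D).Finite) (y₀ : ↥Dᶜ) (r : Setoid ↥(Dᶜ.restrictPreimage q ⁻¹' {y₀}))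
    (hr : ∀ g a b, r a b → r (cov.monodromyPerm y₀ g a) (cov.monodromyPerm y₀ g b))
    (hloc : ∀ b ∈ D, ∃ (y : ↥Dᶜ) (δ : Path y₀ y) (γ : Path y y), IsCircleAround b γ ∧
      ∀ a, r a (cov.monodromyPerm y₀ (FundamentalGroup.fromPath
        (Path.Homotopic.Quotient.mk ((δ.trans γ).trans δ.symm))) a)) :
    ∃ (E : Type (max w u)) (_ : TopologicalSpace E) (h : E → Y) (f : X → E),
      IsCoveringMap h ∧ Continuous f ∧ h ∘ f = q ∧ Function.Surjective f ∧
      ∀ y, Nonempty (Quotient r ≃ h ⁻¹' {y}) := by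
  let act : MulAction (FundamentalGroup ↥Dᶜ y₀) (Quotient r) :=
    { smul := fun g => Quotient.map (cov.monodromyPerm y₀ g) (hr g)
      one_smul := by
        rintro ⟨a⟩
        change (⟦cov.monodromyPerm y₀ 1 a⟧ : Quotient r) = ⟦a⟧
        rw [map_one]
        rfl
      mul_smul := by
        rintro g g' ⟨a⟩
        change (⟦cov.monodromyPerm y₀ (g * g') a⟧ : Quotient r) =
          ⟦cov.monodromyPerm y₀ g (cov.monodromyPerm y₀ g' a)⟧
        rw [map_mul]
        rfl }
  let ρ := MulAction.toPermHom (FundamentalGroup ↥Dᶜ y₀) (Quotient r)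
  obtain ⟨E, _, h, f, h1, h2, h3, h4, h5, -⟩ := exists_etale_quotient hD hq cov hfin y₀ ρ
    (fun a => (⟦a⟧ : Quotient r)) Quotient.mk_surjective (fun γ a => rfl)
    (fun b hb => by
      obtain ⟨y, δ, γ, h1, h2⟩ := hloc b hb
      refine ⟨y, δ, γ, h1, Equiv.ext ?_⟩
      rintro ⟨a⟩
      exact (Quotient.sound (h2 a)).symm)
  exact ⟨E, _, h, f, h1, h2, h3, h4, h5⟩

/-- If `q` is surjective on `π₁`, then a normal subgroup of `π₁(Y ∖ D)` that contains small circles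
around all points of `D` acts transitively on the fibres of `q`. -/
theorem exists_mem_monodromyPerm_apply_eq [CompactSpace X] [ConnectedSpace X] [ConnectedSpace Y]
    (hD : D.Finite) (hq : Continuous q) (cov : IsCoveringMap (Dᶜ.restrictPreimage q))
    (hfin : (q ⁻¹' D).Finite) (hπ : SurjectiveOnPi1 hq) (y₀ : ↥Dᶜ)
    (K : Subgroup (FundamentalGroup ↥Dᶜ y₀)) [K.Normal]
    (hloc : ∀ b ∈ D, ∃ (y : ↥Dᶜ) (δ : Path y₀ y) (γ : Path y y), IsCircleAround b γ ∧
      FundamentalGroup.fromPath (Path.Homotopic.Quotient.mk ((δ.trans γ).trans δ.symm)) ∈ K)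
    (x x' : ↥(Dᶜ.restrictPreimage q ⁻¹' {y₀})) : ∃ k ∈ K, cov.monodromyPerm y₀ k x = x' := by
  -- The classes are the orbits of K. Normality makes them invariant under monodromy, and the
  -- quotient covering they define has one sheet because q is surjective on π₁.
  let r : Setoid ↥(Dᶜ.restrictPreimage q ⁻¹' {y₀}) :=
    { r := fun a b => ∃ k ∈ K, cov.monodromyPerm y₀ k a = b
      iseqv :=
        ⟨fun a => ⟨1, K.one_mem, by rw [map_one]; rfl⟩,
          fun {a b} ⟨k, hk, h⟩ => ⟨k⁻¹, K.inv_mem hk, by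
            rw [← h, map_inv]; exact Equiv.symm_apply_apply _ _⟩,
          fun {a b c} ⟨k, hk, h⟩ ⟨l, hl, h'⟩ => ⟨l * k, K.mul_mem hl hk, by
            rw [map_mul, ← h', ← h]; rfl⟩⟩ }
  have hr : ∀ g, ∀ a b, r a b → r (cov.monodromyPerm y₀ g a) (cov.monodromyPerm y₀ g b) := by
    rintro g a b ⟨k, hk, rfl⟩
    refine ⟨g * k * g⁻¹, ‹K.Normal›.conj_mem k hk g, ?_⟩
    rw [← Equiv.Perm.mul_apply, ← Equiv.Perm.mul_apply, ← map_mul, ← map_mul,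
      inv_mul_cancel_right]
  obtain ⟨E, _, h, f, hh, hf, rfl, hfs, hcard⟩ :=
    exists_etale_quotient_of_setoid hD hq cov hfin y₀ r hr (fun b hb => by
      obtain ⟨y, δ, γ, h1, h2⟩ := hloc b hb
      exact ⟨y, δ, γ, h1, fun a => ⟨_, h2, rfl⟩⟩)
  obtain ⟨x₀, hx₀⟩ := hπ
  have : LocallyPathConnectedSpace X := ChartedSpace.locallyPathConnectedSpace ℂ X
  have : PathConnectedSpace X := pathConnectedSpace_iff_connectedSpace.2 inferInstance
  have hsub : Subsingleton (Quotient r) := by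
    obtain ⟨e⟩ := hcard (h (f x₀))
    refine ⟨fun a b => e.injective (Subtype.ext ?_)⟩
    rw [subsingleton_fibre_of_surjectiveOnPi1 hh hf hfs hx₀ _ (e a).2,
      subsingleton_fibre_of_surjectiveOnPi1 hh hf hfs hx₀ _ (e b).2]
  exact Quotient.exact (hsub.elim (⟦x⟧ : Quotient r) ⟦x'⟧)

/-- If all coverings of `Y` have sections, then a normal subgroup of `π₁(Y ∖ D)` that contains small
circles around all points of `D` is the whole group. -/
theorem eq_top_of_sections [ConnectedSpace Y] (hD : D.Finite) (y₀ : ↥Dᶜ)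
    (K : Subgroup (FundamentalGroup ↥Dᶜ y₀)) [K.Normal]
    (hloc : ∀ b ∈ D, ∃ (y : ↥Dᶜ) (δ : Path y₀ y) (γ : Path y y), IsCircleAround b γ ∧
      FundamentalGroup.fromPath (Path.Homotopic.Quotient.mk ((δ.trans γ).trans δ.symm)) ∈ K)
    (hsec : ∀ (E : Type w) [TopologicalSpace E] (h : E → Y), IsCoveringMap h → ∀ e : E,
      ∃ s : Y → E, Continuous s ∧ (∀ y, h (s y) = y) ∧ s (h e) = e) : K = ⊤ := by
  -- Since K is normal, it is the kernel of translation on its cosets. This representation is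
  -- trivial around D, hence trivial by the existence of sections.
  let ρ := MulAction.toPermHom (FundamentalGroup ↥Dᶜ y₀) (FundamentalGroup ↥Dᶜ y₀ ⧸ K)
  have hker : ρ.ker = K := (Subgroup.normalCore_eq_ker K).symm.trans (Subgroup.normalCore_eq_self K)
  have hρ := representation_eq_one_of_sections hD y₀ ρ (fun b hb => by
    obtain ⟨y, δ, γ, h1, h2⟩ := hloc b hb
    exact ⟨y, δ, γ, h1, by rwa [← MonoidHom.mem_ker, hker]⟩) hsec
  rw [← hker]
  exact eq_top_iff.2 fun g _ => hρ g

omit [T2Space Y] in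
/-- A small circle is null-homotopic in `Y`. -/
theorem IsCircleAround.homotopic_refl {b : Y} {y : ↥Dᶜ} {γ : Path y y} (hγ : IsCircleAround b γ) :
    (γ.map continuous_subtype_val).Homotopic (Path.refl (y : Y)) := by
  obtain ⟨r, hr, hsub, -, hγr⟩ := hγ
  let c := chartAt ℂ b b
  let B := Metric.closedBall c r
  have : ContractibleSpace B := (convex_closedBall c r).contractibleSpace
    ⟨c, Metric.mem_closedBall_self hr.le⟩
  have hmem : ∀ t : unitInterval, c + r * Complex.exp (2 * Real.pi * Complex.I * (t : ℝ)) ∈ B := by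
    intro t
    have h : (2 * Real.pi * Complex.I * (t : ℝ) : ℂ) = ((2 * Real.pi * t : ℝ) : ℂ) * Complex.I := by
      push_cast; ring
    rw [mem_closedBall_iff_norm, add_sub_cancel_left, h, norm_mul, Complex.norm_exp_ofReal_mul_I,
      Complex.norm_real, mul_one, Real.norm_of_nonneg hr.le]
  let φ : C(B, Y) := ⟨fun z => (chartAt ℂ b).symm z,
    (chartAt ℂ b).continuousOn_symm.comp_continuous continuous_subtype_val fun z => hsub z.2⟩
  let β : Path (⟨_, hmem 0⟩ : B) ⟨_, hmem 1⟩ :=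
    { toFun := fun t => ⟨_, hmem t⟩
      continuous_toFun := by fun_prop
      source' := rfl
      target' := rfl }
  have hβ : (⟨_, hmem 1⟩ : B) = ⟨_, hmem 0⟩ := Subtype.ext (by
    simp only [Icc.coe_one, Icc.coe_zero, Complex.ofReal_one, mul_one,
      Complex.ofReal_zero, mul_zero, Complex.exp_two_pi_mul_I, Complex.exp_zero])
  have h0 : (y : Y) = φ ⟨_, hmem 0⟩ := by
    rw [← γ.source]
    exact hγr 0
  have h1 : (β.cast rfl hβ.symm).Homotopic (Path.refl _) := SimplyConnectedSpace.paths_homotopic _ _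
  have h2 := (h1.map φ).pathCast h0 h0
  convert h2 using 1
  · exact Path.ext (funext fun t => hγr t)
  · exact Path.ext (funext fun t => h0)

omit [ChartedSpace ℂ X] [T2Space X] [T2Space Y] in
/-- If `q` factors through a covering of `Y`, then the monodromy along a small circle preserves the
fibres of the first factor. -/
theorem apply_monodromyPerm_eq_of_isCircleAround {Z : Type*} [TopologicalSpace Z] {h : Z → Y}
    {f : X → Z} (hh : IsCoveringMap h) (hf : Continuous f) (hfac : h ∘ f = q)
    (cov : IsCoveringMap (Dᶜ.restrictPreimage q)) {y₀ y : ↥Dᶜ} {b : Y} (δ : Path y₀ y)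
    {γ : Path y y} (hγ : IsCircleAround b γ) (x : ↥(Dᶜ.restrictPreimage q ⁻¹' {y₀})) :
    f (cov.monodromyPerm y₀ (FundamentalGroup.fromPath
      (Path.Homotopic.Quotient.mk ((δ.trans γ).trans δ.symm))) x).1.1 = f x.1.1 := by
  let ε := (δ.trans γ).trans δ.symm
  -- The loop is essential at most in Y ∖ D: in Y the disc is filled in and the loop contracts. Its
  -- lift to Z through f is therefore closed.
  have hε : (ε.map continuous_subtype_val).Homotopic (Path.refl (y₀ : Y)) := by
    rw [← Path.Homotopic.Quotient.eq, Path.map_trans, Path.map_trans, ← Path.map_symm,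
      Path.Homotopic.Quotient.mk_trans, Path.Homotopic.Quotient.mk_trans,
      Path.Homotopic.Quotient.eq.2 hγ.homotopic_refl, ← Path.Homotopic.Quotient.mk_trans,
      ← Path.Homotopic.Quotient.mk_trans, Path.Homotopic.Quotient.eq]
    exact (Path.Homotopic.hcomp ⟨Path.Homotopy.transRefl _⟩ (Path.Homotopic.refl _)).trans
      ⟨(Path.Homotopy.reflTransSymm _).symm⟩
  let Γ := cov.liftPath ε x.1 (ε.source.trans x.2.symm)
  have h1 : Dᶜ.restrictPreimage q ∘ Γ = ε := cov.liftPath_lifts _ _ _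
  have h2 : Γ 0 = x.1 := cov.liftPath_zero _ _ _
  let ξ : Path x.1 (Γ 1) := ⟨Γ, h2, rfl⟩
  have hfc : Continuous fun z : ↥(q ⁻¹' Dᶜ) => f z.1 := hf.comp continuous_subtype_val
  refine (hh.eq_of_homotopicRel (Path.refl (f x.1.1)) (ξ.map hfc) ?_).symm
  have hx : h (f x.1.1) = (y₀ : Y) := (congrFun hfac x.1.1).trans (congrArg Subtype.val x.2)
  have e₁ : ((Path.refl (f x.1.1)).map hh.continuous : C(unitInterval, Y)) = Path.refl (y₀ : Y) :=
    ContinuousMap.ext fun t => hx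
  have e₂ : ((ξ.map hfc).map hh.continuous : C(unitInterval, Y)) =
      ε.map continuous_subtype_val := ContinuousMap.ext fun t =>
    (congrFun hfac (Γ t).1).trans (congrArg Subtype.val (congrFun h1 t))
  rw [e₁, e₂]
  exact hε.symm

end fibre

/-! ### The complex structure of an unramified covering -/

section structureOfCovering

/-- The charts of a space over `Y` that come from the charts of `Y`. -/
def pullbackChart {Z Y : Type*} [TopologicalSpace Z] [TopologicalSpace Y] [ChartedSpace ℂ Y]
    {h : Z → Y} (hh : IsLocalHomeomorph h) (z : Z) : OpenPartialHomeomorph Z ℂ :=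
  (hh z).choose.trans (chartAt ℂ (h z))

variable {Z Y : Type*} [TopologicalSpace Z] [TopologicalSpace Y] [ChartedSpace ℂ Y]
    {h : Z → Y} (hh : IsLocalHomeomorph h)

theorem pullbackChart_apply (z z' : Z) : pullbackChart hh z z' = chartAt ℂ (h z) (h z') := by
  have := (hh z).choose_spec.2
  simp only [pullbackChart, OpenPartialHomeomorph.coe_trans, Function.comp_apply]
  rw [← congrFun this z']

theorem mem_pullbackChart_source (z : Z) : z ∈ (pullbackChart hh z).source := by
  have h1 := (hh z).choose_spec
  simp only [pullbackChart, OpenPartialHomeomorph.trans_source]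
  refine ⟨h1.1, ?_⟩
  rw [mem_preimage, ← h1.2]
  exact mem_chart_source ℂ (h z)

theorem apply_mem_of_mem_pullbackChart_source {z z' : Z} (hz : z' ∈ (pullbackChart hh z).source) :
    h z' ∈ (chartAt ℂ (h z)).source := by
  simp only [pullbackChart, OpenPartialHomeomorph.trans_source] at hz
  have := hz.2
  rwa [mem_preimage, ← (hh z).choose_spec.2] at this

theorem apply_pullbackChart_symm {z : Z} {c : ℂ} (hc : c ∈ (pullbackChart hh z).target) :
    h ((pullbackChart hh z).symm c) = (chartAt ℂ (h z)).symm c := by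
  have h1 := (pullbackChart hh z).map_target hc
  have h2 := (pullbackChart hh z).right_inv hc
  rw [pullbackChart_apply] at h2
  rw [← (chartAt ℂ (h z)).left_inv (apply_mem_of_mem_pullbackChart_source hh h1), h2]

/-- The charted space structure that a local homeomorphism `Z → Y` induces on `Z`. -/
@[reducible]
def pullbackChartedSpace : ChartedSpace ℂ Z where
  atlas := range (pullbackChart hh)
  chartAt := pullbackChart hh
  mem_chart_source := mem_pullbackChart_source hh
  chart_mem_atlas z := ⟨z, rfl⟩

variable [IsManifold 𝓘(ℂ, ℂ) ω Y]

/-- A change of pulled-back charts is the restriction of a change of charts of Y. -/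
theorem isManifold_pullbackChartedSpace :
    letI := pullbackChartedSpace hh; IsManifold 𝓘(ℂ, ℂ) ω Z := by
  let _ := pullbackChartedSpace hh
  refine { compatible := ?_ }
  rintro _ _ ⟨z, rfl⟩ ⟨z', rfl⟩
  set e := pullbackChart hh z
  set e' := pullbackChart hh z'
  have h1 : (chartAt ℂ (h z)).symm ≫ₕ chartAt ℂ (h z') ∈ contDiffGroupoid ω 𝓘(ℂ, ℂ) :=
    HasGroupoid.compatible (chart_mem_atlas ℂ _) (chart_mem_atlas ℂ _)
  have h2 : (e.symm ≫ₕ e').source ⊆ ((chartAt ℂ (h z)).symm ≫ₕ chartAt ℂ (h z')).source := by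
    intro c hc
    simp only [mfld_simps] at hc ⊢
    have h3 := apply_mem_of_mem_pullbackChart_source hh (e.map_target hc.1)
    have h4 := apply_mem_of_mem_pullbackChart_source hh hc.2
    rw [apply_pullbackChart_symm hh hc.1] at h4
    refine ⟨?_, h4⟩
    rw [← e.right_inv hc.1, pullbackChart_apply]
    exact (chartAt ℂ (h z)).map_source h3
  refine StructureGroupoid.mem_of_eqOnSource _
    (closedUnderRestriction' h1 (e.symm ≫ₕ e').open_source) ⟨?_, ?_⟩
  · rw [OpenPartialHomeomorph.restr_source' _ _ (e.symm ≫ₕ e').open_source,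
      inter_eq_self_of_subset_right h2]
  · intro c hc
    have h3 : c ∈ e.target := by
      simp only [mfld_simps] at hc
      exact hc.1
    change e' (e.symm c) = chartAt ℂ (h z') ((chartAt ℂ (h z)).symm c)
    rw [pullbackChart_apply, apply_pullbackChart_symm hh h3]

theorem isHolomorphic_pullbackChartedSpace :
    letI := pullbackChartedSpace hh; IsHolomorphic h := by
  let _ := pullbackChartedSpace hh
  have := isManifold_pullbackChartedSpace hh
  intro z
  have h1 : ContMDiffAt 𝓘(ℂ, ℂ) 𝓘(ℂ, ℂ) ω (chartAt ℂ z) z :=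
    contMDiffOn_chart.contMDiffAt ((chartAt ℂ z).open_source.mem_nhds (mem_chart_source ℂ z))
  have h2 : ContMDiffAt 𝓘(ℂ, ℂ) 𝓘(ℂ, ℂ) ω (chartAt ℂ (h z)).symm (chartAt ℂ z z) := by
    refine contMDiffOn_chart_symm.contMDiffAt ((chartAt ℂ (h z)).open_target.mem_nhds ?_)
    change pullbackChart hh z z ∈ _
    rw [pullbackChart_apply]
    exact (chartAt ℂ (h z)).map_source (mem_chart_source ℂ (h z))
  refine (h2.comp z h1).congr_of_eventuallyEq ?_
  filter_upwards [(chartAt ℂ z).open_source.mem_nhds (mem_chart_source ℂ z)] with z' hz'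
  change h z' = (chartAt ℂ (h z)).symm (pullbackChart hh z z')
  rw [pullbackChart_apply,
    (chartAt ℂ (h z)).left_inv (apply_mem_of_mem_pullbackChart_source hh hz')]

theorem mfderiv_pullbackChartedSpace_ne_zero (z : Z) :
    letI := pullbackChartedSpace hh; mfderiv 𝓘(ℂ, ℂ) 𝓘(ℂ, ℂ) h z ≠ 0 := by
  let _ := pullbackChartedSpace hh
  have := isManifold_pullbackChartedSpace hh
  intro h0
  have h1 : ∀ F : Z → ℂ, F = chartAt ℂ (h z) ∘ h → ∀ v : ℂ,
      (mfderiv 𝓘(ℂ, ℂ) 𝓘(ℂ, ℂ) F z : ℂ →L[ℂ] ℂ) v = 0 := by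
    rintro _ rfl v
    rw [mfderiv_comp z (mdifferentiableAt_atlas (I := 𝓘(ℂ, ℂ)) (chart_mem_atlas ℂ (h z))
      (mem_chart_source ℂ (h z))) ((isHolomorphic_pullbackChartedSpace hh).mdifferentiableAt z), h0]
    exact map_zero (mfderiv 𝓘(ℂ, ℂ) 𝓘(ℂ, ℂ) (chartAt ℂ (h z)) (h z))
  have h2 := h1 _ (funext (pullbackChart_apply hh z))
  have h3 := (mdifferentiable_chart (I := 𝓘(ℂ, ℂ)) z).mfderiv_injective (mem_chart_source ℂ z)
  have h4 : (1 : ℂ) = 0 := h3 ((h2 1).trans (h2 0).symm)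
  exact one_ne_zero h4

/-- In pulled-back charts f has the same coordinate expression as `h ∘ f`; continuity keeps nearby
points in one chart. -/
theorem isHolomorphic_of_comp_pullbackChartedSpace {X : Type*} [TopologicalSpace X]
    [ChartedSpace ℂ X] {f : X → Z} (hf : Continuous f) (hhf : IsHolomorphic (h ∘ f)) :
    letI := pullbackChartedSpace hh; IsHolomorphic f := by
  let _ := pullbackChartedSpace hh
  have := isManifold_pullbackChartedSpace hh
  intro x
  set z := f x
  have h1 : ContMDiffAt 𝓘(ℂ, ℂ) 𝓘(ℂ, ℂ) ω (chartAt ℂ (h z)) (h z) :=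
    contMDiffOn_chart.contMDiffAt ((chartAt ℂ (h z)).open_source.mem_nhds (mem_chart_source ℂ _))
  have h2 : ContMDiffAt 𝓘(ℂ, ℂ) 𝓘(ℂ, ℂ) ω (chartAt ℂ z).symm (chartAt ℂ (h z) (h z)) := by
    refine contMDiffOn_chart_symm.contMDiffAt ((chartAt ℂ z).open_target.mem_nhds ?_)
    rw [← pullbackChart_apply hh]
    exact (chartAt ℂ z).map_source (mem_chart_source ℂ z)
  refine ((h2.comp (h z) h1).comp x (hhf x)).congr_of_eventuallyEq ?_
  filter_upwards [hf.continuousAt ((chartAt ℂ z).open_source.mem_nhds (mem_chart_source ℂ z))]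
    with x' hx'
  change f x' = (chartAt ℂ z).symm (chartAt ℂ (h z) (h (f x')))
  rw [← pullbackChart_apply hh]
  exact ((chartAt ℂ z).left_inv hx').symm

end structureOfCovering

/-- A factorization through a topological double covering is a factorization through an étale
double covering of Riemann surfaces. -/
theorem factorsThroughEtaleDouble_of_isCoveringMap {C : Type u} {Y : Type w}
    [TopologicalSpace C] [ChartedSpace ℂ C] [CompactSpace C] [ConnectedSpace C]
    [TopologicalSpace Y] [ChartedSpace ℂ Y] [IsManifold 𝓘(ℂ, ℂ) ω Y] [T2Space Y] {p : C → Y}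
    (hp : IsHolomorphic p) {E : Type*} [TopologicalSpace E] {h : E → Y} {f : C → E}
    (hh : IsCoveringMap h) (hf : Continuous f) (hfac : h ∘ f = p) (hsurj : Function.Surjective f)
    (hcard : ∀ y, (h ⁻¹' {y}).ncard = 2) : FactorsThroughEtaleDouble p := by
  -- The covering was built in a larger universe. Being a quotient of C, it has a copy in the
  -- universe of C, as `FactorsThroughEtaleDouble` demands.
  have : Small.{u} E := small_of_surjective hsurj
  let θ := Shrink.homeomorph.{u} E
  let Z := Shrink.{u} E
  have hk : IsLocalHomeomorph (h ∘ θ.symm) := hh.isLocalHomeomorph.comp θ.symm.isLocalHomeomorph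
  let f' : C → Z := θ ∘ f
  have hf' : Continuous f' := θ.continuous.comp hf
  have hfac' : (h ∘ θ.symm) ∘ f' = p := by
    rw [← hfac]
    funext x
    simp [f']
  have hs' : Function.Surjective f' := θ.surjective.comp hsurj
  have : T2Space E := t2Space_of_isSeparatedMap hh.continuous hh.isSeparatedMap
  let _ := pullbackChartedSpace hk
  have hdisc : discr (h ∘ θ.symm) = ∅ := by
    rw [discr, image_eq_empty]
    exact eq_empty_of_forall_notMem fun z hz => mfderiv_pullbackChartedSpace_ne_zero hk z hz
  have hn : ∀ y, ((h ∘ θ.symm) ⁻¹' {y}).ncard = 2 := by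
    intro y
    rw [preimage_comp, ← θ.image_eq_preimage_symm, ncard_image_of_injective _ θ.injective, hcard]
  refine ⟨Z, inferInstance, pullbackChartedSpace hk, isManifold_pullbackChartedSpace hk,
    θ.symm.isEmbedding.t2Space, hs'.compactSpace hf', hs'.connectedSpace hf', f', h ∘ θ.symm,
    isHolomorphic_of_comp_pullbackChartedSpace hk hf' (by rwa [hfac']),
    ⟨isHolomorphic_pullbackChartedSpace hk,
      fun y => finite_of_ncard_ne_zero (by rw [hn]; exact two_ne_zero), fun y _ => hn y⟩,
    hdisc, hfac'⟩

end BnCovering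

namespace BnCovering

open Set

/-! ### The monodromy group of a covering of type `B_n` -/

section permGroup

variable {n : ℕ}

/-- An isometry in W(B_n) is determined by its action on short roots, which include a basis.
Statements in S_{2n} can thus be transferred to groups of isometries. -/
theorem permGroup_injOn {H K : Subgroup (V n ≃ₗᵢ[ℝ] V n)} (hH : H ≤ weylB n)
    (hHK : permGroup H ≤ permGroup K) : H ≤ K := by
  intro s hs
  let σ : Equiv.Perm (shortRoots n) :=
    { toFun := fun a => ⟨s a, apply_mem_shortRoots (hH hs) a.2⟩
      invFun := fun a => ⟨s⁻¹ a, apply_mem_shortRoots (inv_mem (hH hs)) a.2⟩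
      left_inv := fun a => Subtype.ext (s.symm_apply_apply _)
      right_inv := fun a => Subtype.ext (s.apply_symm_apply _) }
  obtain ⟨t, ht, h⟩ := hHK (show σ ∈ permGroup H from ⟨s, hs, fun a => rfl⟩)
  have : s = t := isometry_ext fun i => h ⟨eps i, eps_mem_shortRoots i⟩
  rwa [this]

theorem permGroup_inj {H K : Subgroup (V n ≃ₗᵢ[ℝ] V n)} (hH : H ≤ weylB n) (hK : K ≤ weylB n)
    (hHK : permGroup H = permGroup K) : H = K :=
  le_antisymm (permGroup_injOn hH hHK.le) (permGroup_injOn hK hHK.ge)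

theorem conjSubgroup_normalizerG1_le {w : V n ≃ₗᵢ[ℝ] V n} (hw : w ∈ weylB n) :
    conjSubgroup w (normalizerG1 n) ≤ weylB n := by
  rintro _ ⟨s, hs, rfl⟩
  exact mul_mem (mul_mem hw (Subgroup.mem_inf.1 hs).1) (inv_mem hw)

theorem apply_mem_longRoots {s : V n ≃ₗᵢ[ℝ] V n} (hs : s ∈ weylB n) {a : V n}
    (ha : a ∈ longRoots n) : s a ∈ longRoots n := by
  obtain ⟨b, hb, c, hc, h0, rfl⟩ := mem_longRoots_iff.1 ha
  rw [map_sub]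
  exact mem_longRoots_iff.2 ⟨_, apply_mem_shortRoots hs hb, _, apply_mem_shortRoots hs hc,
    by rw [s.inner_map_map, h0], rfl⟩

end permGroup

/-! ### Local loops and the normal subgroups they generate -/

section localLoops

variable {Y : Type*} [TopologicalSpace Y] [ChartedSpace ℂ Y] {D : Set Y}

/-- The classes of the loops `δ γ δ⁻¹`, where `γ` is a small circle around a point of `Y`. -/
def localLoops (y₀ : ↥Dᶜ) : Set (FundamentalGroup ↥Dᶜ y₀) :=
  {l | ∃ (b : Y) (y : ↥Dᶜ) (δ : Path y₀ y) (γ : Path y y), IsCircleAround b γ ∧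
    l = FundamentalGroup.fromPath (Path.Homotopic.Quotient.mk ((δ.trans γ).trans δ.symm))}

/-- Conjugation only changes the path leading to the small circle. -/
theorem conj_mem_localLoops {y₀ : ↥Dᶜ} {l : FundamentalGroup ↥Dᶜ y₀} (hl : l ∈ localLoops y₀)
    (g : FundamentalGroup ↥Dᶜ y₀) : g * l * g⁻¹ ∈ localLoops y₀ := by
  obtain ⟨b, y, δ, γ, hγ, rfl⟩ := hl
  obtain ⟨ε, rfl⟩ := Path.Homotopic.Quotient.mk_surjective g
  refine ⟨b, y, ε.symm.trans δ, γ, hγ, ?_⟩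
  simp only [FundamentalGroup.mul_def, FundamentalGroup.inv_def, Path.trans_symm, Path.symm_symm,
    Path.Homotopic.Quotient.mk_trans, Path.Homotopic.Quotient.mk_symm,
    Path.Homotopic.Quotient.trans_assoc]

/-- Local loops mapping to reflections in R form a conjugation-stable set, because W(B_n) preserves
R. The group they generate is therefore normal, and its image is a reflection group. R will be the
set of all roots or of long roots. -/
theorem exists_reflectionSubgroup {n : ℕ} {y₀ : ↥Dᶜ}
    (θ : FundamentalGroup ↥Dᶜ y₀ →* (V n ≃ₗᵢ[ℝ] V n)) (hθ : ∀ γ, θ γ ∈ weylB n) {R : Set (V n)}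
    (hR : ∀ s ∈ weylB n, ∀ a ∈ R, s a ∈ R) :
    ∃ K : Subgroup (FundamentalGroup ↥Dᶜ y₀), K.Normal ∧
      (∀ l ∈ localLoops y₀, ∀ a ∈ R, θ l = refl a → l ∈ K) ∧
      (∃ A ⊆ R, K.map θ = Subgroup.closure (refl '' A)) ∧
      K ≤ Subgroup.closure (localLoops y₀) := by
  let Λ : Set (FundamentalGroup ↥Dᶜ y₀) := {l | l ∈ localLoops y₀ ∧ ∃ a ∈ R, θ l = refl a}
  have hΛ : ∀ l ∈ Λ, ∀ g, g * l * g⁻¹ ∈ Λ := by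
    rintro l ⟨hl, a, ha, h⟩ g
    exact ⟨conj_mem_localLoops hl g, θ g a, hR _ (hθ g) a ha, by
      rw [map_mul, map_mul, map_inv, h, refl_conj]⟩
  refine ⟨Subgroup.closure Λ, ?_, fun l hl a ha h => Subgroup.subset_closure ⟨hl, a, ha, h⟩,
    ⟨{a ∈ R | refl a ∈ θ '' Λ}, fun a ha => ha.1, ?_⟩, Subgroup.closure_mono fun l hl => hl.1⟩
  · have : Subgroup.normalClosure Λ = Subgroup.closure Λ := by
      refine congrArg Subgroup.closure (Subset.antisymm ?_ Group.subset_conjugatesOfSet)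
      intro l hl
      obtain ⟨a, ha, h⟩ := Group.mem_conjugatesOfSet_iff.1 hl
      obtain ⟨c, rfl⟩ := isConj_iff.1 h
      exact hΛ a ha c
    rw [← this]
    infer_instance
  · rw [MonoidHom.map_closure]
    refine congrArg Subgroup.closure (Subset.antisymm ?_ ?_)
    · rintro _ ⟨l, ⟨hl, a, ha, h⟩, rfl⟩
      exact ⟨a, ⟨ha, l, ⟨hl, a, ha, h⟩, h⟩, h.symm⟩
    · rintro _ ⟨a, ⟨-, h⟩, rfl⟩
      exact h

end localLoops

/-! ### The representation of the fundamental group in W(B_n) -/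

section fibres

variable {C : Type u} {C' : Type v} {Y : Type w}
  [TopologicalSpace C] [ChartedSpace ℂ C] [TopologicalSpace C'] [ChartedSpace ℂ C']
  [TopologicalSpace Y] [ChartedSpace ℂ Y]
  {n : ℕ} {π : C → C'} {g : C' → Y} {y₀ : ↥(discr (g ∘ π))ᶜ}

omit [TopologicalSpace C'] [ChartedSpace ℂ C'] in
theorem Fibre.apply_eq (x : Fibre (g ∘ π) y₀) : g (π x.1.1) = y₀ := congrArg Subtype.val x.2

/-- The fibres of `π` over `g⁻¹(y₀)` are the pairs of points that are numbered by opposite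
vectors. -/
theorem Numbering.apply_eq_iff (hπ : IsCovering π 2) (hg : IsHolomorphic g)
    (L : Numbering n π g y₀) (x x' : Fibre (g ∘ π) y₀) :
    π x.1.1 = π x'.1.1 ↔
      (L.toEquiv x' : V n) = L.toEquiv x ∨ (L.toEquiv x' : V n) = -(L.toEquiv x : V n) := by
  constructor
  · intro h
    by_cases hx : x = x'
    · exact Or.inl (by rw [hx])
    · exact Or.inr (L.map_involution x x' hx h)
  · rintro (h | h)
    · rw [L.toEquiv.injective (Subtype.ext h)]
    · have h1 : (π ⁻¹' {π x.1.1}).ncard = 2 := hπ.degree _ fun h0 => y₀.2 (by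
        rw [← Fibre.apply_eq x]
        exact image_discr_subset_discr_comp hπ.holomorphic hg h0)
      obtain ⟨z, hz, hzx⟩ := exists_ne_of_one_lt_ncard (h1 ▸ one_lt_two) x.1.1
      have hz0 : (g ∘ π) z = y₀ := (congrArg g hz).trans (Fibre.apply_eq x)
      let x'' : Fibre (g ∘ π) y₀ := ⟨⟨z, by rw [mem_preimage, hz0]; exact y₀.2⟩, Subtype.ext hz0⟩
      have h2 := L.map_involution x x'' (fun h => hzx (by rw [h])) hz.symm
      rw [L.toEquiv.injective (Subtype.ext (h.trans h2.symm))]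
      exact hz.symm

variable [T2Space C] [CompactSpace C] [T2Space Y]

omit [ChartedSpace ℂ C'] in
theorem monodromyPerm_comp_apply (hπ : Continuous π) (hp : IsHolomorphic (g ∘ π))
    (cov : IsCoveringMap ((discr (g ∘ π))ᶜ.restrictPreimage g))
    (γ : FundamentalGroup ↥(discr (g ∘ π))ᶜ y₀) (x : Fibre (g ∘ π) y₀) :
    (cov.monodromyPerm y₀ γ ⟨⟨π x.1.1, x.1.2⟩, x.2⟩).1.1 = π (monodromy hp y₀ γ x).1.1 := by
  have h := monodromy_map_apply hp.isCoveringMap cov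
    (φ := fun x : ↥((g ∘ π) ⁻¹' (discr (g ∘ π))ᶜ) =>
      (⟨π x.1, x.2⟩ : ↥(g ⁻¹' (discr (g ∘ π))ᶜ)))
    ((hπ.comp continuous_subtype_val).subtype_mk _) (fun _ => rfl) γ x
  exact congrArg Subtype.val h

variable [T2Space C'] [CompactSpace C']

/-- The monodromy of a covering of type `B_n` is given by elements of `W(B_n)`. -/
theorem Numbering.exists_hom (hπ : IsCovering π 2) (hg : IsHolomorphic g)
    (hp : IsHolomorphic (g ∘ π)) (L : Numbering n π g y₀) :
    ∃ θ : FundamentalGroup ↥(discr (g ∘ π))ᶜ y₀ →* (V n ≃ₗᵢ[ℝ] V n), (∀ γ, θ γ ∈ weylB n) ∧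
      ∀ γ x, (L.toEquiv (monodromy hp y₀ γ x) : V n) = θ γ (L.toEquiv x) := by
  have cov := isCoveringMap_restrictPreimage hg
    (discr_subset_discr_comp hπ.holomorphic hg (hπ.surjective two_ne_zero))
  have hex : ∀ γ, ∃ s ∈ weylB n, ∀ x, (L.toEquiv (monodromy hp y₀ γ x) : V n) =
      s (L.toEquiv x) := by
    intro γ
    -- The monodromy of p lies over that of g, so it preserves the fibres of π, that is, opposite
    -- pairs of labels.
    obtain ⟨s, hs, h⟩ := exists_mem_weylB_of_perm
      ((L.toEquiv.symm.trans (monodromy hp y₀ γ)).trans L.toEquiv) (by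
        intro a b hab
        have h1 : π (L.toEquiv.symm a).1.1 = π (L.toEquiv.symm b).1.1 :=
          (L.apply_eq_iff hπ hg _ _).2 (Or.inr (by simpa using hab))
        have h2 : π (monodromy hp y₀ γ (L.toEquiv.symm a)).1.1 =
            π (monodromy hp y₀ γ (L.toEquiv.symm b)).1.1 := by
          rw [← monodromyPerm_comp_apply hπ.holomorphic.continuous hp cov,
            ← monodromyPerm_comp_apply hπ.holomorphic.continuous hp cov]
          congr 4
          exact Subtype.ext h1
        refine L.map_involution _ _ (fun h3 => ?_) h2
        have h4 := L.toEquiv.symm.injective ((monodromy hp y₀ γ).injective h3)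
        exact neg_ne_of_mem_shortRoots a.2 (by rw [← hab, h4]))
    exact ⟨s, hs, fun x => by simpa using h (L.toEquiv x)⟩
  choose s hs h using hex
  refine ⟨MonoidHom.mk' s fun γ γ' => isometry_ext fun i => ?_, hs, h⟩
  obtain ⟨x, hx⟩ := L.toEquiv.surjective ⟨eps i, eps_mem_shortRoots i⟩
  have h1 := h (γ * γ') x
  rw [map_mul, Equiv.Perm.mul_apply, h, h, hx] at h1
  exact h1.symm

end fibres

/-! ### Determination of the monodromy group -/

section monodromyGroup

variable {C : Type u} {C' : Type v} {Y : Type w}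
  [TopologicalSpace C] [ChartedSpace ℂ C] [T2Space C] [CompactSpace C]
  [TopologicalSpace Y] [ChartedSpace ℂ Y] [T2Space Y]
  {n : ℕ} {π : C → C'} {g : C' → Y} {y₀ : ↥(discr (g ∘ π))ᶜ}
  {hp : IsHolomorphic (g ∘ π)} {L : Numbering n π g y₀}
  {θ : FundamentalGroup ↥(discr (g ∘ π))ᶜ y₀ →* (V n ≃ₗᵢ[ℝ] V n)}

theorem monodromyGroup_eq
    (hθL : ∀ γ x, (L.toEquiv (monodromy hp y₀ γ x) : V n) = θ γ (L.toEquiv x)) :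
    monodromyGroup hp L = permGroup θ.range := by
  ext σ
  constructor
  · rintro ⟨_, ⟨γ, rfl⟩, rfl⟩
    refine ⟨θ γ, ⟨γ, rfl⟩, fun a => ?_⟩
    have := hθL γ (L.toEquiv.symm a)
    rwa [L.toEquiv.apply_symm_apply] at this
  · rintro ⟨_, ⟨γ, rfl⟩, h⟩
    refine ⟨_, ⟨γ, rfl⟩, Equiv.ext fun a => Subtype.ext ?_⟩
    have := hθL γ (L.toEquiv.symm a)
    rw [L.toEquiv.apply_symm_apply] at this
    exact this.trans (h a).symm

theorem eq_refl_of_forall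
    (hθL : ∀ γ x, (L.toEquiv (monodromy hp y₀ γ x) : V n) = θ γ (L.toEquiv x))
    {l : FundamentalGroup ↥(discr (g ∘ π))ᶜ y₀} {a : V n}
    (h : ∀ x, (L.toEquiv (monodromy hp y₀ l x) : V n) = refl a (L.toEquiv x)) :
    θ l = refl a := by
  refine isometry_ext fun i => ?_
  obtain ⟨x, hx⟩ := L.toEquiv.surjective ⟨eps i, eps_mem_shortRoots i⟩
  have h1 := (hθL l x).symm.trans (h x)
  rwa [hx] at h1

theorem exists_mem_range_apply_eq [ConnectedSpace C]
    (hθL : ∀ γ x, (L.toEquiv (monodromy hp y₀ γ x) : V n) = θ γ (L.toEquiv x))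
    (hfin : ((g ∘ π) ⁻¹' discr (g ∘ π)).Finite) {a b : V n} (ha : a ∈ shortRoots n)
    (hb : b ∈ shortRoots n) : ∃ s ∈ θ.range, s a = b := by
  obtain ⟨γ, hγ⟩ := exists_monodromyPerm_apply_eq_of_finite hp.isCoveringMap hfin
    (L.toEquiv.symm ⟨a, ha⟩) (L.toEquiv.symm ⟨b, hb⟩)
  refine ⟨θ γ, ⟨γ, rfl⟩, ?_⟩
  have h := hθL γ (L.toEquiv.symm ⟨a, ha⟩)
  rw [L.toEquiv.apply_symm_apply] at h
  rw [← h]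
  change ((L.toEquiv (hp.isCoveringMap.monodromyPerm y₀ γ _) : shortRoots n) : V n) = b
  rw [hγ, L.toEquiv.apply_symm_apply]

theorem exists_mem_localLoops {R : Set (V n)}
    (hθL : ∀ γ x, (L.toEquiv (monodromy hp y₀ γ x) : V n) = θ γ (L.toEquiv x)) {b : Y}
    (hb : b ∈ discrOfType hp L R) :
    ∃ (y : ↥(discr (g ∘ π))ᶜ) (δ : Path y₀ y) (γ : Path y y), IsCircleAround b γ ∧
      ∃ a ∈ R, θ (FundamentalGroup.fromPath
        (Path.Homotopic.Quotient.mk ((δ.trans γ).trans δ.symm))) = refl a := by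
  obtain ⟨-, σ, ⟨y, δ, γ, hγ, rfl⟩, a, ha, h⟩ := hb
  exact ⟨y, δ, γ, hγ, a, ha, eq_refl_of_forall hθL h⟩

/-- A normal subgroup of the fundamental group that contains small circles around all points of the
discriminant locus. -/
structure IsBranchSubgroup {D : Set Y} {y₀ : ↥Dᶜ} (K : Subgroup (FundamentalGroup ↥Dᶜ y₀)) :
    Prop where
  normal : K.Normal
  exists_mem : ∀ b ∈ D, ∃ (y : ↥Dᶜ) (δ : Path y₀ y) (γ : Path y y), IsCircleAround b γ ∧
    FundamentalGroup.fromPath (Path.Homotopic.Quotient.mk ((δ.trans γ).trans δ.symm)) ∈ K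

theorem ne_zero_of_isSimplyRamified (hram : IsSimplyRamified hp L) : n ≠ 0 := by
  obtain ⟨⟨b, hb⟩, h⟩ := hram
  obtain ⟨-, -, -, a, ha | ha, -⟩ := h b hb
  · obtain ⟨j, -⟩ := ha
    exact Nat.ne_of_gt j.pos
  · obtain ⟨j, -⟩ := ha
    exact Nat.ne_of_gt j.pos

theorem discrOfType_long (hram : IsSimplyRamified hp L) (h0 : discrShort hp L = ∅) {b : Y}
    (hb : b ∈ discr (g ∘ π)) : b ∈ discrOfType hp L (longRoots n) := by
  obtain ⟨-, σ, hσ, a, ha | ha, h⟩ := hram.2 b hb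
  · have h1 : b ∈ discrShort hp L := ⟨hb, σ, hσ, a, ha, h⟩
    rw [h0] at h1
    exact h1.elim
  · exact ⟨hb, σ, hσ, a, ha, h⟩

/-- The subgroup generated by all local reflections already fills W(B_n) once one of them is short;
the transitivity hypothesis `hT` covers both parts of the theorem. -/
theorem range_eq_weylB (hθ : ∀ γ, θ γ ∈ weylB n)
    (hθL : ∀ γ x, (L.toEquiv (monodromy hp y₀ γ x) : V n) = θ γ (L.toEquiv x))
    (hT : ∀ K : Subgroup (FundamentalGroup ↥(discr (g ∘ π))ᶜ y₀), IsBranchSubgroup K →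
      PairTransitive (K.map θ))
    (hram : IsSimplyRamified hp L) (h0 : (discrShort hp L).Nonempty) : θ.range = weylB n := by
  obtain ⟨K, hK, hKl, ⟨A, hA, hN⟩, -⟩ := exists_reflectionSubgroup θ hθ
    (R := shortRoots n ∪ longRoots n)
    (fun s hs a ha => ha.imp (apply_mem_shortRoots hs) (apply_mem_longRoots hs))
  have hKb : IsBranchSubgroup K := ⟨hK, fun b hb => by
    obtain ⟨y, δ, γ, hγ, a, ha, h⟩ := exists_mem_localLoops hθL (hram.2 b hb)
    exact ⟨y, δ, γ, hγ, hKl _ ⟨b, y, δ, γ, hγ, rfl⟩ a ha h⟩⟩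
  obtain ⟨b, hb⟩ := h0
  obtain ⟨y, δ, γ, hγ, a, ha, h⟩ := exists_mem_localLoops hθL hb
  have h1 := weylB_le_of_short hA hN (hT K hKb) ha
    ⟨_, hKl _ ⟨b, y, δ, γ, hγ, rfl⟩ a (Or.inl ha) h, h⟩
  refine le_antisymm ?_ (h1.trans (Subgroup.map_le_range θ K))
  rintro _ ⟨γ, rfl⟩
  exact hθ γ

/-- K is kept inside the group of local loops, since that is what later excludes étale
factorizations. -/
theorem exists_isBranchSubgroup (hθ : ∀ γ, θ γ ∈ weylB n)
    (hθL : ∀ γ x, (L.toEquiv (monodromy hp y₀ γ x) : V n) = θ γ (L.toEquiv x))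
    (hT : ∀ K : Subgroup (FundamentalGroup ↥(discr (g ∘ π))ᶜ y₀), IsBranchSubgroup K →
      PairTransitive (K.map θ))
    (hram : IsSimplyRamified hp L) (h0 : discrShort hp L = ∅) :
    ∃ K : Subgroup (FundamentalGroup ↥(discr (g ∘ π))ᶜ y₀), IsBranchSubgroup K ∧
      K ≤ Subgroup.closure (localLoops y₀) ∧ K.map θ ≤ weylD n ∧
      (weylD n ≤ K.map θ ∨ ∃ w ∈ weylB n, K.map θ = conjSubgroup w (groupG1 n)) := by
  obtain ⟨K, hK, hKl, ⟨A, hA, hN⟩, hKc⟩ := exists_reflectionSubgroup (R := longRoots n) θ hθ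
    (fun s hs a ha => apply_mem_longRoots hs ha)
  have hKb : IsBranchSubgroup K := ⟨hK, fun b hb => by
    obtain ⟨y, δ, γ, hγ, a, ha, h⟩ := exists_mem_localLoops hθL (discrOfType_long hram h0 hb)
    exact ⟨y, δ, γ, hγ, hKl _ ⟨b, y, δ, γ, hγ, rfl⟩ a ha h⟩⟩
  exact ⟨K, hKb, hKc, hN ▸ Subgroup.closure_mono (image_mono hA),
    weylD_le_or_eq_conj hA hN (hT K hKb) (ne_zero_of_isSimplyRamified hram)⟩

/-- The image of a normal subgroup with image a conjugate of `G₁` determines the monodromy group. -/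
theorem range_eq_conj_normalizerG1 [ConnectedSpace C]
    (hθ : ∀ γ, θ γ ∈ weylB n)
    (hθL : ∀ γ x, (L.toEquiv (monodromy hp y₀ γ x) : V n) = θ γ (L.toEquiv x))
    (hfin : ((g ∘ π) ⁻¹' discr (g ∘ π)).Finite) (hn : n ≠ 0)
    {K : Subgroup (FundamentalGroup ↥(discr (g ∘ π))ᶜ y₀)} (hK : K.Normal)
    {w : V n ≃ₗᵢ[ℝ] V n} (hw : w ∈ weylB n) (h : K.map θ = conjSubgroup w (groupG1 n)) :
    θ.range = conjSubgroup w (normalizerG1 n) := by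
  refine eq_conj_normalizerG1 hn hw ?_ (h ▸ Subgroup.map_le_range θ K) ?_
    fun a ha b hb => exists_mem_range_apply_eq hθL hfin ha hb
  · rintro _ ⟨γ, rfl⟩
    exact hθ γ
  · rw [← h]
    rintro _ ⟨γ, rfl⟩ _ ⟨k, hk, rfl⟩
    exact ⟨γ * k * γ⁻¹, hK.conj_mem k hk γ, by rw [map_mul, map_mul, map_inv]⟩

/-- Points of the fibre of g are the pairs ±ε_i, so this is the transitivity of K on that fibre,
read through the numbering. -/
theorem pairTransitive_of_surjectiveOnPi1 [TopologicalSpace C'] [ChartedSpace ℂ C'] [T2Space C']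
    [CompactSpace C'] [ConnectedSpace C']
    [ConnectedSpace Y]
    (hπ : IsCovering π 2) (hg : IsCovering g n)
    (hD : (discr (g ∘ π)).Finite)
    (hθL : ∀ γ x, (L.toEquiv (monodromy hp y₀ γ x) : V n) = θ γ (L.toEquiv x))
    (hsurj : SurjectiveOnPi1 hg.holomorphic.continuous)
    {K : Subgroup (FundamentalGroup ↥(discr (g ∘ π))ᶜ y₀)} (hK : IsBranchSubgroup K) :
    PairTransitive (K.map θ) := by
  intro i j
  have cov := isCoveringMap_restrictPreimage hg.holomorphic
    (discr_subset_discr_comp hπ.holomorphic hg.holomorphic (hπ.surjective two_ne_zero))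
  obtain ⟨x, hx⟩ := L.toEquiv.surjective ⟨eps i, eps_mem_shortRoots i⟩
  obtain ⟨x', hx'⟩ := L.toEquiv.surjective ⟨eps j, eps_mem_shortRoots j⟩
  have := hK.normal
  obtain ⟨k, hk, h⟩ := exists_mem_monodromyPerm_apply_eq hD hg.holomorphic.continuous cov
    (hD.preimage' fun y _ => hg.finite_fibers y) hsurj y₀ K hK.exists_mem
    ⟨⟨π x.1.1, x.1.2⟩, x.2⟩ ⟨⟨π x'.1.1, x'.1.2⟩, x'.2⟩
  have h1 := monodromyPerm_comp_apply hπ.holomorphic.continuous hp cov k x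
  rw [h] at h1
  have h2 := (L.apply_eq_iff hπ hg.holomorphic _ _).1 h1
  rw [hθL, hx, hx'] at h2
  exact ⟨θ k, ⟨k, hk, rfl⟩, h2⟩

theorem eq_top_of_isProjectiveLine [ConnectedSpace Y] (hY : IsProjectiveLine Y) {D : Set Y}
    (hD : D.Finite) {y₀ : ↥Dᶜ} {K : Subgroup (FundamentalGroup ↥Dᶜ y₀)}
    (hK : IsBranchSubgroup K) : K = ⊤ := by
  have := hK.normal
  exact eq_top_of_sections hD y₀ K hK.exists_mem fun E _ h hh e => hY.exists_section hh e

/-- As K is everything, G is the reflection group itself. A conjugate of G₁ cannot send w ε₀ to its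
negative, whereas G does so because C is connected. -/
theorem range_eq_weylD_of_isProjectiveLine [ConnectedSpace C] [ConnectedSpace Y]
    (hY : IsProjectiveLine Y) (hD : (discr (g ∘ π)).Finite)
    (hfin : ((g ∘ π) ⁻¹' discr (g ∘ π)).Finite) (hn : n ≠ 0)
    (hθL : ∀ γ x, (L.toEquiv (monodromy hp y₀ γ x) : V n) = θ γ (L.toEquiv x))
    {K : Subgroup (FundamentalGroup ↥(discr (g ∘ π))ᶜ y₀)} (hK : IsBranchSubgroup K)
    (hKD : K.map θ ≤ weylD n)
    (h : weylD n ≤ K.map θ ∨ ∃ w ∈ weylB n, K.map θ = conjSubgroup w (groupG1 n)) :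
    θ.range = weylD n := by
  have : NeZero n := ⟨hn⟩
  have hr : K.map θ = θ.range := by
    rw [eq_top_of_isProjectiveLine hY hD hK, MonoidHom.range_eq_map]
  rw [hr] at hKD h
  rcases h with h | ⟨w, hw, h⟩
  · exact le_antisymm hKD h
  · obtain ⟨s, hs, h1⟩ := exists_mem_range_apply_eq hθL hfin
      (apply_mem_shortRoots hw (eps_mem_shortRoots 0))
      (apply_mem_shortRoots hw (neg_mem_shortRoots (eps_mem_shortRoots 0)))
    rw [h, mem_conjSubgroup] at hs
    obtain ⟨j, hj⟩ := apply_eps_of_mem_groupG1 hs 0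
    have h2 : (w⁻¹ * s * w) (eps 0) = w⁻¹ (s (w (eps 0))) := rfl
    rw [h2, h1] at hj
    exact absurd (hj.symm.trans (w.symm_apply_apply _)) (eps_ne_neg j 0)

end monodromyGroup

/-! ### Sign blocks for conjugates of G₁ and N(G₁) -/

section signs

variable {n : ℕ}

theorem apply_eq_eps_iff_of_pos {t : V n ≃ₗᵢ[ℝ] V n} (ht : ∀ i, ∃ j, t (eps i) = eps j) {a : V n}
    (ha : a ∈ shortRoots n) : (∃ i, t a = eps i) ↔ ∃ i, a = eps i := by
  obtain ⟨i, rfl | rfl⟩ := ha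
  · exact ⟨fun _ => ⟨i, rfl⟩, fun _ => ht i⟩
  · obtain ⟨j, hj⟩ := ht i
    refine ⟨?_, ?_⟩
    · rintro ⟨k, hk⟩
      rw [map_neg, hj] at hk
      exact absurd hk.symm (eps_ne_neg k j)
    · rintro ⟨k, hk⟩
      exact absurd hk.symm (eps_ne_neg k i)

theorem apply_eq_eps_iff_of_neg {t : V n ≃ₗᵢ[ℝ] V n} (ht : ∀ i, ∃ j, t (eps i) = -eps j) {a : V n}
    (ha : a ∈ shortRoots n) : (∃ i, t a = eps i) ↔ ¬ ∃ i, a = eps i := by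
  obtain ⟨i, rfl | rfl⟩ := ha
  · obtain ⟨j, hj⟩ := ht i
    refine ⟨?_, fun h => absurd ⟨i, rfl⟩ h⟩
    rintro ⟨k, hk⟩
    exact absurd (hk.symm.trans hj) (eps_ne_neg k j)
  · obtain ⟨j, hj⟩ := ht i
    refine ⟨?_, fun _ => ⟨j, by rw [map_neg, hj, neg_neg]⟩⟩
    rintro - ⟨k, hk⟩
    exact absurd hk.symm (eps_ne_neg k i)

/-- `a` is a positive short root with respect to the basis `w ε_i`. -/
def IsPos (w : V n ≃ₗᵢ[ℝ] V n) (a : V n) : Prop := ∃ i, w⁻¹ a = eps i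

theorem inv_mul_mul_apply (w s : V n ≃ₗᵢ[ℝ] V n) (a : V n) :
    (w⁻¹ * s * w) (w⁻¹ a) = w⁻¹ (s a) :=
  congrArg (fun b => w⁻¹ (s b)) (w.apply_symm_apply a)

theorem isPos_apply_iff_of_mem_groupG1 {w s : V n ≃ₗᵢ[ℝ] V n} (hw : w ∈ weylB n)
    (hs : s ∈ conjSubgroup w (groupG1 n)) {a : V n} (ha : a ∈ shortRoots n) :
    IsPos w (s a) ↔ IsPos w a := by
  have h := apply_eq_eps_iff_of_pos (apply_eps_of_mem_groupG1 (mem_conjSubgroup.1 hs))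
    (apply_mem_shortRoots (inv_mem hw) ha)
  rwa [inv_mul_mul_apply] at h

/-- An element of N(G₁) preserves all signs or reverses all of them, so having equal signs is an
invariant relation although the sign itself is not. -/
theorem isPos_apply_iff_iff {w s : V n ≃ₗᵢ[ℝ] V n} (hw : w ∈ weylB n)
    (hs : s ∈ conjSubgroup w (normalizerG1 n)) {a b : V n} (ha : a ∈ shortRoots n)
    (hb : b ∈ shortRoots n) (h : IsPos w a ↔ IsPos w b) :
    IsPos w (s a) ↔ IsPos w (s b) := by
  have ha' := apply_mem_shortRoots (inv_mem hw) ha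
  have hb' := apply_mem_shortRoots (inv_mem hw) hb
  rcases apply_eps_of_mem_normalizerG1 (mem_conjSubgroup.1 hs) with ht | ht
  · have h1 := apply_eq_eps_iff_of_pos ht ha'
    have h2 := apply_eq_eps_iff_of_pos ht hb'
    rw [inv_mul_mul_apply] at h1 h2
    exact h1.trans (h.trans h2.symm)
  · have h1 := apply_eq_eps_iff_of_neg ht ha'
    have h2 := apply_eq_eps_iff_of_neg ht hb'
    rw [inv_mul_mul_apply] at h1 h2
    exact h1.trans ((not_congr h).trans h2.symm)

/-- For `n ≤ 2` the conjugates of `N(G₁)` contain `W(D_n)`. -/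
theorem weylD_le_conj_normalizerG1 (hn : n ≤ 2) {w : V n ≃ₗᵢ[ℝ] V n} (hw : w ∈ weylB n) :
    weylD n ≤ conjSubgroup w (normalizerG1 n) := by
  intro s hs
  have h1 : weylD n ≤ normalizerG1 n := by
    obtain rfl | hn := hn.eq_or_lt
    · exact weylD_two_le_normalizerG1
    -- For n ≤ 1 there are no long roots, so the closure has no generators.
    · refine (Subgroup.closure_le _).2 ?_
      rintro _ ⟨d, ⟨i, j, hij, -⟩, rfl⟩
      omega
  have h2 := conj_mem_weylD (inv_mem hw) hs
  rw [inv_inv] at h2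
  exact mem_conjSubgroup.2 (h1 h2)

end signs

/-! ### Étale double coverings -/

section factorization

variable {C : Type u} {C' : Type v} {Y : Type w}
  [TopologicalSpace C] [ChartedSpace ℂ C] [T2Space C] [CompactSpace C]
  [TopologicalSpace Y] [ChartedSpace ℂ Y] [T2Space Y]
  {n : ℕ} {π : C → C'} {g : C' → Y} {y₀ : ↥(discr (g ∘ π))ᶜ}
  {hp : IsHolomorphic (g ∘ π)} {L : Numbering n π g y₀}
  {θ : FundamentalGroup ↥(discr (g ∘ π))ᶜ y₀ →* (V n ≃ₗᵢ[ℝ] V n)}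

/-- If the monodromy group is a conjugate of `N(G₁)`, then the sign character defines an étale double
covering through which the covering factors. -/
theorem factorsThroughEtaleDouble_of_range_eq [ConnectedSpace C] [ConnectedSpace Y]
    [IsManifold 𝓘(ℂ, ℂ) ω Y] (hn : 3 ≤ n) (hD : (discr (g ∘ π)).Finite)
    (hfin : ((g ∘ π) ⁻¹' discr (g ∘ π)).Finite)
    (hθL : ∀ γ x, (L.toEquiv (monodromy hp y₀ γ x) : V n) = θ γ (L.toEquiv x))
    (hram : IsSimplyRamified hp L) (h0 : discrShort hp L = ∅)
    {w : V n ≃ₗᵢ[ℝ] V n} (hw : w ∈ weylB n) (h : θ.range = conjSubgroup w (normalizerG1 n)) :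
    FactorsThroughEtaleDouble (g ∘ π) := by
  have : NeZero n := ⟨by omega⟩
  have hmem : ∀ γ, θ γ ∈ conjSubgroup w (normalizerG1 n) := fun γ => h ▸ ⟨γ, rfl⟩
  let sign : Fibre (g ∘ π) y₀ → Prop := fun x => IsPos w (L.toEquiv x)
  let r : Setoid (Fibre (g ∘ π) y₀) := Setoid.ker sign
  obtain ⟨E, _, k, f, hk, hf, hfac, hfs, hcard⟩ :=
    exists_etale_quotient_of_setoid hD hp.continuous hp.isCoveringMap hfin y₀ r
    (fun γ a b hab => by
      change sign (monodromy hp y₀ γ a) = sign (monodromy hp y₀ γ b)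
      simp only [sign, hθL]
      exact propext (isPos_apply_iff_iff hw (hmem γ) (L.toEquiv a).2 (L.toEquiv b).2
        (iff_of_eq hab)))
    -- The local monodromy is a long reflection in the conjugate of N(G₁), and n ≥ 3 places it in
    -- the conjugate of G₁. It keeps signs, so the double covering is unramified.
    (fun b hb => by
      obtain ⟨y, δ, γ, hγ, a, ha, hl⟩ := exists_mem_localLoops hθL (discrOfType_long hram h0 hb)
      refine ⟨y, δ, γ, hγ, fun x => ?_⟩
      change sign x = sign (monodromy hp y₀ _ x)
      simp only [sign, hθL, hl]
      exact propext (isPos_apply_iff_of_mem_groupG1 hw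
        (refl_mem_conj_groupG1 hn hw ha (hl ▸ hmem _)) (L.toEquiv x).2).symm)
  have hsign : Function.Surjective sign := by
    intro P
    by_cases hP : P
    · refine ⟨L.toEquiv.symm ⟨w (eps 0), apply_mem_shortRoots hw (eps_mem_shortRoots 0)⟩, ?_⟩
      simp only [sign, L.toEquiv.apply_symm_apply, eq_iff_iff, hP, iff_true]
      exact ⟨0, w.symm_apply_apply _⟩
    · refine ⟨L.toEquiv.symm ⟨w (-eps 0), apply_mem_shortRoots hw
        (neg_mem_shortRoots (eps_mem_shortRoots 0))⟩, ?_⟩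
      simp only [sign, L.toEquiv.apply_symm_apply, eq_iff_iff, hP, iff_false]
      rintro ⟨i, hi⟩
      exact eps_ne_neg i 0 (hi.symm.trans (w.symm_apply_apply _))
  have hr : Nat.card (Quotient r) = 2 := by
    rw [Nat.card_congr (Setoid.quotientKerEquivOfSurjective sign hsign)]
    simp
  refine factorsThroughEtaleDouble_of_isCoveringMap hp hk hf hfac hfs fun y => ?_
  obtain ⟨e⟩ := hcard y
  rw [← Nat.card_coe_set_eq, ← Nat.card_congr e, hr]

/-- Each local loop contracts in Y and so acts trivially on the fibre of h; the property passes to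
products and inverses. -/
theorem apply_monodromy_eq_of_mem_closure {Z : Type*} [TopologicalSpace Z] {h : Z → Y} {f : C → Z}
    (hh : IsCoveringMap h) (hf : Continuous f) (hfac : h ∘ f = g ∘ π)
    {k : FundamentalGroup ↥(discr (g ∘ π))ᶜ y₀} (hk : k ∈ Subgroup.closure (localLoops y₀))
    (x : Fibre (g ∘ π) y₀) : f (monodromy hp y₀ k x).1.1 = f x.1.1 := by
  have hl : ∀ l ∈ localLoops y₀, ∀ x : Fibre (g ∘ π) y₀,
      f (monodromy hp y₀ l x).1.1 = f x.1.1 := by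
    rintro _ ⟨b, y, δ, γ, hγ, rfl⟩ x
    exact apply_monodromyPerm_eq_of_isCircleAround hh hf hfac hp.isCoveringMap δ hγ x
  induction hk using Subgroup.closure_induction generalizing x with
  | mem l hl' => exact hl l hl' x
  | one => rw [map_one]; rfl
  | mul k k' _ _ ih ih' => rw [map_mul, Equiv.Perm.mul_apply, ih, ih']
  | inv k _ ih =>
    have := ih (monodromy hp y₀ k⁻¹ x)
    rw [← Equiv.Perm.mul_apply, ← map_mul, mul_inv_cancel, map_one] at this
    exact this.symm

theorem IsHolomorphic.isCoveringMap_of_discr_eq_empty {Z : Type*} [TopologicalSpace Z]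
    [ChartedSpace ℂ Z] [T2Space Z] [CompactSpace Z] {h : Z → Y} (hh : IsHolomorphic h)
    (h0 : discr h = ∅) : IsCoveringMap h := by
  rw [isCoveringMap_iff_isCoveringMapOn_univ, ← compl_empty, ← h0]
  refine IsCoveringMapOn.of_isLocalHomeomorphOn hh.continuous ?_
  intro x hx
  exact hh.isLocalHomeomorphOn x fun h => hx ⟨x, h, rfl⟩

/-- A covering of type `B_n` whose monodromy group contains enough local monodromies to be transitive
does not factor through an étale double covering. -/
theorem not_factorsThroughEtaleDouble [ConnectedSpace C] (hn : 2 ≤ n)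
    (hD : (discr (g ∘ π)).Finite)
    (hθL : ∀ γ x, (L.toEquiv (monodromy hp y₀ γ x) : V n) = θ γ (L.toEquiv x))
    {K : Subgroup (FundamentalGroup ↥(discr (g ∘ π))ᶜ y₀)}
    (hK : K ≤ Subgroup.closure (localLoops y₀)) (h : weylD n ≤ K.map θ) :
    ¬ FactorsThroughEtaleDouble (g ∘ π) := by
  rintro ⟨Z, _, _, _, _, _, _, f, k, hf, hk, hk0, hfac⟩
  have hkc := hk.holomorphic.isCoveringMap_of_discr_eq_empty hk0
  have cov := isCoveringMap_restrictPreimage hk.holomorphic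
    (show discr k ⊆ discr (g ∘ π) by rw [hk0]; exact empty_subset _)
  let x₀ : Fibre (g ∘ π) y₀ := L.toEquiv.symm ⟨eps ⟨0, by omega⟩, eps_mem_shortRoots _⟩
  -- Local loops reach every point of the fibre, because W(D_n) is transitive on short roots, and
  -- they do not change the value of f.
  have hconst : ∀ x : Fibre (g ∘ π) y₀, f x.1.1 = f x₀.1.1 := by
    intro x
    obtain ⟨s, hs, hsx⟩ := exists_mem_weylD_apply_eq hn (L.toEquiv x₀).2 (L.toEquiv x).2
    obtain ⟨l, hl, rfl⟩ := h hs
    rw [← hθL] at hsx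
    rw [← apply_monodromy_eq_of_mem_closure (hp := hp) hkc hf.continuous hfac (hK hl) x₀,
      L.toEquiv.injective (Subtype.ext hsx)]
  have hx₀ : k (f x₀.1.1) = y₀ := (congrFun hfac x₀.1.1).trans (Fibre.apply_eq x₀)
  have h2 : (k ⁻¹' {(y₀ : Y)}).ncard = 2 := hk.degree _ (by rw [hk0]; exact id)
  obtain ⟨z, hz, hne⟩ := exists_ne_of_one_lt_ncard (h2 ▸ one_lt_two) (f x₀.1.1)
  let φ : ↥((g ∘ π) ⁻¹' (discr (g ∘ π))ᶜ) → ↥(k ⁻¹' (discr (g ∘ π))ᶜ) := fun x =>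
    ⟨f x.1, by rw [mem_preimage, ← Function.comp_apply (f := k), hfac]; exact x.2⟩
  have hφ : Continuous φ := (hf.continuous.comp continuous_subtype_val).subtype_mk _
  have hφc : ∀ x, (discr (g ∘ π))ᶜ.restrictPreimage k (φ x) =
      (discr (g ∘ π))ᶜ.restrictPreimage (g ∘ π) x := fun x => Subtype.ext (congrFun hfac x.1)
  -- As Z is connected, some loop carries f x₀ to the second point z of the fibre of k. By
  -- naturality z is the image of a point of the fibre of p, where f is constant.
  obtain ⟨γ, hγ⟩ := exists_monodromyPerm_apply_eq_of_finite cov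
    (hD.preimage' fun y _ => hk.finite_fibers y) (y₀ := y₀)
    ⟨φ x₀.1, Subtype.ext hx₀⟩ ⟨⟨z, by rw [mem_preimage, hz]; exact y₀.2⟩, Subtype.ext hz⟩
  have h3 := monodromy_map_apply hp.isCoveringMap cov hφ hφc γ x₀
  have h4 : (φ (monodromy hp y₀ γ x₀).1 : Z) = z :=
    (congrArg Subtype.val h3).symm.trans (congrArg (fun e => (e.1.1 : Z)) hγ)
  exact hne (h4.symm.trans (hconst _))

end factorization

end BnCovering

end

/-! ### The main theorem -/

theorem mainTheorem8
    {C : Type u} {C' : Type v} {Y : Type w}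
    [TopologicalSpace C] [ChartedSpace ℂ C] [IsManifold 𝓘(ℂ, ℂ) ω C]
    [T2Space C] [CompactSpace C] [ConnectedSpace C]
    [TopologicalSpace C'] [ChartedSpace ℂ C'] [IsManifold 𝓘(ℂ, ℂ) ω C']
    [T2Space C'] [CompactSpace C']
    [TopologicalSpace Y] [ChartedSpace ℂ Y] [IsManifold 𝓘(ℂ, ℂ) ω Y]
    [T2Space Y] [CompactSpace Y] [ConnectedSpace Y]
    (n : ℕ) (π : C → C') (g : C' → Y)
    (hπ : BnCovering.IsCovering π 2) (hg : BnCovering.IsCovering g n)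
    (y₀ : ↥(BnCovering.discr (g ∘ π))ᶜ) (L : BnCovering.Numbering n π g y₀)
    (hram : BnCovering.IsSimplyRamified (hg.holomorphic.comp hπ.holomorphic) L) :
    let D_s : Set Y := BnCovering.discrShort (hg.holomorphic.comp hπ.holomorphic) L
    let G : Subgroup (Equiv.Perm (BnCovering.shortRoots n)) :=
      BnCovering.monodromyGroup (hg.holomorphic.comp hπ.holomorphic) L
    (BnCovering.SurjectiveOnPi1 hg.holomorphic.continuous →
      (D_s.Nonempty → G = BnCovering.permGroup (BnCovering.weylB n)) ∧
      (D_s = ∅ →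
        (G = BnCovering.permGroup (BnCovering.weylB n) ∨
          G = BnCovering.permGroup (BnCovering.weylD n) ∨
          (3 ≤ n ∧ BnCovering.IsConjNormalizerG1 G)) ∧
        (3 ≤ n →
          (BnCovering.IsConjNormalizerG1 G ↔ BnCovering.FactorsThroughEtaleDouble (g ∘ π))))) ∧
    (BnCovering.IsProjectiveLine Y →
      (D_s.Nonempty → G = BnCovering.permGroup (BnCovering.weylB n)) ∧
      (D_s = ∅ → G = BnCovering.permGroup (BnCovering.weylD n))) := by
  intro D_s G
  set hp := hg.holomorphic.comp hπ.holomorphic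
  have hfib : ∀ y, ((g ∘ π) ⁻¹' {y}).Finite := fun y =>
    (hg.finite_fibers y).preimage' fun x _ => hπ.finite_fibers x
  have hD : (BnCovering.discr (g ∘ π)).Finite := hp.finite_discr hfib
  have hfin : ((g ∘ π) ⁻¹' BnCovering.discr (g ∘ π)).Finite := hD.preimage' fun y _ => hfib y
  have hn := BnCovering.ne_zero_of_isSimplyRamified hram
  have hC' : ConnectedSpace C' :=
    (hπ.surjective two_ne_zero).connectedSpace hπ.holomorphic.continuous
  obtain ⟨θ, hθ, hθL⟩ := L.exists_hom hπ hg.holomorphic hp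
  have hG : G = BnCovering.permGroup θ.range := BnCovering.monodromyGroup_eq hθL
  have hθB : θ.range ≤ BnCovering.weylB n := by
    rintro _ ⟨γ, rfl⟩
    exact hθ γ
  refine ⟨fun hsurj => ?_, fun hY => ?_⟩
  · have hT : ∀ K : Subgroup (FundamentalGroup ↥(BnCovering.discr (g ∘ π))ᶜ y₀),
        BnCovering.IsBranchSubgroup K → BnCovering.PairTransitive (K.map θ) := fun K hK =>
      BnCovering.pairTransitive_of_surjectiveOnPi1 hπ hg hD hθL hsurj hK
    refine ⟨fun hs => by rw [hG, BnCovering.range_eq_weylB hθ hθL hT hram hs], fun hs => ?_⟩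
    obtain ⟨K, hK, hKc, -, h⟩ := BnCovering.exists_isBranchSubgroup hθ hθL hT hram hs
    have hB : BnCovering.weylD n ≤ θ.range →
        θ.range = BnCovering.weylD n ∨ θ.range = BnCovering.weylB n := fun h =>
      BnCovering.eq_weylD_or_eq_weylB h hθB
    have hN : ∀ w ∈ BnCovering.weylB n,
        K.map θ = BnCovering.conjSubgroup w (BnCovering.groupG1 n) →
        θ.range = BnCovering.conjSubgroup w (BnCovering.normalizerG1 n) := fun w hw h =>
      BnCovering.range_eq_conj_normalizerG1 hθ hθL hfin hn hK.normal hw h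
    refine ⟨?_, fun h3 => ⟨?_, fun hfac => ?_⟩⟩
    -- The split concerns G rather than the image of K: for n ≤ 2 a conjugate of N(G₁) also contains
    -- W(D_n), so the remaining case forces n ≥ 3.
    · by_cases hD' : BnCovering.weylD n ≤ θ.range
      · rcases hB hD' with h1 | h1
        · exact Or.inr (Or.inl (by rw [hG, h1]))
        · exact Or.inl (by rw [hG, h1])
      · obtain ⟨w, hw, h1⟩ := h.resolve_left fun h =>
          hD' (h.trans (Subgroup.map_le_range θ K))
        have h2 := hN w hw h1
        refine Or.inr (Or.inr ⟨?_, w, hw, by rw [hG, h2]⟩)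
        by_contra h3
        exact hD' (h2 ▸ BnCovering.weylD_le_conj_normalizerG1 (by omega) hw)
    · rintro ⟨w, hw, h1⟩
      refine BnCovering.factorsThroughEtaleDouble_of_range_eq h3 hD hfin hθL hram hs hw
        (BnCovering.permGroup_inj hθB (BnCovering.conjSubgroup_normalizerG1_le hw) ?_)
      rw [← hG, h1]
    -- The étale factorization excludes W(D_n) from the image of K, leaving only the conjugate of
    -- G₁.
    · obtain ⟨w, hw, h1⟩ := h.resolve_left fun h =>
        BnCovering.not_factorsThroughEtaleDouble (by omega) hD hθL hKc h hfac
      exact ⟨w, hw, by rw [hG, hN w hw h1]⟩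
  -- Over ℙ¹ the subgroup K is everything, so its transitivity is that of the full monodromy on the
  -- connected curve C; this replaces the hypothesis on g_*.
  · have hT : ∀ K : Subgroup (FundamentalGroup ↥(BnCovering.discr (g ∘ π))ᶜ y₀),
        BnCovering.IsBranchSubgroup K → BnCovering.PairTransitive (K.map θ) := by
      intro K hK i j
      obtain ⟨s, ⟨γ, rfl⟩, hs⟩ := BnCovering.exists_mem_range_apply_eq hθL hfin
        (BnCovering.eps_mem_shortRoots i) (BnCovering.eps_mem_shortRoots j)
      rw [BnCovering.eq_top_of_isProjectiveLine hY hD hK]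
      exact ⟨θ γ, ⟨γ, Subgroup.mem_top γ, rfl⟩, Or.inl hs⟩
    refine ⟨fun hs => by rw [hG, BnCovering.range_eq_weylB hθ hθL hT hram hs], fun hs => ?_⟩
    obtain ⟨K, hK, -, hKD, h⟩ := BnCovering.exists_isBranchSubgroup hθ hθL hT hram hs
    rw [hG, BnCovering.range_eq_weylD_of_isProjectiveLine hY hD hfin hn hθL hK hKD h]
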